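/- Let $X_t=\sum_{i=1}^{N_t}\varepsilon_i$, $t\ge 0$, where $(N_t)$ is, under $\mathbb P_\vartheta$, a homogeneous Poisson process with intensity $\vartheta>0$, and where the $\varepsilon_i$ are independent, independent of $N$, and equal to $\pm 1$ with probability $\tfrac12$ each. For every $T>0$ let $0<\Delta_T\le T$, and observe $X_0,X_{\Delta_T},X_{2\Delta_T},\ldots,X_{n_T\Delta_T}$ with $n_T=\lfloor T/\Delta_T\rfloor$. For $k\in\mathbb Z$ put $f_\Delta(\vartheta,k)=\mathbb P_\vartheta(X_\Delta=k)$, and define $$\widehat\vartheta^{QV}_{T}=\frac1T\sum_{i=1}^{n_T}\big(X_{i\Delta_T}-X_{(i-1)\Delta_T}\big)^2,\qquad \widehat\vartheta^{OS}_{T}=\widehat\vartheta^{QV}_{T}-\frac{\sum_{i=1}^{n_T}\partial_\vartheta\log f_{\Delta_T}\big(\widehat\vartheta^{QV}_{T},X_{i\Delta_T}-X_{(i-1)\Delta_T}\big)}{\sum_{i=1}^{n_T}\partial^2_\vartheta\log f_{\Delta_T}\big(\widehat\vartheta^{QV}_{T},X_{i\Delta_T}-X_{(i-1)\Delta_T}\big)}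 .$$ Let $\mathcal I_\nu(x)=\sum_{m\ge0}\frac{(x/2)^{2m+\nu}}{m!\,(\nu+m)!}$ be the modified Bessel function of the first kind, $h_\Delta(\vartheta,k)=\mathcal I_{|k|+1}(\vartheta\Delta)/\mathcal I_{|k|}(\vartheta\Delta)$, and, for $\Delta>0$, $$I_{T,\Delta}(\vartheta)=T\Delta\,\mathbb E_\vartheta\Big[\big(h_\Delta(\vartheta,X_\Delta)+(\vartheta\Delta)^{-1}|X_\Delta|-1\big)^2\Big],\qquad \mathfrak I_{T,\Delta}(\vartheta)=\lfloor T/\Delta\rfloor\,\mathbb E_\vartheta\big[(\partial_\vartheta\log f_\Delta(\vartheta,X_\Delta))^2\big],$$ the latter being the Fisher information of the observed increments. **Theorem.** Let $\vartheta>0$, and assume that, as $T\to\infty$, one of the following holds: $\Delta_T\to0$ (microscopic regime), or $\Delta_T\to\Delta_\infty\in(0,\infty)$ (intermediate regime), or $\Delta_T\to\infty$ and $T/\Delta_T\to\infty$ (macroscopic regime). Then $$I_{T,\Delta_T}(\vartheta)^{1/2}\big(\widehat\vartheta^{OS}_{T}-\vartheta\big)\longrightarrow\mathcal N(0,1)\quad\text{in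 distribution under }\mathbb P_\vartheta\text{ as }T\to\infty .$$ The one-step estimator is therefore efficient on all scales: the same convergence holds with $I_{T,\Delta_T}(\vartheta)$ replaced by the Fisher information $\mathfrak I_{T,\Delta_T}(\vartheta)$, and also with $I_{T,\Delta_T}(\vartheta)$ replaced by the information of the respective regime, namely $T/\vartheta$ in the microscopic regime, $I_{T,\Delta_\infty}(\vartheta)$ in the intermediate regime, and $T/(2\vartheta^2\Delta_T)$ in the macroscopic regime. -/

import Mathlib

open MeasureTheory ProbabilityTheory Filter Topology
open scoped NNReal ENNReal

noncomputable section

namespace TimeScales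

/-- `N` is a standard homogeneous Poisson process with intensity `ϑ` under `P`: it starts from `0`,
its paths are nondecreasing and right-continuous, and its increments over disjoint intervals are
independent, the increment over `[s, t]` having the Poisson law with parameter `ϑ (t - s)`. -/
structure IsPoissonProcess {Ω : Type*} [MeasurableSpace Ω]
    (N : ℝ≥0 → Ω → ℕ) (ϑ : ℝ) (P : Measure Ω) : Prop where
  measurable : ∀ t, Measurable (N t)
  zero : ∀ᵐ ω ∂P, N 0 ω = 0
  paths : ∀ᵐ ω ∂P, Monotone (fun t => N t ω) ∧
    ∀ t, ContinuousWithinAt (fun s => N s ω) (Set.Ici t) t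
  indep_increments : HasIndepIncrements (fun t ω => (N t ω : ℤ)) P
  increments : ∀ s t : ℝ≥0, s ≤ t →
    HasLaw (fun ω => (N t ω : ℤ) - (N s ω : ℤ))
      ((poissonMeasure (Real.toNNReal (ϑ * ((t : ℝ) - s)))).map (Nat.cast : ℕ → ℤ)) P

/-- The ingredients of the compound Poisson process with symmetric Bernoulli jumps and intensity
`ϑ`: a Poisson process `N` with intensity `ϑ`, and an independent sequence of independent signs
`ε i`, each equal to `1` or `-1` with probability `1 / 2`. The sequence is indexed from `0`, so
that `ε i` is the `(i + 1)`-st jump. -/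
structure IsModel {Ω : Type*} [MeasurableSpace Ω]
    (N : ℝ≥0 → Ω → ℕ) (ε : ℕ → Ω → ℤ) (ϑ : ℝ) (P : Measure Ω) : Prop where
  poisson : IsPoissonProcess N ϑ P
  jump_measurable : ∀ i, Measurable (ε i)
  jump_pos : ∀ i, P {ω | ε i ω = 1} = 1 / 2
  jump_neg : ∀ i, P {ω | ε i ω = -1} = 1 / 2
  jump_indep : iIndepFun ε P
  indep : IndepFun (fun ω i => ε i ω) (fun ω t => N t ω) P

/-- The process `X_t = ∑_{i = 1}^{N_t} ε_i`, started from `X_0 = 0`. -/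
def process {Ω : Type*} (N : ℝ≥0 → Ω → ℕ) (ε : ℕ → Ω → ℤ) (t : ℝ≥0) (ω : Ω) : ℤ :=
  ∑ i ∈ Finset.range (N t ω), ε i ω

/-- The likelihood of one increment, `f_Δ(ϑ, k) = P_ϑ(X_Δ = k)`. -/
def likelihood {Ω : Type*} [MeasurableSpace Ω] (P : ℝ → Measure Ω) (X : ℝ≥0 → Ω → ℤ)
    (Δ : ℝ≥0) (ϑ : ℝ) (k : ℤ) : ℝ :=
  (P ϑ).real {ω | X Δ ω = k}

/-- The score `∂_ϑ log f(ϑ, k)`. -/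
def score (f : ℝ → ℤ → ℝ) (ϑ : ℝ) (k : ℤ) : ℝ :=
  deriv (fun θ => Real.log (f θ k)) ϑ

/-- The second derivative `∂²_ϑ log f(ϑ, k)`. -/
def scoreDeriv (f : ℝ → ℤ → ℝ) (ϑ : ℝ) (k : ℤ) : ℝ :=
  deriv (fun θ => score f θ k) ϑ

/-- The number `⌊T / Δ⌋` of observed increments. -/
def numObs (T Δ : ℝ≥0) : ℕ := ⌊T / Δ⌋₊

/-- The quadratic variation estimator, as a function of the data `x i = X_{iΔ}`. -/
def qvEstimator (T Δ : ℝ≥0) (x : ℕ → ℤ) : ℝ :=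
  1 / (T : ℝ) * ∑ i ∈ Finset.range (numObs T Δ), ((x (i + 1) - x i : ℤ) : ℝ) ^ 2

/-- The one-step estimator: one Newton-Raphson iteration for the log-likelihood built on `f`,
started from the quadratic variation estimator. -/
def osEstimator (f : ℝ → ℤ → ℝ) (T Δ : ℝ≥0) (x : ℕ → ℤ) : ℝ :=
  qvEstimator T Δ x -
    (∑ i ∈ Finset.range (numObs T Δ), score f (qvEstimator T Δ x) (x (i + 1) - x i)) /
      (∑ i ∈ Finset.range (numObs T Δ), scoreDeriv f (qvEstimator T Δ x) (x (i + 1) - x i))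

/-- The one-step estimator evaluated at the observation `(X_0, X_Δ, X_{2Δ}, …)`. -/
def oneStep {Ω : Type*} [MeasurableSpace Ω] (P : ℝ → Measure Ω) (X : ℝ≥0 → Ω → ℤ)
    (T Δ : ℝ≥0) (ω : Ω) : ℝ :=
  osEstimator (likelihood P X Δ) T Δ (fun i => X (i * Δ) ω)

/-- The modified Bessel function of the first kind `I_ν`, for integer order. -/
def besselI (ν : ℕ) (x : ℝ) : ℝ :=
  ∑' m : ℕ, (x / 2) ^ (2 * m + ν) / ((m.factorial : ℝ) * ((ν + m).factorial : ℝ))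

/-- The ratio `h_Δ(ϑ, k) = I_{|k|+1}(ϑΔ) / I_{|k|}(ϑΔ)`. -/
def besselRatio (Δ ϑ : ℝ) (k : ℤ) : ℝ :=
  besselI (k.natAbs + 1) (ϑ * Δ) / besselI k.natAbs (ϑ * Δ)

/-- The information
`I_{T,Δ}(ϑ) = T Δ E_ϑ[(h_Δ(ϑ, X_Δ) + (ϑΔ)⁻¹ |X_Δ| - 1)²]`. -/
def information {Ω : Type*} [MeasurableSpace Ω] (P : ℝ → Measure Ω) (X : ℝ≥0 → Ω → ℤ)
    (T Δ : ℝ≥0) (ϑ : ℝ) : ℝ :=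
  (T : ℝ) * (Δ : ℝ) *
    ∫ ω, (besselRatio Δ ϑ (X Δ ω) + (ϑ * (Δ : ℝ))⁻¹ * |(X Δ ω : ℝ)| - 1) ^ 2 ∂(P ϑ)

/-- The exact Fisher information `⌊T/Δ⌋ E_ϑ[(∂_ϑ log f_Δ(ϑ, X_Δ))²]` of the experiment generated
by the `⌊T/Δ⌋` independent, identically distributed increments. -/
def fisherInformation {Ω : Type*} [MeasurableSpace Ω] (P : ℝ → Measure Ω) (X : ℝ≥0 → Ω → ℤ)
    (T Δ : ℝ≥0) (ϑ : ℝ) : ℝ :=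
  (numObs T Δ : ℝ) * ∫ ω, (score (likelihood P X Δ) ϑ (X Δ ω)) ^ 2 ∂(P ϑ)

/-- Microscopic scale: `Δ_T → 0`. -/
def IsMicroscopic (Δ : ℝ≥0 → ℝ≥0) : Prop := Tendsto Δ atTop (𝓝 0)

/-- Intermediate scale with limit `Δ_∞ ∈ (0, ∞)`: `Δ_T → Δ_∞`. -/
def IsIntermediate (Δ : ℝ≥0 → ℝ≥0) (Δinf : ℝ≥0) : Prop := 0 < Δinf ∧ Tendsto Δ atTop (𝓝 Δinf)

/-- Macroscopic scale: `Δ_T → ∞` and `T / Δ_T → ∞`. -/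
def IsMacroscopic (Δ : ℝ≥0 → ℝ≥0) : Prop :=
  Tendsto Δ atTop atTop ∧ Tendsto (fun T => T / Δ T) atTop atTop

/-- `a_T^{1/2} (Y_T - ϑ) → N(0, 1)` in distribution under `P` as `T → ∞`. -/
def AsympStandardNormal {Ω : Type*} [MeasurableSpace Ω] (P : Measure Ω) [IsProbabilityMeasure P]
    (a : ℝ≥0 → ℝ) (Y : ℝ≥0 → Ω → ℝ) (ϑ : ℝ) : Prop :=
  TendstoInDistribution (fun (T : ℝ≥0) (ω : Ω) => Real.sqrt (a T) * (Y T ω - ϑ)) atTop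
    (id : ℝ → ℝ) (fun _ => P) (gaussianReal 0 1)

end TimeScales

end

/-! With the Poisson path frozen, the increments of X are sums of signs over disjoint blocks.
Integrating out the signs and then the path shows that the observed increments are i.i.d. symmetric
Skellam variables, with mass e^{-x} I_{|k|}(x) at k, where x = ϑΔ (`IsModel.hasLaw_increment`,
`IsModel.iIndepFun_increments`). Intensity and time scale enter only through x, and Newton's step is
equivariant under rescaling. So Δ times the one-step estimator is one Newton step for the parameter
x, started at Δ times the quadratic variation estimator. Write y = ϑΔ_T, n = ⌊T/Δ_T⌋, g for the
score in x, and J for the Fisher information of one Skellam variable. The claim becomes √(nJ(y))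
(Newton step − y) → N(0,1).

The Newton part is classical (`tendstoInDistribution_newton`). If the sum of the g' is close to −nJ
at y and changes little between y and the starting point, the step is y plus (score sum)/(nJ), up to
o(1/√(nJ)) in probability. The normalised score sum is asymptotically normal by a Lyapunov theorem
for triangular arrays (`tendstoInDistribution_sum_row`). The starting point has to be within
O(1/√(nJ)) of y. The quadratic variation is, because J(y) E[k⁴] = J(y)(3y² + y) stays bounded on
every scale.

There remain bounds for J, E[g⁴], E[g'²] and the modulus of continuity of g'. For bounded y,
elementary bounds on the Bessel ratio r = I_{k+1}/I_k, from the three-term recurrence and the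
Riccati equation for r, suffice. They give |J(y) − 1/y| ≤ 3 and a relative Lipschitz bound for g'.
For large y these bounds are too crude, since g has size 1/y by cancellation. There the logarithmic
derivative v of √x I_k(x) solves v' = 1 + (k² − 1/4)/x² − v², and v ≥ 1/2 for every k. Hence −v'
solves a linear equation with damping 2v ≥ 1, and a comparison argument used twice
(`abs_le_of_deriv_add_liouville`) expands g and g' with errors controlled by powers of 1 + k²/x,
whose moments are bounded. This yields 2y²J(y) → 1.

All normalisations in the theorem are asymptotically equivalent: nΔ/T → 1, while yJ(y) → 1 at zero,
J is continuous, and 2y²J(y) → 1 at infinity; Slutsky's lemma transfers the convergence. -/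

noncomputable section

namespace TimeScales

/-! ### Modified Bessel functions of integer order -/

/-- The entire function `F_ν` with `I_ν(x) = (x / 2) ^ ν * F_ν(x ^ 2 / 4)`. -/
def besselSeries (ν : ℕ) (y : ℝ) : ℝ :=
  ∑' m : ℕ, y ^ m / ((m.factorial : ℝ) * ((ν + m).factorial : ℝ))

lemma summable_besselSeries (ν : ℕ) (y : ℝ) :
    Summable fun m : ℕ => y ^ m / ((m.factorial : ℝ) * ((ν + m).factorial : ℝ)) := by
  refine Summable.of_norm_bounded (Real.summable_pow_div_factorial |y|) fun m => ?_
  rw [norm_div, norm_pow, Real.norm_eq_abs, Real.norm_of_nonneg (by positivity)]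
  refine div_le_div_of_nonneg_left (by positivity) (by positivity) ?_
  exact le_mul_of_one_le_right (by positivity) (by exact_mod_cast Nat.factorial_pos _)

/-- Termwise differentiation, dominated on a ball around 0 containing y. In this normalisation
differentiating only raises the order, which keeps the Bessel calculus below algebraic. -/
lemma hasDerivAt_besselSeries (ν : ℕ) (y : ℝ) :
    HasDerivAt (besselSeries ν) (besselSeries (ν + 1) y) y := by
  set R : ℝ := |y| + 1
  have hR : 0 < R := by positivity
  have hu : Summable fun n : ℕ => (n : ℝ) * R ^ (n - 1) / (n.factorial : ℝ) := by
    rw [← summable_nat_add_iff 1]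
    refine (Real.summable_pow_div_factorial R).congr fun n => ?_
    rw [Nat.factorial_succ]
    push_cast
    have : (n.factorial : ℝ) ≠ 0 := by positivity
    field_simp
  have key := hasDerivAt_tsum_of_isPreconnected (𝕜 := ℝ) (F := ℝ)
    (g := fun (n : ℕ) (z : ℝ) => z ^ n / ((n.factorial : ℝ) * ((ν + n).factorial : ℝ)))
    (g' := fun (n : ℕ) (z : ℝ) =>
      ((n : ℝ) * z ^ (n - 1)) / ((n.factorial : ℝ) * ((ν + n).factorial : ℝ)))
    (t := Metric.ball 0 R) (y₀ := y) (y := y) hu Metric.isOpen_ball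
    (convex_ball (0 : ℝ) R).isPreconnected (fun n z _ => (hasDerivAt_pow n z).div_const _)
    (fun n z hz => ?_) (by simp [R]) (summable_besselSeries ν y) (by simp [R])
  · refine key.congr_deriv ?_
    rw [besselSeries, Summable.tsum_eq_zero_add]
    · simp only [Nat.cast_zero, zero_mul, zero_div, zero_add]
      refine tsum_congr fun m => ?_
      rw [Nat.factorial_succ, show ν + 1 + m = ν + (m + 1) by ring]
      push_cast
      have : (m.factorial : ℝ) ≠ 0 := by positivity
      field_simp
    · rw [← summable_nat_add_iff 1]
      refine (summable_besselSeries (ν + 1) y).congr fun m => ?_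
      rw [Nat.factorial_succ, show ν + 1 + m = ν + (m + 1) by ring]
      push_cast
      have : (m.factorial : ℝ) ≠ 0 := by positivity
      field_simp
  · have hz' : |z| ≤ R := by
      rw [mem_ball_zero_iff, Real.norm_eq_abs] at hz
      exact hz.le
    rw [norm_div, norm_mul, norm_pow, Real.norm_eq_abs z, Real.norm_of_nonneg (by positivity),
      Real.norm_of_nonneg (by positivity)]
    refine div_le_div₀ (by positivity) (by gcongr) (by positivity) ?_
    exact le_mul_of_one_le_right (by positivity) (by exact_mod_cast Nat.factorial_pos _)

/-- In each coefficient 1/(ν+m)! = (m + (ν+1))/(ν+1+m)!. The part carrying the factor m becomes y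
F_{ν+2} after a shift of index. -/
lemma besselSeries_recurrence (ν : ℕ) (y : ℝ) :
    besselSeries ν y = y * besselSeries (ν + 2) y + (ν + 1) * besselSeries (ν + 1) y := by
  have h1 : HasSum (fun m : ℕ => (m : ℝ) * (y ^ m / ((m.factorial : ℝ) *
      ((ν + 1 + m).factorial : ℝ)))) (y * besselSeries (ν + 2) y) := by
    rw [hasSum_nat_add_iff' 1 |>.symm]
    simp only [Finset.range_one, Finset.sum_singleton, Nat.cast_zero, zero_mul, sub_zero]
    refine ((summable_besselSeries (ν + 2) y).hasSum.mul_left y).congr_fun fun m => ?_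
    rw [Nat.factorial_succ, show ν + 2 + m = ν + 1 + (m + 1) by ring]
    push_cast
    have : (m.factorial : ℝ) ≠ 0 := by positivity
    field_simp
    ring
  have h2 := (summable_besselSeries (ν + 1) y).hasSum.mul_left ((ν : ℝ) + 1)
  refine ((h1.add h2).congr_fun fun m => ?_).tsum_eq
  rw [show ν + 1 + m = (ν + m) + 1 by ring, Nat.factorial_succ]
  push_cast
  have : (m.factorial : ℝ) ≠ 0 := by positivity
  field_simp
  ring

lemma one_le_factorial_mul_besselSeries (ν : ℕ) {y : ℝ} (hy : 0 ≤ y) :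
    1 / (ν.factorial : ℝ) ≤ besselSeries ν y := by
  have := (summable_besselSeries ν y).le_tsum 0 (fun m _ => by positivity)
  simpa [besselSeries] using this

lemma besselSeries_le (ν : ℕ) {y : ℝ} (hy : 0 ≤ y) :
    besselSeries ν y ≤ Real.exp y / (ν.factorial : ℝ) := by
  rw [Real.exp_eq_exp_ℝ, NormedSpace.exp_eq_tsum_div, ← tsum_div_const]
  refine (summable_besselSeries ν y).tsum_le_tsum (fun m => ?_)
    ((Real.summable_pow_div_factorial y).div_const _)
  rw [div_div]
  gcongr
  omega

lemma besselI_eq (ν : ℕ) (x : ℝ) :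
    besselI ν x = (x / 2) ^ ν * besselSeries ν (x ^ 2 / 4) := by
  rw [besselI, besselSeries, ← tsum_mul_left]
  refine tsum_congr fun m => ?_
  rw [show x ^ 2 / 4 = (x / 2) ^ 2 by ring, ← pow_mul, pow_add]
  ring

lemma besselI_pos (ν : ℕ) {x : ℝ} (hx : 0 < x) : 0 < besselI ν x := by
  rw [besselI_eq]
  have h := one_le_factorial_mul_besselSeries ν (y := x ^ 2 / 4) (by positivity)
  have : 0 < 1 / (ν.factorial : ℝ) := by positivity
  have := this.trans_le h
  positivity

lemma besselI_le (ν : ℕ) {x : ℝ} (hx : 0 ≤ x) :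
    besselI ν x ≤ Real.exp (x ^ 2 / 4) * ((x / 2) ^ ν / (ν.factorial : ℝ)) := by
  rw [besselI_eq]
  have := mul_le_mul_of_nonneg_left (besselSeries_le ν (y := x ^ 2 / 4) (by positivity))
    (show 0 ≤ (x / 2) ^ ν by positivity)
  refine this.trans_eq (by ring)

lemma besselSeries_mono (ν : ℕ) {x y : ℝ} (hx : 0 ≤ x) (hxy : x ≤ y) :
    besselSeries ν x ≤ besselSeries ν y :=
  (summable_besselSeries ν x).tsum_le_tsum (fun m => by gcongr) (summable_besselSeries ν y)

lemma besselI_mono (ν : ℕ) {x y : ℝ} (hx : 0 ≤ x) (hxy : x ≤ y) :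
    besselI ν x ≤ besselI ν y := by
  rw [besselI_eq, besselI_eq]
  have h := besselSeries_mono ν (x := x ^ 2 / 4) (y := y ^ 2 / 4) (by positivity) (by gcongr)
  have h0 : 0 ≤ besselSeries ν (x ^ 2 / 4) :=
    (by positivity : (0 : ℝ) ≤ 1 / (ν.factorial : ℝ)).trans
      (one_le_factorial_mul_besselSeries ν (by positivity))
  have : 0 ≤ y := hx.trans hxy
  gcongr

lemma besselI_recurrence (ν : ℕ) {x : ℝ} (hx : x ≠ 0) :
    besselI ν x = besselI (ν + 2) x + 2 * (ν + 1) / x * besselI (ν + 1) x := by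
  rw [besselI_eq, besselI_eq, besselI_eq, besselSeries_recurrence ν]
  field_simp
  ring

lemma hasDerivAt_besselI (ν : ℕ) {x : ℝ} (hx : x ≠ 0) :
    HasDerivAt (besselI ν) (besselI (ν + 1) x + ν / x * besselI ν x) x := by
  have e : besselI ν = fun x => (x / 2) ^ ν * besselSeries ν (x ^ 2 / 4) :=
    funext (besselI_eq ν)
  have h1 : HasDerivAt (fun x : ℝ => (x / 2) ^ ν) ((ν : ℝ) * (x / 2) ^ (ν - 1) * (1 / 2)) x :=
    ((hasDerivAt_id x).div_const 2).pow ν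
  have h2 : HasDerivAt (fun x : ℝ => x ^ 2 / 4) (x / 2) x := by
    refine ((hasDerivAt_pow 2 x).div_const 4).congr_deriv ?_
    norm_num
    ring
  have h3 := h1.mul ((hasDerivAt_besselSeries ν (x ^ 2 / 4)).comp x h2)
  rw [e]
  refine h3.congr_deriv ?_
  simp only [besselI_eq, Function.comp_def]
  rcases ν with _ | n
  · simp; ring
  · simp only [Nat.add_sub_cancel]
    push_cast
    field_simp
    ring

lemma hasDerivAt_besselI_succ (ν : ℕ) {x : ℝ} (hx : x ≠ 0) :
    HasDerivAt (besselI (ν + 1)) (besselI ν x - (ν + 1) / x * besselI (ν + 1) x) x := by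
  refine (hasDerivAt_besselI (ν + 1) hx).congr_deriv ?_
  rw [besselI_recurrence ν hx]
  push_cast
  ring

/-- In the derivative of I_ν² − I_{ν+1}² the cross terms cancel and a sum of squares with
nonnegative weights remains. At 0 the difference is nonnegative because I_{ν+1}(0) = 0. -/
lemma besselI_succ_le (ν : ℕ) {x : ℝ} (hx : 0 < x) : besselI (ν + 1) x ≤ besselI ν x := by
  have hd : ∀ y : ℝ, 0 < y → HasDerivAt (fun z => besselI ν z ^ 2 - besselI (ν + 1) z ^ 2)
      (2 * ν / y * besselI ν y ^ 2 + 2 * (ν + 1) / y * besselI (ν + 1) y ^ 2) y := by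
    intro y hy
    refine (((hasDerivAt_besselI ν hy.ne').pow 2).sub
      ((hasDerivAt_besselI_succ ν hy.ne').pow 2)).congr_deriv ?_
    push_cast
    ring
  have hcont : ∀ μ : ℕ, Continuous (besselI μ) := by
    intro μ
    have : Continuous (besselSeries μ) :=
      continuous_iff_continuousAt.2 fun y => (hasDerivAt_besselSeries μ y).continuousAt
    rw [show besselI μ = fun x => (x / 2) ^ μ * besselSeries μ (x ^ 2 / 4) from
      funext (besselI_eq μ)]
    fun_prop
  have hmono : MonotoneOn (fun z => besselI ν z ^ 2 - besselI (ν + 1) z ^ 2) (Set.Ici 0) := by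
    refine monotoneOn_of_deriv_nonneg (convex_Ici 0) ?_ ?_ ?_
    · exact (((hcont ν).pow 2).sub ((hcont (ν + 1)).pow 2)).continuousOn
    · intro y hy
      rw [interior_Ici] at hy
      exact (hd y hy).differentiableAt.differentiableWithinAt
    · intro y hy
      rw [interior_Ici] at hy
      have hy' : 0 < y := hy
      rw [(hd y hy).deriv]
      positivity
  have h0 := hmono (Set.mem_Ici.2 le_rfl) (Set.mem_Ici.2 hx.le) hx.le
  have hz : besselI (ν + 1) 0 = 0 := by simp [besselI_eq]
  simp only [hz] at h0
  have : besselI (ν + 1) x ^ 2 ≤ besselI ν x ^ 2 := by nlinarith [sq_nonneg (besselI ν 0)]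
  exact (pow_le_pow_iff_left₀ (besselI_pos _ hx).le (besselI_pos _ hx).le two_ne_zero).1 this

/-- The ratio `I_{k+1}(x) / I_k(x)`. -/
def ratio (k : ℕ) (x : ℝ) : ℝ := besselI (k + 1) x / besselI k x

lemma ratio_pos (k : ℕ) {x : ℝ} (hx : 0 < x) : 0 < ratio k x :=
  div_pos (besselI_pos _ hx) (besselI_pos _ hx)

lemma ratio_le_one (k : ℕ) {x : ℝ} (hx : 0 < x) : ratio k x ≤ 1 :=
  (div_le_one (besselI_pos _ hx)).2 (besselI_succ_le k hx)

/-- One step of the continued fraction of the Bessel ratio. Dropping the next ratio gives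
`two_mul_ratio_le`; bounding it by 1 gives `le_ratio`. -/
lemma inv_ratio (k : ℕ) {x : ℝ} (hx : 0 < x) :
    1 / ratio k x = ratio (k + 1) x + 2 * (k + 1) / x := by
  have h1 := besselI_pos k hx
  have h2 := besselI_pos (k + 1) hx
  rw [ratio, ratio, one_div_div, besselI_recurrence k hx.ne']
  field_simp

lemma two_mul_ratio_le (k : ℕ) {x : ℝ} (hx : 0 < x) : 2 * (k + 1) * ratio k x ≤ x := by
  have h := inv_ratio k hx
  have h1 := ratio_pos k hx
  have h2 := ratio_pos (k + 1) hx
  have h3 : 2 * ((k : ℝ) + 1) / x ≤ 1 / ratio k x := by linarith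
  rwa [div_le_div_iff₀ hx h1, one_mul] at h3

lemma le_ratio (k : ℕ) {x : ℝ} (hx : 0 < x) : x / (x + 2 * (k + 1)) ≤ ratio k x := by
  have h := inv_ratio k hx
  have h1 := ratio_pos k hx
  have h2 := ratio_le_one (k + 1) hx
  have h3 : 1 / ratio k x ≤ 1 + 2 * (k + 1) / x := by linarith
  rw [div_le_iff₀ h1] at h3
  rw [div_le_iff₀ (by positivity)]
  have : (1 + 2 * ((k : ℝ) + 1) / x) * x = x + 2 * (k + 1) := by field_simp
  nlinarith

lemma hasDerivAt_ratio (k : ℕ) {x : ℝ} (hx : 0 < x) :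
    HasDerivAt (ratio k) (1 - ratio k x ^ 2 - (2 * k + 1) / x * ratio k x) x := by
  have h1 := besselI_pos k hx
  refine ((hasDerivAt_besselI_succ k hx.ne').div (hasDerivAt_besselI k hx.ne')
    h1.ne').congr_deriv ?_
  simp only [ratio]
  field_simp
  ring

/-- Both subtracted terms of the Riccati equation lie in [0, 1]. The resulting Lipschitz constant 1
of the ratio does not depend on the order. -/
lemma abs_deriv_ratio_le (k : ℕ) {x : ℝ} (hx : 0 < x) :
    |1 - ratio k x ^ 2 - (2 * k + 1) / x * ratio k x| ≤ 1 := by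
  have h1 := ratio_pos k hx
  have h2 := ratio_le_one k hx
  have h3 := two_mul_ratio_le k hx
  have h4 : (2 * (k : ℝ) + 1) / x * ratio k x ≤ 1 := by
    rw [div_mul_eq_mul_div, div_le_one hx]
    linarith
  have h5 : 0 ≤ (2 * (k : ℝ) + 1) / x * ratio k x := by positivity
  rw [abs_le]
  constructor <;> nlinarith

lemma abs_ratio_sub_le (k : ℕ) {x y : ℝ} (hx : 0 < x) (hy : 0 < y) :
    |ratio k x - ratio k y| ≤ |x - y| := by
  have := (convex_Ioi (0 : ℝ)).norm_image_sub_le_of_norm_hasDerivWithin_le (f := ratio k)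
    (C := 1) (x := y) (y := x)
    (fun z hz => (hasDerivAt_ratio k hz).hasDerivWithinAt)
    (fun z hz => abs_deriv_ratio_le k hz) hy hx
  simpa using this

/-! ### The symmetric Skellam distribution -/

/-- The probability mass function `k ↦ e^{-x} I_{|k|}(x)` of the symmetric Skellam distribution. -/
def skellam (x : ℝ) (k : ℤ) : ℝ := Real.exp (-x) * besselI k.natAbs x

/-- The score `∂_x log (e^{-x} I_{|k|}(x))`. -/
def skellamScore (x : ℝ) (k : ℤ) : ℝ := ratio k.natAbs x + (k.natAbs : ℝ) / x - 1

/-- The second derivative `∂²_x log (e^{-x} I_{|k|}(x))`. -/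
def skellamScoreDeriv (x : ℝ) (k : ℤ) : ℝ :=
  1 - ratio k.natAbs x ^ 2 - (2 * k.natAbs + 1) / x * ratio k.natAbs x - (k.natAbs : ℝ) / x ^ 2

lemma skellam_pos {x : ℝ} (hx : 0 < x) (k : ℤ) : 0 < skellam x k :=
  mul_pos (Real.exp_pos _) (besselI_pos _ hx)

lemma hasDerivAt_skellam {x : ℝ} (hx : 0 < x) (k : ℤ) :
    HasDerivAt (fun y => skellam y k) (skellam x k * skellamScore x k) x := by
  have h1 : HasDerivAt (fun y : ℝ => Real.exp (-y)) (Real.exp (-x) * (-1)) x :=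
    (hasDerivAt_neg x).exp
  refine (h1.mul (hasDerivAt_besselI k.natAbs hx.ne')).congr_deriv ?_
  have := (besselI_pos k.natAbs hx).ne'
  simp only [skellam, skellamScore, ratio]
  field_simp
  ring

lemma hasDerivAt_log_skellam {x : ℝ} (hx : 0 < x) (k : ℤ) :
    HasDerivAt (fun y => Real.log (skellam y k)) (skellamScore x k) x := by
  refine ((hasDerivAt_skellam hx k).log (skellam_pos hx k).ne').congr_deriv ?_
  have := (skellam_pos hx k).ne'
  field_simp

lemma hasDerivAt_skellamScore {x : ℝ} (hx : 0 < x) (k : ℤ) :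
    HasDerivAt (fun y => skellamScore y k) (skellamScoreDeriv x k) x := by
  have h := ((hasDerivAt_ratio k.natAbs hx).add
    ((hasDerivAt_const x (k.natAbs : ℝ)).div (hasDerivAt_id x) hx.ne')).sub_const 1
  refine h.congr_deriv ?_
  simp only [skellamScoreDeriv, id]
  ring

/-- The Kolmogorov forward equation. -/
lemma skellam_mul_score {x : ℝ} (hx : 0 < x) (k : ℤ) :
    skellam x k * skellamScore x k = (skellam x (k + 1) + skellam x (k - 1)) / 2 - skellam x k := by
  have key : ∀ n : ℕ, besselI (n + 1) x * (ratio (n + 1) x + ((n + 1 : ℕ) : ℝ) / x - 1) =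
      (besselI n x + besselI (n + 2) x) / 2 - besselI (n + 1) x := by
    intro n
    have := (besselI_pos (n + 1) hx).ne'
    rw [besselI_recurrence n hx.ne', ratio]
    push_cast
    field_simp
    ring
  simp only [skellam, skellamScore]
  rcases lt_trichotomy k 0 with hk | rfl | hk
  · obtain ⟨n, hn⟩ : ∃ n : ℕ, k.natAbs = n + 1 := ⟨k.natAbs - 1, by omega⟩
    rw [hn, show (k + 1).natAbs = n by omega, show (k - 1).natAbs = n + 2 by omega, mul_assoc, key n]
    ring
  · have := (besselI_pos 0 hx).ne'
    simp [ratio]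
    field_simp
  · obtain ⟨n, hn⟩ : ∃ n : ℕ, k.natAbs = n + 1 := ⟨k.natAbs - 1, by omega⟩
    rw [hn, show (k + 1).natAbs = n + 2 by omega, show (k - 1).natAbs = n by omega, mul_assoc, key n]
    ring

/-- Both sides are the second derivative of the mass at k: the forward equation is differentiated
once more, and derivatives are unique. -/
lemma skellam_mul_scoreDeriv_add {x : ℝ} (hx : 0 < x) (k : ℤ) :
    skellam x k * (skellamScoreDeriv x k + skellamScore x k ^ 2) =
      (skellam x (k + 1) * skellamScore x (k + 1) + skellam x (k - 1) * skellamScore x (k - 1)) / 2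
        - skellam x k * skellamScore x k := by
  have h1 := (hasDerivAt_skellam hx k).mul (hasDerivAt_skellamScore hx k)
  have h2 := (((hasDerivAt_skellam hx (k + 1)).add (hasDerivAt_skellam hx (k - 1))).div_const 2).sub
    (hasDerivAt_skellam hx k)
  have h3 : (fun y => skellam y k * skellamScore y k) =ᶠ[𝓝 x]
      fun y => (skellam y (k + 1) + skellam y (k - 1)) / 2 - skellam y k := by
    filter_upwards [lt_mem_nhds hx] with y hy using skellam_mul_score hy k
  have h4 := (h2.congr_of_eventuallyEq h3).unique h1
  rw [h4]
  ring

/-- The three-term recurrence in a form valid for both signs of k. Summed against a test function it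
becomes Stein's identity `integral_stein`. -/
lemma cast_mul_skellam {x : ℝ} (hx : 0 < x) (k : ℤ) :
    (k : ℝ) * skellam x k = x / 2 * (skellam x (k - 1) - skellam x (k + 1)) := by
  have key : ∀ n : ℕ, ((n : ℝ) + 1) * besselI (n + 1) x =
      x / 2 * (besselI n x - besselI (n + 2) x) := by
    intro n
    rw [besselI_recurrence n hx.ne']
    field_simp
    ring
  simp only [skellam]
  rcases lt_trichotomy k 0 with hk | rfl | hk
  · obtain ⟨n, hn⟩ : ∃ n : ℕ, k = -((n : ℤ) + 1) := ⟨k.natAbs - 1, by omega⟩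
    subst hn
    rw [show (-((n : ℤ) + 1)).natAbs = n + 1 by omega,
      show (-((n : ℤ) + 1) + 1).natAbs = n by omega,
      show (-((n : ℤ) + 1) - 1).natAbs = n + 2 by omega]
    push_cast
    linear_combination (-Real.exp (-x)) * key n
  · simp
  · obtain ⟨n, hn⟩ : ∃ n : ℕ, k = (n : ℤ) + 1 := ⟨k.natAbs - 1, by omega⟩
    subst hn
    rw [show ((n : ℤ) + 1).natAbs = n + 1 by omega,
      show ((n : ℤ) + 1 + 1).natAbs = n + 2 by omega,
      show ((n : ℤ) + 1 - 1).natAbs = n by omega]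
    push_cast
    linear_combination Real.exp (-x) * key n

lemma abs_skellamScore_le {x : ℝ} (hx : 0 < x) (k : ℤ) :
    |skellamScore x k| ≤ (k.natAbs : ℝ) / x + 1 := by
  have h1 := ratio_pos k.natAbs hx
  have h2 := ratio_le_one k.natAbs hx
  have h3 : 0 ≤ (k.natAbs : ℝ) / x := by positivity
  rw [skellamScore, abs_le]
  constructor <;> linarith

lemma abs_skellamScoreDeriv_le {x : ℝ} (hx : 0 < x) (k : ℤ) :
    |skellamScoreDeriv x k| ≤ (k.natAbs : ℝ) / x ^ 2 + 1 := by
  have h1 := abs_deriv_ratio_le k.natAbs hx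
  have h3 : 0 ≤ (k.natAbs : ℝ) / x ^ 2 := by positivity
  rw [abs_le] at h1
  rw [skellamScoreDeriv, abs_le]
  constructor <;> linarith

/-! ### Functions of polynomial growth -/

/-- `φ` grows at most polynomially. -/
def PolyGrowth (φ : ℤ → ℝ) : Prop :=
  ∃ (C : ℝ) (p : ℕ), 0 ≤ C ∧ ∀ k, |φ k| ≤ C * (1 + (k.natAbs : ℝ)) ^ p

namespace PolyGrowth

variable {φ ψ : ℤ → ℝ}

lemma of_le (hψ : PolyGrowth ψ) (h : ∀ k, |φ k| ≤ ψ k) : PolyGrowth φ := by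
  obtain ⟨C, p, hC, hψ⟩ := hψ
  exact ⟨C, p, hC, fun k => (h k).trans ((le_abs_self _).trans (hψ k))⟩

lemma const (c : ℝ) : PolyGrowth fun _ => c := ⟨|c|, 0, abs_nonneg c, fun k => by simp⟩

lemma natAbs : PolyGrowth fun k => (k.natAbs : ℝ) :=
  ⟨1, 1, zero_le_one, fun k => by rw [abs_of_nonneg (by positivity)]; linarith⟩

lemma cast : PolyGrowth fun k => (k : ℝ) :=
  natAbs.of_le fun k => by rw [Nat.cast_natAbs, Int.cast_abs]

lemma add (hφ : PolyGrowth φ) (hψ : PolyGrowth ψ) : PolyGrowth fun k => φ k + ψ k := by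
  obtain ⟨C, p, hC, hφ⟩ := hφ
  obtain ⟨D, q, hD, hψ⟩ := hψ
  refine ⟨C + D, p + q, by positivity, fun k => ?_⟩
  have h1 : (1 : ℝ) ≤ 1 + (k.natAbs : ℝ) := by linarith [(k.natAbs).cast_nonneg (α := ℝ)]
  have h2 := pow_le_pow_right₀ h1 (Nat.le_add_right p q)
  have h3 := pow_le_pow_right₀ h1 (Nat.le_add_left q p)
  calc |φ k + ψ k| ≤ |φ k| + |ψ k| := abs_add_le _ _
    _ ≤ C * (1 + (k.natAbs : ℝ)) ^ p + D * (1 + (k.natAbs : ℝ)) ^ q := add_le_add (hφ k) (hψ k)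
    _ ≤ C * (1 + (k.natAbs : ℝ)) ^ (p + q) + D * (1 + (k.natAbs : ℝ)) ^ (p + q) := by gcongr
    _ = _ := by ring

lemma mul (hφ : PolyGrowth φ) (hψ : PolyGrowth ψ) : PolyGrowth fun k => φ k * ψ k := by
  obtain ⟨C, p, hC, hφ⟩ := hφ
  obtain ⟨D, q, hD, hψ⟩ := hψ
  refine ⟨C * D, p + q, by positivity, fun k => ?_⟩
  rw [abs_mul]
  refine (mul_le_mul (hφ k) (hψ k) (abs_nonneg _) (by positivity)).trans_eq (by ring)

lemma const_mul (c : ℝ) (hφ : PolyGrowth φ) : PolyGrowth fun k => c * φ k := (const c).mul hφ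

lemma neg (hφ : PolyGrowth φ) : PolyGrowth fun k => -φ k := by
  simpa using hφ.const_mul (-1)

lemma sub (hφ : PolyGrowth φ) (hψ : PolyGrowth ψ) : PolyGrowth fun k => φ k - ψ k := by
  simpa [sub_eq_add_neg] using hφ.add hψ.neg

lemma div_const (hφ : PolyGrowth φ) (c : ℝ) : PolyGrowth fun k => φ k / c := by
  simpa [div_eq_inv_mul] using hφ.const_mul c⁻¹

lemma pow (hφ : PolyGrowth φ) (n : ℕ) : PolyGrowth fun k => φ k ^ n := by
  induction n with
  | zero => simpa using const 1
  | succ n ih => simpa [pow_succ] using ih.mul hφ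

lemma comp_add (hφ : PolyGrowth φ) (m : ℤ) : PolyGrowth fun k => φ (k + m) := by
  obtain ⟨C, p, hC, hφ⟩ := hφ
  have h : PolyGrowth fun k => C * (1 + ((k.natAbs : ℝ) + m.natAbs)) ^ p :=
    (((const 1).add (natAbs.add (const _))).pow p).const_mul C
  refine h.of_le fun k => (hφ (k + m)).trans ?_
  have : ((k + m).natAbs : ℝ) ≤ k.natAbs + m.natAbs := by
    exact_mod_cast Int.natAbs_add_le k m
  gcongr

/-- The masses are at most a constant times (x/2)^|k| / |k|!, while (1 + n)^p ≤ p! e^{1+n} by a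
single term of the exponential series. Polynomial growth thus costs only a geometric factor. -/
lemma summable (hφ : PolyGrowth φ) {x : ℝ} (hx : 0 < x) :
    Summable fun k => skellam x k * φ k := by
  obtain ⟨C, p, hC, hφ⟩ := hφ
  set K : ℝ := Real.exp (-x) * Real.exp (x ^ 2 / 4) * C * (p.factorial * Real.exp 1)
  have hn : ∀ n : ℕ, (1 + (n : ℝ)) ^ p ≤ p.factorial * Real.exp 1 * (Real.exp 1) ^ n := by
    intro n
    have h := Real.pow_div_factorial_le_exp (1 + (n : ℝ)) (by positivity) p
    rw [div_le_iff₀ (by positivity)] at h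
    refine h.trans_eq ?_
    rw [Real.exp_add, ← Real.exp_nat_mul, mul_one]
    ring
  have hs : Summable fun n : ℕ => K * ((Real.exp 1 * (x / 2)) ^ n / (n.factorial : ℝ)) :=
    (Real.summable_pow_div_factorial _).mul_left K
  have hb : ∀ k : ℤ, ‖skellam x k * φ k‖ ≤
      K * ((Real.exp 1 * (x / 2)) ^ k.natAbs / (k.natAbs.factorial : ℝ)) := by
    intro k
    rw [norm_mul, Real.norm_eq_abs, Real.norm_eq_abs, abs_of_pos (skellam_pos hx k), skellam]
    calc Real.exp (-x) * besselI k.natAbs x * |φ k|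
        ≤ Real.exp (-x) * (Real.exp (x ^ 2 / 4) * ((x / 2) ^ k.natAbs / (k.natAbs.factorial : ℝ))) *
          (C * (p.factorial * Real.exp 1 * (Real.exp 1) ^ k.natAbs)) := by
          have := besselI_le k.natAbs hx.le
          have h2 := (besselI_pos k.natAbs hx).le
          have h3 := (hφ k).trans (mul_le_mul_of_nonneg_left (hn k.natAbs) hC)
          gcongr
      _ = _ := by simp only [K, mul_pow]; ring
  exact Summable.of_nat_of_neg
    (Summable.of_norm_bounded hs fun n => by simpa using hb n)
    (Summable.of_norm_bounded hs fun n => by simpa using hb (-n))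

end PolyGrowth

lemma polyGrowth_skellamScore {x : ℝ} (hx : 0 < x) : PolyGrowth (skellamScore x) :=
  ((PolyGrowth.natAbs.div_const x).add (.const 1)).of_le (abs_skellamScore_le hx)

lemma polyGrowth_skellamScoreDeriv {x : ℝ} (hx : 0 < x) : PolyGrowth (skellamScoreDeriv x) :=
  ((PolyGrowth.natAbs.div_const (x ^ 2)).add (.const 1)).of_le (abs_skellamScoreDeriv_le hx)

/-- The law of the difference of two independent Poisson variables with parameter `x / 2`. -/
def skellamMeasure (x : ℝ) : Measure ℤ :=
  ((poissonMeasure (x / 2).toNNReal).prod (poissonMeasure (x / 2).toNNReal)).map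
    fun p => (p.1 : ℤ) - p.2

instance (x : ℝ) : IsProbabilityMeasure (skellamMeasure x) :=
  Measure.isProbabilityMeasure_map (by fun_prop)

lemma skellamMeasure_real_singleton {x : ℝ} (hx : 0 < x) (k : ℤ) :
    (skellamMeasure x).real {k} = skellam x k := by
  set r : ℝ≥0 := (x / 2).toNNReal
  have hr : (r : ℝ) = x / 2 := Real.coe_toNNReal _ (by positivity)
  have h1 : (skellamMeasure x).real {k} =
      ∫ b : ℕ, ∫ a : ℕ, Set.indicator {k} (fun _ => (1 : ℝ)) ((a : ℤ) - b)
        ∂(poissonMeasure r) ∂(poissonMeasure r) := by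
    rw [← integral_prod_symm (f := fun p : ℕ × ℕ =>
      Set.indicator {k} (fun _ => (1 : ℝ)) ((p.1 : ℤ) - p.2))]
    · rw [← integral_indicator_one (μ := skellamMeasure x) (s := {k}) (measurableSet_singleton k),
        skellamMeasure, integral_map (by fun_prop) (by fun_prop)]
      rfl
    · refine Integrable.of_bound (C := 1) (by fun_prop) (ae_of_all _ fun p => ?_)
      by_cases h : ((p.1 : ℤ) - p.2) = k <;> simp [h]
  have hp : ∀ n : ℕ, Real.exp (-r) * (r : ℝ) ^ n / (n.factorial : ℝ) =
      Real.exp (-(x / 2)) * (x / 2) ^ n / (n.factorial : ℝ) := fun n => by rw [hr]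
  have hin : ∀ b : ℕ, ∫ a : ℕ, Set.indicator {k} (fun _ => (1 : ℝ)) ((a : ℤ) - b)
      ∂(poissonMeasure r) = if 0 ≤ k + b then
        Real.exp (-(x / 2)) * (x / 2) ^ (k + b).toNat / ((k + b).toNat.factorial : ℝ) else 0 := by
    intro b
    rw [integral_poissonMeasure]
    simp only [hp]
    split_ifs with h
    · rw [tsum_eq_single (k + b).toNat]
      · rw [Set.indicator_of_mem]
        · simp
        · simp only [Set.mem_singleton_iff]; omega
      · intro a ha
        rw [Set.indicator_of_notMem, smul_zero]
        simp only [Set.mem_singleton_iff]; omega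
    · rw [← tsum_zero (α := ℝ) (β := ℕ)]
      refine tsum_congr fun a => ?_
      rw [Set.indicator_of_notMem, smul_zero]
      simp only [Set.mem_singleton_iff]; omega
  rw [h1]
  simp only [hin]
  rw [integral_poissonMeasure]
  simp only [hp, smul_eq_mul]
  have hexp : Real.exp (-x) = Real.exp (-(x / 2)) * Real.exp (-(x / 2)) := by
    rw [← Real.exp_add]; ring_nf
  rw [skellam, besselI, ← tsum_mul_left]
  rcases le_or_gt 0 k with hk | hk
  · obtain ⟨n, rfl⟩ := Int.eq_ofNat_of_zero_le hk
    refine tsum_congr fun m => ?_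
    rw [if_pos (by positivity), show ((n : ℤ) + m).toNat = n + m by omega, Int.natAbs_natCast, hexp]
    rw [show 2 * m + n = m + (n + m) by ring, pow_add (x / 2) m]
    field_simp
  · obtain ⟨n, hn⟩ : ∃ n : ℕ, k = -(n : ℤ) := ⟨k.natAbs, by omega⟩
    subst hn
    -- For k = −n the second Poisson variable must be at least n, so the first n terms of the
    -- convolution vanish.
    rw [← Summable.sum_add_tsum_nat_add' (k := n), Finset.sum_eq_zero, zero_add]
    · refine tsum_congr fun m => ?_
      rw [if_pos (by omega), show (-(n : ℤ) + ((m + n : ℕ) : ℤ)).toNat = m by omega, Int.natAbs_neg,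
        Int.natAbs_natCast, hexp, show m + n = n + m by ring,
        show 2 * m + n = m + (n + m) by ring, pow_add (x / 2) m]
      field_simp
    · intro i hi
      rw [if_neg, mul_zero]
      have := Finset.mem_range.1 hi
      omega
    · have hs := (summable_besselSeries n ((x / 2) ^ 2)).mul_left
        (Real.exp (-(x / 2)) * Real.exp (-(x / 2)) * (x / 2) ^ n)
      refine hs.congr fun m => ?_
      rw [if_pos (by omega), show (-(n : ℤ) + ((m + n : ℕ) : ℤ)).toNat = m by omega,
        show m + n = n + m by ring, ← pow_mul]
      rw [pow_add, two_mul, pow_add]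
      field_simp

lemma hasSum_integral_skellam {φ : ℤ → ℝ} (hφ : PolyGrowth φ) {x : ℝ} (hx : 0 < x) :
    HasSum (fun k => skellam x k * φ k) (∫ k, φ k ∂skellamMeasure x) := by
  have h := hasSum_integral_sum_dirac (c := fun k : ℤ => skellamMeasure x {k}) (x := id) (f := φ)
    (fun k => by simp) ?_
  · simp only [id, Measure.sum_smul_dirac] at h
    refine h.congr_fun fun k => ?_
    rw [← measureReal_def, skellamMeasure_real_singleton hx, smul_eq_mul]
  · refine (hφ.summable hx).abs.congr fun k => ?_
    rw [← measureReal_def, skellamMeasure_real_singleton hx, abs_mul, abs_of_pos (skellam_pos hx k)]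
    rfl

lemma PolyGrowth.integrable {φ : ℤ → ℝ} (hφ : PolyGrowth φ) {x : ℝ} (hx : 0 < x) :
    Integrable φ (skellamMeasure x) := by
  rw [← Measure.sum_smul_dirac (skellamMeasure x)]
  refine (integrable_sum_dirac_iff (x := id) (fun k => by simp)).2 ?_
  refine (hφ.summable hx).abs.congr fun k => ?_
  rw [← measureReal_def, skellamMeasure_real_singleton hx, abs_mul, abs_of_pos (skellam_pos hx k)]
  rfl

lemma hasSum_skellam_shift {φ : ℤ → ℝ} (hφ : PolyGrowth φ) {x : ℝ} (hx : 0 < x) (m : ℤ) :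
    HasSum (fun k => skellam x (k + m) * φ k) (∫ k, φ (k - m) ∂skellamMeasure x) := by
  have h := hasSum_integral_skellam (φ := fun k => φ (k - m)) (hφ.comp_add (-m)) hx
  have := (Equiv.addRight m).hasSum_iff.2 h
  simpa [Function.comp_def] using this

lemma integral_stein {φ : ℤ → ℝ} (hφ : PolyGrowth φ) {x : ℝ} (hx : 0 < x) :
    ∫ k, (k : ℝ) * φ k ∂skellamMeasure x =
      x / 2 * (∫ k, φ (k + 1) ∂skellamMeasure x - ∫ k, φ (k - 1) ∂skellamMeasure x) := by
  have h0 := hasSum_integral_skellam (PolyGrowth.cast.mul hφ) hx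
  have h1 := hasSum_skellam_shift hφ hx (-1)
  have h2 := hasSum_skellam_shift hφ hx 1
  refine h0.unique ((((h1.sub h2).mul_left (x / 2))).congr_fun fun k => ?_) |>.trans ?_
  · rw [← mul_assoc, mul_comm _ (k : ℝ), cast_mul_skellam hx k]
    ring_nf
  · simp

lemma integral_skellamScore {x : ℝ} (hx : 0 < x) :
    ∫ k, skellamScore x k ∂skellamMeasure x = 0 := by
  have h := hasSum_integral_skellam (polyGrowth_skellamScore hx) hx
  have h0 := hasSum_skellam_shift (.const 1) hx 0
  have h1 := hasSum_skellam_shift (.const 1) hx 1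
  have h2 := hasSum_skellam_shift (.const 1) hx (-1)
  refine h.unique ((((h1.add h2).div_const 2).sub h0).congr_fun fun k => ?_) |>.trans ?_
  · rw [skellam_mul_score hx]
    simp [sub_eq_add_neg]
  · simp

/-- The second Bartlett identity. The second derivative of the mass is a difference of shifts of
p·score, each of which sums to E[score] = 0; no interchange of derivative and sum is needed. -/
lemma integral_skellamScoreDeriv {x : ℝ} (hx : 0 < x) :
    ∫ k, skellamScoreDeriv x k ∂skellamMeasure x = -∫ k, skellamScore x k ^ 2 ∂skellamMeasure x := by
  have hp := (polyGrowth_skellamScoreDeriv hx).add ((polyGrowth_skellamScore hx).pow 2)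
  have h := hasSum_integral_skellam hp hx
  have h0 := hasSum_integral_skellam (polyGrowth_skellamScore hx) hx
  have h1 := (Equiv.addRight (1 : ℤ)).hasSum_iff.2 h0
  have h2 := (Equiv.addRight (-1 : ℤ)).hasSum_iff.2 h0
  have h3 := h.unique ((((h1.add h2).div_const 2).sub h0).congr_fun fun k => by
    rw [skellam_mul_scoreDeriv_add hx]
    simp [sub_eq_add_neg])
  rw [integral_add ((polyGrowth_skellamScoreDeriv hx).integrable hx)
    (((polyGrowth_skellamScore hx).pow 2).integrable hx)] at h3
  rw [integral_skellamScore hx] at h3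
  linarith

lemma charFun_skellamMeasure {x : ℝ} (hx : 0 ≤ x) (t : ℝ) :
    ∫ k, Complex.exp ((t : ℂ) * (k : ℂ) * Complex.I) ∂skellamMeasure x =
      Complex.exp (x * (Complex.cos t - 1)) := by
  set r : ℝ≥0 := (x / 2).toNNReal
  have hr : (r : ℝ) = x / 2 := Real.coe_toNNReal _ (by positivity)
  have hP : ∀ s : ℝ, ∫ n : ℕ, Complex.exp ((s : ℂ) * (n : ℂ) * Complex.I) ∂poissonMeasure r =
      Complex.exp (r * (Complex.exp (s * Complex.I) - 1)) := by
    intro s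
    rw [← charFun_map_cast_poissonMeasure, charFun_apply_real, integral_map .of_discrete (by fun_prop)]
    simp
  rw [skellamMeasure, integral_map (by fun_prop) (by fun_prop)]
  have h : ∀ p : ℕ × ℕ, Complex.exp ((t : ℂ) * (((p.1 : ℤ) - p.2 : ℤ) : ℂ) * Complex.I) =
      Complex.exp ((t : ℂ) * (p.1 : ℂ) * Complex.I) *
        Complex.exp (((-t : ℝ) : ℂ) * (p.2 : ℂ) * Complex.I) := by
    intro p
    rw [← Complex.exp_add]
    push_cast
    ring_nf
  simp only [h]
  rw [integral_prod_mul (fun a : ℕ => Complex.exp ((t : ℂ) * (a : ℂ) * Complex.I))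
    (fun b : ℕ => Complex.exp (((-t : ℝ) : ℂ) * (b : ℂ) * Complex.I)), hP, hP, ← Complex.exp_add]
  congr 1
  have hr' : (r : ℂ) = (x : ℂ) / 2 := by exact_mod_cast congrArg (fun z : ℝ => (z : ℂ)) hr
  rw [hr', Complex.cos]
  push_cast
  ring_nf

/-! ### Moments of the Skellam distribution -/

/-- Stein's identity as a recursion for moments: φ(k) = k^{2j−1} has a central difference of degree
2j − 2. Moments up to order 8 are needed, for the fourth power of 1 + k²/x. -/
lemma integral_mul_eq_of_diff {φ ψ : ℤ → ℝ} (hφ : PolyGrowth φ)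
    (h : ∀ k, φ (k + 1) - φ (k - 1) = ψ k) {x : ℝ} (hx : 0 < x) :
    ∫ k, (k : ℝ) * φ k ∂skellamMeasure x = x / 2 * ∫ k, ψ k ∂skellamMeasure x := by
  rw [integral_stein hφ hx, ← integral_sub ((hφ.comp_add 1).integrable hx)
    (by simpa [sub_eq_add_neg] using (hφ.comp_add (-1)).integrable hx)]
  simp only [h]

lemma integrable_cast_pow {x : ℝ} (hx : 0 < x) (n : ℕ) :
    Integrable (fun k : ℤ => (k : ℝ) ^ n) (skellamMeasure x) :=
  (PolyGrowth.cast.pow n).integrable hx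

lemma integral_sq_skellam {x : ℝ} (hx : 0 < x) :
    ∫ k, (k : ℝ) ^ 2 ∂skellamMeasure x = x := by
  have h := integral_mul_eq_of_diff (φ := fun k => (k : ℝ)) (ψ := fun _ => 2) .cast
    (fun k => by push_cast; ring) hx
  simp only [← sq, integral_const, probReal_univ, smul_eq_mul, one_mul] at h
  rw [h]; ring

lemma integral_pow_four_skellam {x : ℝ} (hx : 0 < x) :
    ∫ k, (k : ℝ) ^ 4 ∂skellamMeasure x = 3 * x ^ 2 + x := by
  have h := integral_mul_eq_of_diff (φ := fun k => (k : ℝ) ^ 3)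
    (ψ := fun k => 6 * (k : ℝ) ^ 2 + 2) (PolyGrowth.cast.pow 3) (fun k => by push_cast; ring) hx
  rw [integral_add ((integrable_cast_pow hx 2).const_mul _) (integrable_const _),
    integral_const_mul, integral_sq_skellam hx] at h
  simp only [integral_const, probReal_univ, smul_eq_mul, one_mul] at h
  rw [show (fun k : ℤ => (k : ℝ) ^ 4) = fun k : ℤ => (k : ℝ) * (k : ℝ) ^ 3 by ext; ring, h]
  ring

lemma integral_pow_six_skellam {x : ℝ} (hx : 0 < x) :
    ∫ k, (k : ℝ) ^ 6 ∂skellamMeasure x = 15 * x ^ 3 + 15 * x ^ 2 + x := by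
  have h := integral_mul_eq_of_diff (φ := fun k => (k : ℝ) ^ 5)
    (ψ := fun k => 10 * (k : ℝ) ^ 4 + 20 * (k : ℝ) ^ 2 + 2)
    (PolyGrowth.cast.pow 5) (fun k => by push_cast; ring) hx
  rw [integral_add ((((PolyGrowth.cast.pow 4).const_mul 10).add
      ((PolyGrowth.cast.pow 2).const_mul 20)).integrable hx) (integrable_const _),
    integral_add ((integrable_cast_pow hx 4).const_mul _) ((integrable_cast_pow hx 2).const_mul _),
    integral_const_mul, integral_const_mul, integral_sq_skellam hx,
    integral_pow_four_skellam hx] at h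
  simp only [integral_const, probReal_univ, smul_eq_mul, one_mul] at h
  rw [show (fun k : ℤ => (k : ℝ) ^ 6) = fun k : ℤ => (k : ℝ) * (k : ℝ) ^ 5 by ext; ring, h]
  ring

lemma integral_pow_eight_skellam {x : ℝ} (hx : 0 < x) :
    ∫ k, (k : ℝ) ^ 8 ∂skellamMeasure x = 105 * x ^ 4 + 210 * x ^ 3 + 63 * x ^ 2 + x := by
  have h := integral_mul_eq_of_diff (φ := fun k => (k : ℝ) ^ 7)
    (ψ := fun k => 14 * (k : ℝ) ^ 6 + 70 * (k : ℝ) ^ 4 + 42 * (k : ℝ) ^ 2 + 2)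
    (PolyGrowth.cast.pow 7) (fun k => by push_cast; ring) hx
  rw [integral_add (((((PolyGrowth.cast.pow 6).const_mul 14).add
      ((PolyGrowth.cast.pow 4).const_mul 70)).add ((PolyGrowth.cast.pow 2).const_mul 42)).integrable hx)
      (integrable_const _),
    integral_add ((((PolyGrowth.cast.pow 6).const_mul 14).add
      ((PolyGrowth.cast.pow 4).const_mul 70)).integrable hx) ((integrable_cast_pow hx 2).const_mul _),
    integral_add ((integrable_cast_pow hx 6).const_mul _) ((integrable_cast_pow hx 4).const_mul _),
    integral_const_mul, integral_const_mul, integral_const_mul, integral_sq_skellam hx,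
    integral_pow_four_skellam hx, integral_pow_six_skellam hx] at h
  simp only [integral_const, probReal_univ, smul_eq_mul, one_mul] at h
  rw [show (fun k : ℤ => (k : ℝ) ^ 8) = fun k : ℤ => (k : ℝ) * (k : ℝ) ^ 7 by ext; ring, h]
  ring

lemma natAbs_cast_sq (k : ℤ) : ((k.natAbs : ℝ)) ^ 2 = (k : ℝ) ^ 2 := by
  rw [Nat.cast_natAbs, Int.cast_abs, sq_abs]

lemma natAbs_cast_le_sq (k : ℤ) : (k.natAbs : ℝ) ≤ (k : ℝ) ^ 2 := by
  rw [← natAbs_cast_sq]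
  exact_mod_cast Nat.le_self_pow two_ne_zero _

lemma integral_natAbs_le {x : ℝ} (hx : 0 < x) :
    ∫ k : ℤ, (k.natAbs : ℝ) ∂skellamMeasure x ≤ x := by
  refine (integral_mono (PolyGrowth.natAbs.integrable hx) (integrable_cast_pow hx 2)
    natAbs_cast_le_sq).trans_eq (integral_sq_skellam hx)

/-! ### The Fisher information of one Skellam observation -/

/-- The Fisher information of the Skellam distribution. -/
def skellamInfo (x : ℝ) : ℝ := ∫ k, skellamScore x k ^ 2 ∂skellamMeasure x

/-- The score is q + (r − 1) with q = |k|/x and 0 < r ≤ 1, so its square differs from q² by at most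
2q + 1. Moreover E[q²] = 1/x, and E[q] ≤ 1 because |k| ≤ k². -/
lemma abs_skellamInfo_sub_le {x : ℝ} (hx : 0 < x) : |skellamInfo x - 1 / x| ≤ 3 := by
  have hi := ((polyGrowth_skellamScore hx).pow 2).integrable hx
  have h2 := (integrable_cast_pow hx 2).div_const (x ^ 2)
  have e : 1 / x = ∫ k : ℤ, (k : ℝ) ^ 2 / x ^ 2 ∂skellamMeasure x := by
    rw [integral_div, integral_sq_skellam hx]
    field_simp
  rw [skellamInfo, e, ← integral_sub hi h2]
  have hb : ∀ k : ℤ, |skellamScore x k ^ 2 - (k : ℝ) ^ 2 / x ^ 2| ≤ 2 / x * k.natAbs + 1 := by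
    intro k
    have h1 := ratio_pos k.natAbs hx
    have h2 := ratio_le_one k.natAbs hx
    rw [← natAbs_cast_sq, skellamScore]
    set r := ratio k.natAbs x
    have hq : 0 ≤ (k.natAbs : ℝ) / x := by positivity
    set q := (k.natAbs : ℝ) / x with hqd
    rw [← div_pow, ← hqd, show 2 / x * (k.natAbs : ℝ) = 2 * q by rw [hqd]; ring, abs_le]
    constructor <;> nlinarith
  calc |∫ k : ℤ, skellamScore x k ^ 2 - (k : ℝ) ^ 2 / x ^ 2 ∂skellamMeasure x|
      ≤ ∫ k : ℤ, (2 / x * (k.natAbs : ℝ) + 1) ∂skellamMeasure x := by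
        rw [← Real.norm_eq_abs]
        exact norm_integral_le_of_norm_le
          (((PolyGrowth.natAbs.const_mul _).add (.const 1)).integrable hx) (ae_of_all _ hb)
    _ = 2 / x * (∫ k : ℤ, (k.natAbs : ℝ) ∂skellamMeasure x) + 1 := by
        rw [integral_add ((PolyGrowth.natAbs.const_mul _).integrable hx) (integrable_const _),
          integral_const_mul]
        simp
    _ ≤ 2 / x * x + 1 := by gcongr; exact integral_natAbs_le hx
    _ = 3 := by field_simp; norm_num

lemma skellamInfo_pos {x : ℝ} (hx : 0 < x) : 0 < skellamInfo x := by
  have h := hasSum_integral_skellam ((polyGrowth_skellamScore hx).pow 2) hx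
  obtain ⟨n, hn⟩ := exists_nat_gt x
  -- A single term is enough: for n > x the score at n exceeds n/x − 1 > 0.
  have h1 : skellam x n * skellamScore x n ^ 2 ≤ skellamInfo x :=
    le_hasSum h n fun k _ => mul_nonneg (skellam_pos hx k).le (sq_nonneg _)
  refine lt_of_lt_of_le (mul_pos (skellam_pos hx n) (pow_pos ?_ 2)) h1
  have h2 := ratio_pos n hx
  have h3 : 1 < (n : ℝ) / x := by rwa [one_lt_div hx]
  simp only [skellamScore, Int.natAbs_natCast]
  linarith

lemma tendsto_mul_skellamInfo_zero :
    Tendsto (fun x => x * skellamInfo x) (𝓝[>] 0) (𝓝 1) := by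
  have h : Tendsto (fun x : ℝ => 3 * x) (𝓝[>] 0) (𝓝 0) := by
    have : Tendsto (fun x : ℝ => 3 * x) (𝓝 0) (𝓝 (3 * 0)) := tendsto_id.const_mul 3
    rw [mul_zero] at this
    exact this.mono_left nhdsWithin_le_nhds
  refine tendsto_iff_norm_sub_tendsto_zero.2 (squeeze_zero' (Eventually.of_forall fun _ =>
    norm_nonneg _) ?_ h)
  filter_upwards [self_mem_nhdsWithin] with x hx
  have hx' : 0 < x := hx
  rw [show x * skellamInfo x - 1 = x * (skellamInfo x - 1 / x) by field_simp, norm_mul,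
    Real.norm_of_nonneg hx'.le, Real.norm_eq_abs]
  nlinarith [abs_skellamInfo_sub_le hx']

lemma continuousAt_skellamInfo {x : ℝ} (hx : 0 < x) : ContinuousAt skellamInfo x := by
  have hev : ∀ᶠ y in 𝓝 x, x / 2 < y ∧ y < 2 * x :=
    (lt_mem_nhds (by linarith)).and (gt_mem_nhds (by linarith))
  have e : ∀ y, 0 < y → skellamInfo y = ∑' k, skellam y k * skellamScore y k ^ 2 := fun y hy =>
    (hasSum_integral_skellam ((polyGrowth_skellamScore hy).pow 2) hy).tsum_eq.symm
  have h2x : 0 < 2 * x := by linarith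
  have hp : PolyGrowth fun k => ((k.natAbs : ℝ) / (x / 2) + 1) ^ 2 :=
    ((PolyGrowth.natAbs.div_const _).add (.const 1)).pow 2
  have key : Tendsto (fun y => ∑' k, skellam y k * skellamScore y k ^ 2) (𝓝 x)
      (𝓝 (∑' k, skellam x k * skellamScore x k ^ 2)) := by
    refine tendsto_tsum_of_dominated_convergence
      ((hp.summable h2x).mul_left (Real.exp (2 * x))) (fun k => ?_) ?_
    · exact ((hasDerivAt_skellam hx k).continuousAt.mul
        ((hasDerivAt_skellamScore hx k).continuousAt.pow 2))
    · filter_upwards [hev] with y hy k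
      have hy0 : 0 < y := by linarith [hy.1]
      rw [norm_mul, Real.norm_of_nonneg (skellam_pos hy0 k).le, norm_pow, Real.norm_eq_abs,
        ← mul_assoc]
      -- For y < 2x the Bessel factor is dominated by its value at 2x; the factor e^{2x} undoes the
      -- exponential in the mass at 2x.
      have h1 : skellam y k ≤ Real.exp (2 * x) * skellam (2 * x) k := by
        rw [skellam, skellam, ← mul_assoc, ← Real.exp_add, add_neg_cancel, Real.exp_zero]
        have := besselI_mono k.natAbs hy0.le hy.2.le
        have h0 := (besselI_pos k.natAbs hy0).le
        have : Real.exp (-y) ≤ 1 := Real.exp_le_one_iff.2 (by linarith)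
        gcongr
      have h2 : |skellamScore y k| ≤ (k.natAbs : ℝ) / (x / 2) + 1 :=
        (abs_skellamScore_le hy0 k).trans (by gcongr; exact hy.1.le)
      have h3 := (skellam_pos hy0 k).le
      have h4 := h3.trans h1
      gcongr
  refine Tendsto.congr' ?_ (e x hx ▸ key)
  filter_upwards [hev] with y hy
  exact (e y (by linarith [hy.1])).symm

lemma integral_score_pow_four_le {x : ℝ} (hx : 0 < x) :
    ∫ k, skellamScore x k ^ 4 ∂skellamMeasure x ≤ 8 * ((3 * x ^ 2 + x) / x ^ 4 + 1) := by
  have hb : ∀ k : ℤ, skellamScore x k ^ 4 ≤ 8 * ((k : ℝ) ^ 4 / x ^ 4 + 1) := by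
    intro k
    have h := abs_skellamScore_le hx k
    have hq : 0 ≤ (k.natAbs : ℝ) / x := by positivity
    have e : (k : ℝ) ^ 4 / x ^ 4 = ((k.natAbs : ℝ) / x) ^ 4 := by
      rw [div_pow, show ((k.natAbs : ℝ)) ^ 4 = (((k.natAbs : ℝ)) ^ 2) ^ 2 by ring, natAbs_cast_sq]
      ring
    rw [e, ← Even.pow_abs (by decide : Even 4)]
    set q := (k.natAbs : ℝ) / x
    refine (pow_le_pow_left₀ (abs_nonneg _) h 4).trans ?_
    nlinarith [sq_nonneg (q - 1), sq_nonneg (q + 1), sq_nonneg (q ^ 2 - 1),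
      mul_nonneg (sq_nonneg (q - 1)) (sq_nonneg q), sq_nonneg (q * (q - 1))]
  refine (integral_mono (((polyGrowth_skellamScore hx).pow 4).integrable hx)
    (((((PolyGrowth.cast.pow 4).div_const _).add (.const 1)).const_mul 8).integrable hx) hb).trans_eq ?_
  rw [integral_const_mul, integral_add ((integrable_cast_pow hx 4).div_const _) (integrable_const _),
    integral_div, integral_pow_four_skellam hx]
  simp

lemma integral_scoreDeriv_sq_le {x : ℝ} (hx : 0 < x) :
    ∫ k, skellamScoreDeriv x k ^ 2 ∂skellamMeasure x ≤ 2 * (1 / x ^ 3 + 1) := by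
  have hb : ∀ k : ℤ, skellamScoreDeriv x k ^ 2 ≤ 2 * ((k : ℝ) ^ 2 / x ^ 4 + 1) := by
    intro k
    have h := abs_skellamScoreDeriv_le hx k
    have hq : 0 ≤ (k.natAbs : ℝ) / x ^ 2 := by positivity
    have e : (k : ℝ) ^ 2 / x ^ 4 = ((k.natAbs : ℝ) / x ^ 2) ^ 2 := by
      rw [div_pow, natAbs_cast_sq]
      ring
    rw [e, ← sq_abs]
    set q := (k.natAbs : ℝ) / x ^ 2
    refine (pow_le_pow_left₀ (abs_nonneg _) h 2).trans ?_
    nlinarith [sq_nonneg (q - 1)]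
  refine (integral_mono (((polyGrowth_skellamScoreDeriv hx).pow 2).integrable hx)
    (((((PolyGrowth.cast.pow 2).div_const _).add (.const 1)).const_mul 2).integrable hx) hb).trans_eq ?_
  rw [integral_const_mul, integral_add ((integrable_cast_pow hx 2).div_const _) (integrable_const _),
    integral_div, integral_sq_skellam hx]
  simp
  field_simp

/-- The modulus of continuity used for bounded arguments, relative in |x − y|/y. All factors 1/x are
replaced by 2/y, and the ratio is 1-Lipschitz. -/
lemma abs_scoreDeriv_sub_le {x y : ℝ} (hy : 0 < y) (h1 : y / 2 ≤ x) (k : ℤ) :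
    |skellamScoreDeriv x k - skellamScoreDeriv y k| ≤
      |x - y| / y * (2 * y + 4 * k.natAbs + 4 + 6 * k.natAbs / y ^ 2) := by
  have hx : 0 < x := by linarith
  set n : ℝ := (k.natAbs : ℝ) with hn
  have hn0 : 0 ≤ n := by positivity
  set r := ratio k.natAbs x
  set s := ratio k.natAbs y
  have hr0 : 0 < r := ratio_pos _ hx
  have hs0 : 0 < s := ratio_pos _ hy
  have hr1 : r ≤ 1 := ratio_le_one _ hx
  have hs1 : s ≤ 1 := ratio_le_one _ hy
  have hrs : |r - s| ≤ |x - y| := abs_ratio_sub_le _ hx hy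
  have hs2 : 2 * (n + 1) * s ≤ y := two_mul_ratio_le _ hy
  have hD : 0 ≤ |x - y| := abs_nonneg _
  have hxi : 1 / x ≤ 2 / y := by rw [div_le_div_iff₀ hx hy]; linarith
  have e : skellamScoreDeriv x k - skellamScoreDeriv y k =
      -((r - s) * (r + s)) - (2 * n + 1) * (1 / x) * (r - s) +
        (2 * n + 1) * s / y * ((1 / x) * (x - y)) +
        n * (1 / y) * (1 / x) * (1 / x + 1 / y) * (x - y) := by
    simp only [skellamScoreDeriv]
    field_simp
    ring
  have b1 : |-((r - s) * (r + s))| ≤ |x - y| * 2 := by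
    rw [abs_neg, abs_mul, abs_of_pos (by linarith : 0 < r + s)]
    exact mul_le_mul hrs (by linarith) (by linarith) hD
  have b2 : |(2 * n + 1) * (1 / x) * (r - s)| ≤ (2 * n + 1) * (2 / y) * |x - y| := by
    rw [abs_mul, abs_of_nonneg (by positivity)]
    gcongr
  -- The bound 2(n+1)s ≤ y absorbs the factor 2n + 1 completely, so this term contributes no growth
  -- in k.
  have b3 : |(2 * n + 1) * s / y * ((1 / x) * (x - y))| ≤ 1 * (2 / y * |x - y|) := by
    rw [abs_mul, abs_mul, abs_of_nonneg (by positivity : 0 ≤ 1 / x), abs_of_nonneg (by positivity)]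
    have : (2 * n + 1) * s / y ≤ 1 := by rw [div_le_one hy]; linarith
    exact mul_le_mul this (by gcongr) (by positivity) zero_le_one
  have b4 : |n * (1 / y) * (1 / x) * (1 / x + 1 / y) * (x - y)| ≤
      n * (1 / y) * (2 / y) * (2 / y + 1 / y) * |x - y| := by
    rw [abs_mul, abs_of_nonneg (by positivity)]
    gcongr
  rw [e]
  refine (abs_add_le _ _).trans ((add_le_add ((abs_add_le _ _).trans (add_le_add
    ((abs_sub _ _).trans (add_le_add b1 b2)) b3)) b4).trans_eq ?_)
  field_simp
  ring

/-! ### Asymptotics of the Bessel ratios for large arguments -/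

/-- The logarithmic derivative of `√x I_k(x)`. -/
def liouvilleLogDeriv (k : ℕ) (x : ℝ) : ℝ := ratio k x + (k + 1 / 2) / x

/-- If k ≥ x/2 the explicit term suffices; otherwise the lower bound on the ratio does most of the
work. The bound is uniform in k, so errors in the linear equation e' + 2ve = f are damped at rate at
least 1. -/
lemma half_le_liouvilleLogDeriv (k : ℕ) {x : ℝ} (hx : 0 < x) : 1 / 2 ≤ liouvilleLogDeriv k x := by
  have h0 := ratio_pos k hx
  have h1 := le_ratio k hx
  rw [liouvilleLogDeriv]
  rcases le_or_gt (x / 2) (k : ℝ) with h | h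
  · have : 1 / 2 ≤ ((k : ℝ) + 1 / 2) / x := by
      rw [div_le_div_iff₀ two_pos hx]; linarith
    linarith
  · have h2 : x / (2 * x + 2) ≤ ratio k x :=
      (div_le_div_of_nonneg_left hx.le (by positivity) (by linarith)).trans h1
    have h3 : 1 / 2 / x ≤ ((k : ℝ) + 1 / 2) / x := by gcongr; linarith [k.cast_nonneg (α := ℝ)]
    have h4 : 1 / 2 ≤ x / (2 * x + 2) + 1 / 2 / x := by
      rw [div_add_div _ _ (by positivity) hx.ne', div_le_div_iff₀ two_pos (by positivity)]
      nlinarith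
    linarith

/-- In Liouville normal form w = √x I_k(x) satisfies w'' = (1 + (k² − 1/4)/x²) w, without a
first-order term; this is the Riccati equation for w'/w. -/
lemma hasDerivAt_liouvilleLogDeriv (k : ℕ) {x : ℝ} (hx : 0 < x) :
    HasDerivAt (liouvilleLogDeriv k)
      (1 + ((k : ℝ) ^ 2 - 1 / 4) / x ^ 2 - liouvilleLogDeriv k x ^ 2) x := by
  refine ((hasDerivAt_ratio k hx).add ((hasDerivAt_const x ((k : ℝ) + 1 / 2)).div (hasDerivAt_id x)
    hx.ne')).congr_deriv ?_
  simp only [liouvilleLogDeriv, id]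
  field_simp
  ring

/-- A comparison principle: x I_k(x)² has logarithmic derivative 2v, so it is an integrating factor
and its product with F is monotone. -/
lemma nonneg_of_deriv_add_liouville_nonneg (k : ℕ) {a : ℝ} (ha : 0 < a) {F F' : ℝ → ℝ}
    (hF : ∀ y, a ≤ y → HasDerivAt F (F' y) y)
    (h : ∀ y, a ≤ y → 0 ≤ F' y + 2 * liouvilleLogDeriv k y * F y) (h0 : 0 ≤ F a)
    {y : ℝ} (hy : a ≤ y) : 0 ≤ F y := by
  have hd : ∀ z, a ≤ z → HasDerivAt (fun z => z * besselI k z ^ 2 * F z)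
      (z * besselI k z ^ 2 * (F' z + 2 * liouvilleLogDeriv k z * F z)) z := by
    intro z hz
    have hz0 : 0 < z := ha.trans_le hz
    refine (((hasDerivAt_id z).mul ((hasDerivAt_besselI k hz0.ne').pow 2)).mul
      (hF z hz)).congr_deriv ?_
    have := (besselI_pos k hz0).ne'
    simp only [id, liouvilleLogDeriv, ratio, Pi.mul_apply, Pi.pow_apply]
    field_simp
    ring
  have hm : MonotoneOn (fun z => z * besselI k z ^ 2 * F z) (Set.Ici a) := by
    refine monotoneOn_of_deriv_nonneg (convex_Ici a)
      (fun z hz => (hd z hz).continuousAt.continuousWithinAt) ?_ ?_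
    · intro z hz
      exact (hd z (interior_subset hz)).differentiableAt.differentiableWithinAt
    · intro z hz
      have hz' : a ≤ z := interior_subset hz
      rw [(hd z hz').deriv]
      have := h z hz'
      have : 0 < z := ha.trans_le hz'
      positivity
  have h1 := hm (Set.mem_Ici.2 le_rfl) (Set.mem_Ici.2 hy) hy
  have hy0 : 0 < y := ha.trans_le hy
  have h2 : 0 < y * besselI k y ^ 2 := mul_pos hy0 (pow_pos (besselI_pos k hy0) 2)
  have h3 : 0 ≤ y * besselI k y ^ 2 * F y := le_trans (by positivity) h1
  exact nonneg_of_mul_nonneg_right h3 h2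

/-- Twice the bound on the forcing, S, is a supersolution: 2vS ≥ S is twice the forcing bound, and
S' costs at most one copy of it, because differentiation brings factors 6/y, 8/y, 10/y ≤ 1 for y ≥
10. The comparison principle is applied to S − e and S + e. -/
lemma abs_le_of_deriv_add_liouville (k : ℕ) {a A B C : ℝ} (ha : 10 ≤ a) (hA : 0 ≤ A) (hB : 0 ≤ B)
    (hC : 0 ≤ C) {e e' : ℝ → ℝ} (he : ∀ y, a ≤ y → HasDerivAt e (e' y) y)
    (h : ∀ y, a ≤ y → |e' y + 2 * liouvilleLogDeriv k y * e y| ≤ A / y ^ 3 + B / y ^ 4 + C / y ^ 5)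
    (h0 : |e a| ≤ 2 * (A / a ^ 3 + B / a ^ 4 + C / a ^ 5)) {y : ℝ} (hy : a ≤ y) :
    |e y| ≤ 2 * (A / y ^ 3 + B / y ^ 4 + C / y ^ 5) := by
  set S : ℝ → ℝ := fun y => 2 * (A / y ^ 3 + B / y ^ 4 + C / y ^ 5)
  set S' : ℝ → ℝ := fun y => 2 * (A * (-3 / y ^ 4) + B * (-4 / y ^ 5) + C * (-5 / y ^ 6))
  have ha0 : 0 < a := by linarith
  have hS : ∀ y, a ≤ y → HasDerivAt S (S' y) y := by
    intro y hy
    have hy0 : y ≠ 0 := (ha0.trans_le hy).ne'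
    refine ((((hasDerivAt_const y A).div (hasDerivAt_pow 3 y) (pow_ne_zero 3 hy0)).add
      ((hasDerivAt_const y B).div (hasDerivAt_pow 4 y) (pow_ne_zero 4 hy0))).add
      ((hasDerivAt_const y C).div (hasDerivAt_pow 5 y) (pow_ne_zero 5 hy0))).const_mul 2
      |>.congr_deriv ?_
    simp only [S']
    field_simp
    ring
  have hsup : ∀ y, a ≤ y →
      A / y ^ 3 + B / y ^ 4 + C / y ^ 5 ≤ S' y + 2 * liouvilleLogDeriv k y * S y := by
    intro y hy
    have hy0 : 0 < y := ha0.trans_le hy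
    have hv := half_le_liouvilleLogDeriv k hy0
    have hS0 : 0 ≤ S y := by simp only [S]; positivity
    have h1 : S y ≤ 2 * liouvilleLogDeriv k y * S y := by nlinarith
    have h2 : -(A / y ^ 3 + B / y ^ 4 + C / y ^ 5) ≤ S' y := by
      have hi : 10 * (1 / y) ≤ 1 := by
        rw [mul_one_div, div_le_one hy0]; linarith
      have hi0 : 0 ≤ 1 / y := by positivity
      have e : S' y = -((6 * (1 / y)) * (A / y ^ 3) + (8 * (1 / y)) * (B / y ^ 4) +
          (10 * (1 / y)) * (C / y ^ 5)) := by
        simp only [S']; field_simp; ring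
      rw [e]
      have hA' : 0 ≤ A / y ^ 3 := by positivity
      have hB' : 0 ≤ B / y ^ 4 := by positivity
      have hC' : 0 ≤ C / y ^ 5 := by positivity
      nlinarith [mul_le_of_le_one_left hA' (by linarith : 6 * (1 / y) ≤ 1),
        mul_le_of_le_one_left hB' (by linarith : 8 * (1 / y) ≤ 1),
        mul_le_of_le_one_left hC' hi]
    simp only [S] at h1 ⊢
    linarith
  rw [abs_le] at h0
  rw [abs_le]
  have h1 := nonneg_of_deriv_add_liouville_nonneg k ha0 (F := fun y => S y - e y)
    (fun z hz => (hS z hz).sub (he z hz)) (fun z hz => by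
      have h2 := hsup z hz
      have h3 := (abs_le.1 (h z hz)).2
      linarith) (by simp only [S]; linarith) hy
  have h2 := nonneg_of_deriv_add_liouville_nonneg k ha0 (F := fun y => S y + e y)
    (fun z hz => (hS z hz).add (he z hz)) (fun z hz => by
      have h2 := hsup z hz
      have h3 := (abs_le.1 (h z hz)).1
      linarith) (by simp only [S]; linarith) hy
  simp only [S] at h1 h2
  constructor <;> linarith

/-- Minus the derivative of `liouvilleLogDeriv`. -/
def riccatiDefect (k : ℕ) (x : ℝ) : ℝ :=
  liouvilleLogDeriv k x ^ 2 - 1 - ((k : ℝ) ^ 2 - 1 / 4) / x ^ 2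

lemma hasDerivAt_riccatiDefect (k : ℕ) {x : ℝ} (hx : 0 < x) :
    HasDerivAt (riccatiDefect k) (-2 * liouvilleLogDeriv k x * riccatiDefect k x +
      2 * ((k : ℝ) ^ 2 - 1 / 4) / x ^ 3) x := by
  refine ((((hasDerivAt_liouvilleLogDeriv k hx).pow 2).sub_const 1).sub
    ((hasDerivAt_const x ((k : ℝ) ^ 2 - 1 / 4)).div (hasDerivAt_pow 2 x)
      (pow_ne_zero 2 hx.ne'))).congr_deriv ?_
  simp only [riccatiDefect]
  field_simp
  ring

lemma skellamScore_eq {x : ℝ} (k : ℤ) :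
    skellamScore x k = liouvilleLogDeriv k.natAbs x - 1 - 1 / (2 * x) := by
  rw [skellamScore, liouvilleLogDeriv, mul_comm (2 : ℝ), ← div_div]
  ring

lemma skellamScoreDeriv_eq {x : ℝ} (hx : 0 < x) (k : ℤ) :
    skellamScoreDeriv x k = -riccatiDefect k.natAbs x + 1 / (2 * x ^ 2) := by
  rw [skellamScoreDeriv, riccatiDefect, liouvilleLogDeriv]
  field_simp
  ring

lemma abs_sq_sub_quarter_le (k : ℕ) : |(k : ℝ) ^ 2 - 1 / 4| ≤ 1 + (k : ℝ) ^ 2 := by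
  have := sq_nonneg (k : ℝ)
  rw [abs_le]; constructor <;> linarith

/-- The first comparison. The constant comes from the starting value at 16, where the crude bound on
the score derivative gives at most 3(1 + k²) = 2 · 6144 (1 + k²)/16³; the forcing alone would need
only 2(1 + k²). -/
lemma abs_riccatiDefect_le (k : ℕ) {x : ℝ} (hx : 16 ≤ x) :
    |riccatiDefect k x| ≤ 12288 * (1 + (k : ℝ) ^ 2) / x ^ 3 := by
  have hq := abs_sq_sub_quarter_le k
  have h0 : |riccatiDefect k 16| ≤ 2 * (6144 * (1 + (k : ℝ) ^ 2) / 16 ^ 3 + 0 / 16 ^ 4 + 0 / 16 ^ 5) := by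
    have h1 := abs_skellamScoreDeriv_le (x := 16) (by norm_num) (k : ℤ)
    rw [skellamScoreDeriv_eq (by norm_num), Int.natAbs_natCast, abs_le] at h1
    have h2 : (0 : ℝ) ≤ k := k.cast_nonneg
    rw [abs_le]
    constructor <;> nlinarith [sq_nonneg ((k : ℝ) - 1)]
  have := abs_le_of_deriv_add_liouville k (a := 16) (A := 6144 * (1 + (k : ℝ) ^ 2)) (B := 0) (C := 0)
    (by norm_num) (by positivity) le_rfl le_rfl
    (fun y hy => hasDerivAt_riccatiDefect k (by linarith)) (fun y hy => ?_) h0 hx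
  · refine this.trans_eq (by ring)
  · have hy0 : 0 < y := by linarith
    rw [show -2 * liouvilleLogDeriv k y * riccatiDefect k y + 2 * ((k : ℝ) ^ 2 - 1 / 4) / y ^ 3 +
      2 * liouvilleLogDeriv k y * riccatiDefect k y = 2 * ((k : ℝ) ^ 2 - 1 / 4) / y ^ 3 by ring,
      abs_div, abs_mul, abs_two, abs_of_pos (pow_pos hy0 3), zero_div, zero_div, add_zero, add_zero]
    gcongr
    nlinarith

/-- The definition of the defect determines v² − 1 = (v − 1)(v + 1), and v + 1 ≥ 1. -/
lemma abs_liouvilleLogDeriv_sub_one_le (k : ℕ) {x : ℝ} (hx : 16 ≤ x) :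
    |liouvilleLogDeriv k x - 1| ≤ 12289 * (1 + (k : ℝ) ^ 2) / x ^ 2 := by
  have hx0 : 0 < x := by linarith
  have h1 := half_le_liouvilleLogDeriv k hx0
  set v := liouvilleLogDeriv k x with hv
  have e : (v - 1) * (v + 1) = ((k : ℝ) ^ 2 - 1 / 4) / x ^ 2 + riccatiDefect k x := by
    rw [riccatiDefect, ← hv]; ring
  have h2 : |(v - 1) * (v + 1)| ≤ 12289 * (1 + (k : ℝ) ^ 2) / x ^ 2 := by
    rw [e]
    refine (abs_add_le _ _).trans ((add_le_add (b := (1 + (k : ℝ) ^ 2) / x ^ 2) ?_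
      ((abs_riccatiDefect_le k hx).trans ?_)).trans_eq
      (b := (1 + (k : ℝ) ^ 2) / x ^ 2 + 12288 * (1 + (k : ℝ) ^ 2) / x ^ 2) ?_)
    · rw [abs_div, abs_of_pos (pow_pos hx0 2)]
      gcongr
      exact abs_sq_sub_quarter_le k
    · exact div_le_div_of_nonneg_left (by positivity) (by positivity)
        (pow_le_pow_right₀ (by linarith) (by norm_num))
    · ring
  rw [abs_mul, abs_of_pos (by linarith : 0 < v + 1)] at h2
  nlinarith [abs_nonneg (v - 1)]

/-- The scale of the scores for large arguments. -/
def scoreEnvelope (x : ℝ) (k : ℤ) : ℝ := 1 + (k : ℝ) ^ 2 / x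

lemma one_le_scoreEnvelope {x : ℝ} (hx : 0 < x) (k : ℤ) : 1 ≤ scoreEnvelope x k := by
  have : 0 ≤ (k : ℝ) ^ 2 / x := by positivity
  rw [scoreEnvelope]; linarith

lemma polyGrowth_scoreEnvelope (x : ℝ) : PolyGrowth (scoreEnvelope x) :=
  (PolyGrowth.const 1).add ((PolyGrowth.cast.pow 2).div_const x)

lemma one_add_sq_div_le_scoreEnvelope {x : ℝ} (hx : 1 ≤ x) (k : ℤ) :
    (1 + (k.natAbs : ℝ) ^ 2) / x ≤ scoreEnvelope x k := by
  rw [scoreEnvelope, natAbs_cast_sq, add_div]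
  have : 1 / x ≤ 1 := by rw [div_le_one (by linarith)]; exact hx
  linarith

lemma exists_score_expansion : ∃ C : ℝ, 0 < C ∧ ∀ x : ℝ, 16 ≤ x → ∀ k : ℤ,
    |skellamScore x k| ≤ C * scoreEnvelope x k / x ∧
    |skellamScore x k - ((k : ℝ) ^ 2 / x - 1) / (2 * x)| ≤ C * scoreEnvelope x k ^ 2 / x ^ 2 := by
  refine ⟨12290 ^ 2, by norm_num, fun x hx k => ?_⟩
  have hx0 : 0 < x := by linarith
  have hQ1 := one_le_scoreEnvelope hx0 k
  have hQ := one_add_sq_div_le_scoreEnvelope (by linarith : 1 ≤ x) k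
  have hd := abs_riccatiDefect_le k.natAbs hx
  have hv := abs_liouvilleLogDeriv_sub_one_le k.natAbs hx
  set Q := scoreEnvelope x k with hQd
  set v := liouvilleLogDeriv k.natAbs x with hvd
  set d := riccatiDefect k.natAbs x with hdd
  have hv' : |v - 1| ≤ 12289 * Q / x := by
    refine hv.trans ?_
    rw [show 12289 * (1 + (k.natAbs : ℝ) ^ 2) / x ^ 2 =
      12289 * ((1 + (k.natAbs : ℝ) ^ 2) / x) / x by field_simp]
    gcongr
  have hd' : |d| ≤ 12288 * Q ^ 2 / x ^ 2 := by
    refine hd.trans ?_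
    rw [show 12288 * (1 + (k.natAbs : ℝ) ^ 2) / x ^ 3 =
      12288 * ((1 + (k.natAbs : ℝ) ^ 2) / x) / x ^ 2 by field_simp]
    gcongr
    nlinarith
  rw [skellamScore_eq, ← hvd]
  constructor
  · have h1 : |1 / (2 * x)| ≤ Q / x := by
      rw [abs_of_pos (by positivity), div_le_div_iff₀ (by positivity) hx0]
      nlinarith
    refine (abs_sub _ _).trans ((add_le_add hv' h1).trans ?_)
    rw [← add_div]
    gcongr
    linarith
  -- Substitute v − 1 = (v² − 1)/2 − (v − 1)²/2: the first part is explicit up to the defect, the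
  -- second is quadratic in a quantity of order Q/x.
  · have e : v - 1 - 1 / (2 * x) - ((k : ℝ) ^ 2 / x - 1) / (2 * x) =
        d / 2 - (v - 1) ^ 2 / 2 - 1 / (8 * x ^ 2) := by
      rw [hdd, riccatiDefect, ← hvd, natAbs_cast_sq]
      field_simp
      ring
    have h2 : (v - 1) ^ 2 ≤ 12289 ^ 2 * Q ^ 2 / x ^ 2 := by
      rw [← sq_abs]
      refine (pow_le_pow_left₀ (abs_nonneg _) hv' 2).trans_eq (by ring)
    have h3 : 1 / (8 * x ^ 2) ≤ Q ^ 2 / x ^ 2 := by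
      rw [div_le_div_iff₀ (by positivity) (by positivity)]
      have : 1 ≤ Q ^ 2 := by nlinarith
      nlinarith [sq_nonneg x]
    have h4 : 0 ≤ 1 / (8 * x ^ 2) := by positivity
    have h5 : 12290 ^ 2 * Q ^ 2 / x ^ 2 = 12290 ^ 2 * (Q ^ 2 / x ^ 2) := by ring
    have h6 : 12288 * Q ^ 2 / x ^ 2 = 12288 * (Q ^ 2 / x ^ 2) := by ring
    have h7 : 12289 ^ 2 * Q ^ 2 / x ^ 2 = 12289 ^ 2 * (Q ^ 2 / x ^ 2) := by ring
    have h8 : 0 ≤ Q ^ 2 / x ^ 2 := by positivity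
    rw [h6] at hd'
    rw [h7] at h2
    rw [e, h5]
    rw [abs_le] at hd' ⊢
    constructor <;> nlinarith [sq_nonneg (v - 1)]

/-- The second comparison. With v ≈ 1, balancing 2v d against the forcing suggests d ≈ (k² −
1/4)/x³. After this is subtracted the new forcing is (k² − 1/4)(3/x⁴ + 2(1 − v)/x³), which the bound
on v − 1 makes one order smaller on the scale k² ~ x. -/
lemma exists_scoreDeriv_expansion : ∃ C : ℝ, 0 < C ∧ ∀ x : ℝ, 16 ≤ x → ∀ k : ℤ,
    |skellamScoreDeriv x k - (1 / (2 * x ^ 2) - (k : ℝ) ^ 2 / x ^ 3)| ≤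
      C * scoreEnvelope x k ^ 2 / x ^ 3 := by
  have key : ∀ (k : ℕ) {x : ℝ}, 16 ≤ x → |riccatiDefect k x - ((k : ℝ) ^ 2 - 1 / 4) / x ^ 3| ≤
      2 * (0 / x ^ 3 + 3 * (1 + (k : ℝ) ^ 2) / x ^ 4 +
        -- 3145984 = 16⁵ (3 + 16⁻³) covers the starting value at 16, and exceeds the 24578 = 2 ·
        -- 12289 required by the forcing.
        3145984 * (1 + (k : ℝ) ^ 2) ^ 2 / x ^ 5) := by
    intro k x hx
    have hn : (1 : ℝ) ≤ 1 + (k : ℝ) ^ 2 := by nlinarith [sq_nonneg (k : ℝ)]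
    set n : ℝ := 1 + (k : ℝ) ^ 2 with hnd
    have hq : |(k : ℝ) ^ 2 - 1 / 4| ≤ n := abs_sq_sub_quarter_le k
    refine abs_le_of_deriv_add_liouville k (a := 16) (e := fun y => riccatiDefect k y -
        ((k : ℝ) ^ 2 - 1 / 4) / y ^ 3) (e' := fun y => -2 * liouvilleLogDeriv k y * riccatiDefect k y +
        2 * ((k : ℝ) ^ 2 - 1 / 4) / y ^ 3 + 3 * ((k : ℝ) ^ 2 - 1 / 4) / y ^ 4)
      (by norm_num) le_rfl (by positivity) (by positivity) (fun y hy => ?_) (fun y hy => ?_) ?_ hx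
    · have hy0 : 0 < y := by linarith
      refine ((hasDerivAt_riccatiDefect k hy0).sub ((hasDerivAt_const y ((k : ℝ) ^ 2 - 1 / 4)).div
        (hasDerivAt_pow 3 y) (pow_ne_zero 3 hy0.ne'))).congr_deriv ?_
      field_simp
      ring
    · have hy0 : 0 < y := by linarith
      have hv := abs_liouvilleLogDeriv_sub_one_le k hy
      set v := liouvilleLogDeriv k y
      have e : -2 * v * riccatiDefect k y + 2 * ((k : ℝ) ^ 2 - 1 / 4) / y ^ 3 +
          3 * ((k : ℝ) ^ 2 - 1 / 4) / y ^ 4 +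
          2 * v * (riccatiDefect k y - ((k : ℝ) ^ 2 - 1 / 4) / y ^ 3) =
          ((k : ℝ) ^ 2 - 1 / 4) * (3 / y ^ 4 + 2 * (1 - v) / y ^ 3) := by
        field_simp
        ring
      rw [e, abs_mul]
      have h1 : |3 / y ^ 4 + 2 * (1 - v) / y ^ 3| ≤ 3 / y ^ 4 + 2 * (12289 * n / y ^ 2) / y ^ 3 := by
        refine (abs_add_le _ _).trans (add_le_add (abs_of_pos (by positivity)).le ?_)
        rw [abs_div, abs_mul, abs_two, abs_of_pos (pow_pos hy0 3), abs_sub_comm]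
        gcongr
      refine (mul_le_mul hq h1 (abs_nonneg _) (by positivity)).trans ?_
      rw [show n * (3 / y ^ 4 + 2 * (12289 * n / y ^ 2) / y ^ 3) =
        0 / y ^ 3 + 3 * n / y ^ 4 + 24578 * n ^ 2 / y ^ 5 by field_simp; ring]
      gcongr
      norm_num
    · have h1 : |((k : ℝ) ^ 2 - 1 / 4) / 16 ^ 3| ≤ n / 16 ^ 3 := by
        rw [abs_div, abs_of_pos (by positivity : (0 : ℝ) < 16 ^ 3)]
        gcongr
      refine (abs_sub _ _).trans ((add_le_add (abs_riccatiDefect_le k le_rfl) h1).trans ?_)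
      rw [← hnd]
      norm_num
      nlinarith
  refine ⟨2 * 3145984 + 7, by norm_num, fun x hx k => ?_⟩
  have hx0 : 0 < x := by linarith
  have hQ1 := one_le_scoreEnvelope hx0 k
  have hQ := one_add_sq_div_le_scoreEnvelope (by linarith : 1 ≤ x) k
  have hk := key k.natAbs hx
  set Q := scoreEnvelope x k with hQd
  set n : ℝ := 1 + (k.natAbs : ℝ) ^ 2 with hnd
  have hn : 0 < n := by positivity
  rw [skellamScoreDeriv_eq hx0]
  have e : -riccatiDefect k.natAbs x + 1 / (2 * x ^ 2) - (1 / (2 * x ^ 2) - (k : ℝ) ^ 2 / x ^ 3) =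
      -(riccatiDefect k.natAbs x - ((k.natAbs : ℝ) ^ 2 - 1 / 4) / x ^ 3) + 1 / (4 * x ^ 3) := by
    rw [natAbs_cast_sq]
    field_simp
    ring
  rw [e]
  have h1 : 2 * (0 / x ^ 3 + 3 * n / x ^ 4 + 3145984 * n ^ 2 / x ^ 5) ≤
      (2 * 3145984 + 6) * (Q ^ 2 / x ^ 3) := by
    have h2 : n / x ^ 4 ≤ Q ^ 2 / x ^ 3 := by
      rw [show n / x ^ 4 = (n / x) / x ^ 3 by field_simp]
      gcongr
      nlinarith
    have h3 : n ^ 2 / x ^ 5 ≤ Q ^ 2 / x ^ 3 := by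
      rw [show n ^ 2 / x ^ 5 = (n / x) ^ 2 / x ^ 3 by field_simp]
      gcongr
    rw [zero_div, mul_div_assoc, mul_div_assoc]
    linarith
  have h4 : |1 / (4 * x ^ 3)| ≤ Q ^ 2 / x ^ 3 := by
    rw [abs_of_pos (by positivity), div_le_div_iff₀ (by positivity) (by positivity)]
    have h5 : 0 < x ^ 3 := by positivity
    have h6 : 1 ≤ Q ^ 2 := one_le_pow₀ hQ1
    nlinarith
  refine (abs_add_le _ _).trans ((add_le_add ((abs_neg _).trans_le (hk.trans h1)) h4).trans_eq ?_)
  ring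

/-! ### Moments of the scores and Fisher information for large arguments. -/

lemma integral_scoreEnvelope_pow_four_le {x : ℝ} (hx : 1 ≤ x) :
    ∫ k, scoreEnvelope x k ^ 4 ∂skellamMeasure x ≤ 3040 := by
  have hx0 : 0 < x := by linarith
  have hb : ∀ k : ℤ, scoreEnvelope x k ^ 4 ≤ 8 * (1 + (k : ℝ) ^ 8 / x ^ 4) := by
    intro k
    have hq : 0 ≤ (k : ℝ) ^ 2 / x := by positivity
    have e : (k : ℝ) ^ 8 / x ^ 4 = ((k : ℝ) ^ 2 / x) ^ 4 := by rw [div_pow]; ring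
    rw [e, scoreEnvelope]
    set q := (k : ℝ) ^ 2 / x
    nlinarith [sq_nonneg (q - 1), sq_nonneg (q + 1), sq_nonneg (q ^ 2 - 1),
      mul_nonneg (sq_nonneg (q - 1)) (sq_nonneg q), sq_nonneg (q * (q - 1))]
  refine (integral_mono (((polyGrowth_scoreEnvelope x).pow 4).integrable hx0)
    ((((PolyGrowth.const 1).add ((PolyGrowth.cast.pow 8).div_const _)).const_mul 8).integrable hx0)
    hb).trans ?_
  rw [integral_const_mul, integral_add (integrable_const _) ((integrable_cast_pow hx0 8).div_const _),
    integral_div, integral_pow_eight_skellam hx0]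
  simp only [integral_const, probReal_univ, smul_eq_mul, one_mul]
  -- For x ≥ 1 the eighth moment is at most (105 + 210 + 63 + 1) x⁴, and 8 (1 + 379) = 3040.
  have : (105 * x ^ 4 + 210 * x ^ 3 + 63 * x ^ 2 + x) / x ^ 4 ≤ 379 := by
    rw [div_le_iff₀ (by positivity)]
    have h1 : x ^ 3 ≤ x ^ 4 := pow_le_pow_right₀ hx (by norm_num)
    have h2 : x ^ 2 ≤ x ^ 4 := pow_le_pow_right₀ hx (by norm_num)
    have h3 : x ≤ x ^ 4 := le_self_pow₀ hx (by norm_num)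
    linarith
  linarith

lemma integral_le_of_abs_le_envelope {x : ℝ} (hx : 1 ≤ x) {φ : ℤ → ℝ} {c : ℝ}
    (hc : 0 ≤ c) (hb : ∀ k, |φ k| ≤ c * scoreEnvelope x k ^ 4) :
    |∫ k, φ k ∂skellamMeasure x| ≤ 3040 * c := by
  have hx0 : 0 < x := by linarith
  rw [← Real.norm_eq_abs]
  refine (norm_integral_le_of_norm_le ((((polyGrowth_scoreEnvelope x).pow 4).const_mul c).integrable
    hx0) (ae_of_all _ hb)).trans ?_
  rw [integral_const_mul, mul_comm]
  gcongr
  exact integral_scoreEnvelope_pow_four_le hx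

/-- The leading term a = (k²/x − 1)/(2x) of the score g has E[a²] = 1/(2x²) + 1/(4x³) by the exact
moments, and |g² − a²| = |g + a||g − a| is of order Q³/x³. -/
lemma exists_abs_skellamInfo_sub_le : ∃ C : ℝ, 0 < C ∧ ∀ x : ℝ, 16 ≤ x →
    |skellamInfo x - 1 / (2 * x ^ 2)| ≤ C / x ^ 3 := by
  obtain ⟨C, hC, h⟩ := exists_score_expansion
  refine ⟨3040 * (C + C ^ 2) + 1 / 4, by positivity, fun x hx => ?_⟩
  have hx0 : 0 < x := by linarith
  have e : ∫ k : ℤ, (((k : ℝ) ^ 2 / x - 1) / (2 * x)) ^ 2 ∂skellamMeasure x =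
      1 / (2 * x ^ 2) + 1 / (4 * x ^ 3) := by
    rw [show (fun k : ℤ => (((k : ℝ) ^ 2 / x - 1) / (2 * x)) ^ 2) = fun k : ℤ =>
        1 / (4 * x ^ 4) * (k : ℝ) ^ 4 - 1 / (2 * x ^ 3) * (k : ℝ) ^ 2 + 1 / (4 * x ^ 2) by
      ext k; field_simp; ring]
    rw [integral_add ((((PolyGrowth.cast.pow 4).const_mul _).sub
        ((PolyGrowth.cast.pow 2).const_mul _)).integrable hx0) (integrable_const _),
      integral_sub ((integrable_cast_pow hx0 4).const_mul _) ((integrable_cast_pow hx0 2).const_mul _),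
      integral_const_mul, integral_const_mul, integral_sq_skellam hx0, integral_pow_four_skellam hx0]
    simp only [integral_const, probReal_univ, smul_eq_mul, one_mul]
    field_simp
    ring
  have hp : PolyGrowth fun k : ℤ => (((k : ℝ) ^ 2 / x - 1) / (2 * x)) ^ 2 :=
    ((((PolyGrowth.cast.pow 2).div_const x).sub (.const 1)).div_const _).pow 2
  have hb : ∀ k : ℤ, |skellamScore x k ^ 2 - (((k : ℝ) ^ 2 / x - 1) / (2 * x)) ^ 2| ≤
      (C + C ^ 2) / x ^ 3 * scoreEnvelope x k ^ 4 := by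
    intro k
    obtain ⟨h1, h2⟩ := h x hx k
    have hQ1 := one_le_scoreEnvelope hx0 k
    have ha : |((k : ℝ) ^ 2 / x - 1) / (2 * x)| ≤ scoreEnvelope x k / x := by
      rw [abs_div, abs_of_pos (by positivity : 0 < 2 * x)]
      have : |(k : ℝ) ^ 2 / x - 1| ≤ scoreEnvelope x k := by
        have : 0 ≤ (k : ℝ) ^ 2 / x := by positivity
        rw [scoreEnvelope, abs_le]; constructor <;> linarith
      refine div_le_div₀ (by linarith) this hx0 (by linarith)
    set Q := scoreEnvelope x k
    set g := skellamScore x k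
    set a := ((k : ℝ) ^ 2 / x - 1) / (2 * x)
    rw [sq_sub_sq, abs_mul]
    have h3 : |g + a| ≤ (C + 1) * Q / x := by
      refine (abs_add_le _ _).trans ((add_le_add h1 ha).trans_eq (by ring))
    refine (mul_le_mul h3 h2 (abs_nonneg _) (by positivity)).trans ?_
    rw [show (C + 1) * Q / x * (C * Q ^ 2 / x ^ 2) = (C + C ^ 2) / x ^ 3 * Q ^ 3 by ring]
    gcongr
    norm_num
  have h1 := integral_le_of_abs_le_envelope (by linarith : 1 ≤ x) (by positivity) hb
  rw [integral_sub (((polyGrowth_skellamScore hx0).pow 2).integrable hx0) (hp.integrable hx0), e] at h1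
  have h2 : 3040 * ((C + C ^ 2) / x ^ 3) = 3040 * (C + C ^ 2) / x ^ 3 := by ring
  have h3 : 1 / (4 * x ^ 3) = 1 / 4 / x ^ 3 := by field_simp
  rw [h2, h3, abs_le] at h1
  have h4 : 0 ≤ 1 / 4 / x ^ 3 := by positivity
  rw [add_div, abs_le]
  change _ ≤ skellamInfo x - _ ∧ skellamInfo x - _ ≤ _
  unfold skellamInfo
  constructor <;> linarith [h1.1, h1.2]

lemma tendsto_mul_skellamInfo_atTop :
    Tendsto (fun x => 2 * x ^ 2 * skellamInfo x) atTop (𝓝 1) := by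
  obtain ⟨C, hC, h⟩ := exists_abs_skellamInfo_sub_le
  have h0 : Tendsto (fun x : ℝ => 2 * C / x) atTop (𝓝 0) := tendsto_const_nhds.div_atTop tendsto_id
  refine tendsto_iff_norm_sub_tendsto_zero.2 (squeeze_zero' (Eventually.of_forall fun _ =>
    norm_nonneg _) ?_ h0)
  filter_upwards [eventually_ge_atTop 16] with x hx
  have hx0 : 0 < x := by linarith
  rw [show 2 * x ^ 2 * skellamInfo x - 1 = 2 * x ^ 2 * (skellamInfo x - 1 / (2 * x ^ 2)) by
    field_simp, norm_mul, Real.norm_of_nonneg (by positivity), Real.norm_eq_abs]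
  refine (mul_le_mul_of_nonneg_left (h x hx) (by positivity)).trans_eq (by field_simp)

lemma exists_integral_score_pow_four_le : ∃ C : ℝ, 0 < C ∧ ∀ x : ℝ, 16 ≤ x →
    ∫ k, skellamScore x k ^ 4 ∂skellamMeasure x ≤ C / x ^ 4 := by
  obtain ⟨C, hC, h⟩ := exists_score_expansion
  refine ⟨3040 * C ^ 4, by positivity, fun x hx => ?_⟩
  have hx0 : 0 < x := by linarith
  refine (le_abs_self _).trans ((integral_le_of_abs_le_envelope (by linarith) (c := C ^ 4 / x ^ 4)
    (by positivity) fun k => ?_).trans_eq (by ring))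
  rw [abs_pow]
  refine (pow_le_pow_left₀ (abs_nonneg _) (h x hx k).1 4).trans_eq (by ring)

lemma exists_integral_scoreDeriv_sq_le : ∃ C : ℝ, 0 < C ∧ ∀ x : ℝ, 16 ≤ x →
    ∫ k, skellamScoreDeriv x k ^ 2 ∂skellamMeasure x ≤ C / x ^ 4 := by
  obtain ⟨C, hC, h⟩ := exists_scoreDeriv_expansion
  refine ⟨3040 * (C + 1) ^ 2, by positivity, fun x hx => ?_⟩
  have hx0 : 0 < x := by linarith
  refine (le_abs_self _).trans ((integral_le_of_abs_le_envelope (by linarith)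
    (c := (C + 1) ^ 2 / x ^ 4) (by positivity) fun k => ?_).trans_eq (by ring))
  have hQ1 := one_le_scoreEnvelope hx0 k
  have h1 := h x hx k
  have h2 : |1 / (2 * x ^ 2) - (k : ℝ) ^ 2 / x ^ 3| ≤ scoreEnvelope x k ^ 2 / x ^ 2 := by
    have e : 1 / (2 * x ^ 2) - (k : ℝ) ^ 2 / x ^ 3 = (1 / 2 - (k : ℝ) ^ 2 / x) / x ^ 2 := by
      field_simp
    rw [e, abs_div, abs_of_pos (pow_pos hx0 2)]
    gcongr
    have : 0 ≤ (k : ℝ) ^ 2 / x := by positivity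
    rw [scoreEnvelope, abs_le]; constructor <;> nlinarith
  have h3 : C * scoreEnvelope x k ^ 2 / x ^ 3 ≤ C * scoreEnvelope x k ^ 2 / x ^ 2 :=
    div_le_div_of_nonneg_left (by positivity) (by positivity)
      (pow_le_pow_right₀ (by linarith) (by norm_num))
  have h4 : |skellamScoreDeriv x k| ≤ (C + 1) * scoreEnvelope x k ^ 2 / x ^ 2 := by
    calc |skellamScoreDeriv x k| = |(skellamScoreDeriv x k - (1 / (2 * x ^ 2) - (k : ℝ) ^ 2 / x ^ 3))
        + (1 / (2 * x ^ 2) - (k : ℝ) ^ 2 / x ^ 3)| := by ring_nf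
      _ ≤ C * scoreEnvelope x k ^ 2 / x ^ 2 + scoreEnvelope x k ^ 2 / x ^ 2 :=
        (abs_add_le _ _).trans (add_le_add (h1.trans h3) h2)
      _ = _ := by ring
  rw [abs_pow]
  refine (pow_le_pow_left₀ (abs_nonneg _) h4 2).trans_eq (by ring)

/-- The modulus of continuity used for large arguments. Only the leading terms are compared in a
Lipschitz way; the remainders of the expansion are added. The last term does not vanish as x → y,
but it is of order y⁻³ against an information of order y⁻². The bound 32 ≤ y ensures x ≥ 16. -/
lemma exists_abs_scoreDeriv_sub_le_envelope : ∃ C : ℝ, 0 < C ∧ ∀ x y : ℝ, 32 ≤ y →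
    y / 2 ≤ x → x ≤ 3 / 2 * y → ∀ k : ℤ,
      |skellamScoreDeriv x k - skellamScoreDeriv y k| ≤
        |x - y| / y * (38 / y ^ 2 * scoreEnvelope y k) + C / y ^ 3 * scoreEnvelope y k ^ 2 := by
  obtain ⟨C, hC, h⟩ := exists_scoreDeriv_expansion
  refine ⟨33 * C, by positivity, fun x y hy h1 h2 k => ?_⟩
  have hy0 : 0 < y := by linarith
  have hx0 : 0 < x := by linarith
  have hx := h x (by linarith) k
  have hy' := h y (by linarith) k
  have hQ1 := one_le_scoreEnvelope hy0 k
  have hQx : scoreEnvelope x k ≤ 2 * scoreEnvelope y k := by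
    have : (k : ℝ) ^ 2 / x ≤ 2 * ((k : ℝ) ^ 2 / y) := by
      rw [← mul_div_assoc, div_le_div_iff₀ hx0 hy0]
      nlinarith [sq_nonneg (k : ℝ)]
    rw [scoreEnvelope, scoreEnvelope]; linarith
  have hQx1 := one_le_scoreEnvelope hx0 k
  have hxy : 1 / x ≤ 2 / y := by rw [div_le_div_iff₀ hx0 hy0]; linarith
  have hrem : C * scoreEnvelope x k ^ 2 / x ^ 3 ≤ 32 * C / y ^ 3 * scoreEnvelope y k ^ 2 := by
    rw [show C * scoreEnvelope x k ^ 2 / x ^ 3 = C * scoreEnvelope x k ^ 2 * (1 / x) ^ 3 by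
      field_simp]
    calc C * scoreEnvelope x k ^ 2 * (1 / x) ^ 3
        ≤ C * (2 * scoreEnvelope y k) ^ 2 * (2 / y) ^ 3 := by gcongr
      _ = _ := by field_simp; ring
  have hmain : |(1 / (2 * x ^ 2) - (k : ℝ) ^ 2 / x ^ 3) - (1 / (2 * y ^ 2) - (k : ℝ) ^ 2 / y ^ 3)| ≤
      |x - y| / y * (38 / y ^ 2 * scoreEnvelope y k) := by
    set c := 1 / x with hc
    have hc0 : 0 ≤ c := by positivity
    have e : (1 / (2 * x ^ 2) - (k : ℝ) ^ 2 / x ^ 3) - (1 / (2 * y ^ 2) - (k : ℝ) ^ 2 / y ^ 3) =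
        (x - y) / y * (-(1 / 2 * (c * (1 / y + c))) +
          (k : ℝ) ^ 2 * (c * (1 / y ^ 2 + c / y + c ^ 2))) := by
      rw [hc]
      field_simp
      ring
    rw [e, abs_mul, abs_div, abs_of_pos hy0]
    gcongr
    refine (abs_add_le _ _).trans ?_
    rw [abs_neg, abs_of_nonneg (by positivity), abs_of_nonneg (by positivity)]
    calc 1 / 2 * (c * (1 / y + c)) + (k : ℝ) ^ 2 * (c * (1 / y ^ 2 + c / y + c ^ 2))
        ≤ 1 / 2 * ((2 / y) * (1 / y + 2 / y)) +
          (k : ℝ) ^ 2 * ((2 / y) * (1 / y ^ 2 + (2 / y) / y + (2 / y) ^ 2)) := by gcongr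
      _ = 3 / y ^ 2 + 14 / y ^ 2 * ((k : ℝ) ^ 2 / y) := by field_simp; ring
      _ ≤ 38 / y ^ 2 * scoreEnvelope y k := by
        have h3 : 0 ≤ (k : ℝ) ^ 2 / y := by positivity
        have h4 : 0 ≤ 1 / y ^ 2 := by positivity
        rw [scoreEnvelope, show 3 / y ^ 2 = 3 * (1 / y ^ 2) by ring,
          show 14 / y ^ 2 = 14 * (1 / y ^ 2) by ring, show 38 / y ^ 2 = 38 * (1 / y ^ 2) by ring]
        nlinarith [mul_nonneg h4 h3]
  rw [show 33 * C / y ^ 3 * scoreEnvelope y k ^ 2 = 32 * C / y ^ 3 * scoreEnvelope y k ^ 2 +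
    C * scoreEnvelope y k ^ 2 / y ^ 3 by ring]
  have hx2 := hx.trans hrem
  rw [abs_le] at hx2 hy' hmain ⊢
  constructor <;> linarith [hx2.1, hx2.2, hy'.1, hy'.2, hmain.1, hmain.2]

/-! ### The law of the increments of the compound Poisson process -/

section Increments

variable {Ω : Type*} [MeasurableSpace Ω] {P : Measure Ω} [IsProbabilityMeasure P]
  {N : ℝ≥0 → Ω → ℕ} {ε : ℕ → Ω → ℤ} {ϑ : ℝ}

/-- The character `z ↦ e^{i s z}` of `ℤ`. -/
def intChar (s : ℝ) (z : ℤ) : ℂ := Complex.exp ((s : ℂ) * (z : ℂ) * Complex.I)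

lemma norm_intChar (s : ℝ) (z : ℤ) : ‖intChar s z‖ = 1 := by
  rw [intChar, show (s : ℂ) * (z : ℂ) * Complex.I = ((s * z : ℝ) : ℂ) * Complex.I by push_cast; ring]
  exact Complex.norm_exp_ofReal_mul_I _

lemma intChar_sum {ι : Type*} (s : ℝ) (t : Finset ι) (f : ι → ℤ) :
    intChar s (∑ i ∈ t, f i) = ∏ i ∈ t, intChar s (f i) := by
  simp only [intChar]
  rw [← Complex.exp_sum]
  push_cast
  rw [Finset.mul_sum, Finset.sum_mul]

lemma measurable_process (hN : ∀ t, Measurable (N t)) (hε : ∀ i, Measurable (ε i)) (t : ℝ≥0) :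
    Measurable (process N ε t) := by
  have h1 : Measurable fun p : Ω × ℕ => ∑ i ∈ Finset.range p.2, ε i p.1 :=
    measurable_from_prod_countable_left fun n => Finset.measurable_fun_sum (Finset.range n) fun i _ => hε i
  exact h1.comp (measurable_id.prodMk (hN t))

lemma IsModel.integral_intChar_jump (h : IsModel N ε ϑ P) (s : ℝ) (i : ℕ) :
    ∫ ω, intChar s (ε i ω) ∂P = (Real.cos s : ℂ) := by
  have hA : MeasurableSet {ω | ε i ω = 1} := h.jump_measurable i (measurableSet_singleton 1)
  have hB : MeasurableSet {ω | ε i ω = -1} := h.jump_measurable i (measurableSet_singleton (-1))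
  have hd : Disjoint {ω | ε i ω = 1} {ω | ε i ω = -1} :=
    Set.disjoint_left.2 fun ω h1 h2 => by
      simp only [Set.mem_ofPred_eq] at h1 h2
      omega
  have hu : P ({ω | ε i ω = 1} ∪ {ω | ε i ω = -1}) = 1 := by
    rw [measure_union hd hB, h.jump_pos, h.jump_neg, ENNReal.add_halves]
  have hae : ∀ᵐ ω ∂P, ω ∈ {ω | ε i ω = 1} ∪ {ω | ε i ω = -1} :=
    (prob_compl_eq_zero_iff (hA.union hB)).2 hu
  have he : (fun ω => intChar s (ε i ω)) =ᵐ[P] fun ω =>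
      {ω | ε i ω = 1}.indicator (fun _ => intChar s 1) ω +
        {ω | ε i ω = -1}.indicator (fun _ => intChar s (-1)) ω := by
    filter_upwards [hae] with ω hω
    rcases hω with h1 | h1
    · have h2 : ω ∉ {ω | ε i ω = -1} := Set.disjoint_left.1 hd h1
      rw [Set.indicator_of_mem h1, Set.indicator_of_notMem h2, add_zero, show ε i ω = 1 from h1]
    · have h2 : ω ∉ {ω | ε i ω = 1} := Set.disjoint_right.1 hd h1
      rw [Set.indicator_of_mem h1, Set.indicator_of_notMem h2, zero_add, show ε i ω = -1 from h1]
  rw [integral_congr_ae he, integral_add ((integrable_const _).indicator hA)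
    ((integrable_const _).indicator hB), integral_indicator_const _ hA,
    integral_indicator_const _ hB, measureReal_def, measureReal_def, h.jump_pos, h.jump_neg]
  simp only [intChar, Complex.ofReal_cos, Complex.cos]
  simp
  ring

lemma IsModel.integral_prod_intChar_jump (h : IsModel N ε ϑ P) (c : ℕ → ℝ) (t : Finset ℕ) :
    ∫ ω, ∏ i ∈ t, intChar (c i) (ε i ω) ∂P = ∏ i ∈ t, (Real.cos (c i) : ℂ) := by
  have h1 := iIndepFun.integral_fun_prod_comp (ι := t) (X := fun i : t => ε i)
    (h.jump_indep.precomp (g := ((↑) : t → ℕ)) Subtype.val_injective)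
    (f := fun i z => intChar (c i) z) (fun i => (h.jump_measurable i).aemeasurable)
    (fun i => Measurable.aestronglyMeasurable (by fun_prop))
  simp only [h.integral_intChar_jump] at h1
  rw [Finset.prod_coe_sort t (fun i => (Real.cos (c i) : ℂ))] at h1
  rw [← h1]
  refine integral_congr_ae (ae_of_all _ fun ω => ?_)
  exact (Finset.prod_coe_sort t (fun i => intChar (c i) (ε i ω))).symm

/-- Consecutive blocks are disjoint, so one frequency per block can be read as one frequency per
sign; independence of the signs then applies to a single product. -/
lemma exists_blockwise (m : ℕ → ℕ) (hm : Monotone m) (s : ℕ → ℝ) (n : ℕ) :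
    ∃ c : ℕ → ℝ, ∀ j < n, ∀ i ∈ Finset.Ico (m j) (m (j + 1)), c i = s j := by
  induction n with
  | zero => exact ⟨0, fun j hj => absurd hj (Nat.not_lt_zero j)⟩
  | succ n ih =>
    obtain ⟨c, hc⟩ := ih
    refine ⟨fun i => if i < m n then c i else s n, fun j hj i hi => ?_⟩
    rw [Finset.mem_Ico] at hi
    change (if i < m n then c i else s n) = s j
    rcases Nat.lt_succ_iff_lt_or_eq.1 hj with hj | rfl
    · rw [if_pos (hi.2.trans_le (hm hj)), hc j hj i (Finset.mem_Ico.2 hi)]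
    · rw [if_neg (by omega)]

lemma prod_blocks (m : ℕ → ℕ) (hm : Monotone m) (F : ℕ → ℂ) (n : ℕ) :
    ∏ j ∈ Finset.range n, ∏ i ∈ Finset.Ico (m j) (m (j + 1)), F i =
      ∏ i ∈ Finset.Ico (m 0) (m n), F i := by
  induction n with
  | zero => simp
  | succ n ih =>
    rw [Finset.prod_range_succ, ih, Finset.prod_Ico_consecutive _ (hm (Nat.zero_le n))
      (hm (Nat.le_succ n))]

lemma IsModel.integral_blocks (h : IsModel N ε ϑ P) {m : ℕ → ℕ} (hm : Monotone m) (s : ℕ → ℝ)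
    (n : ℕ) :
    ∫ ω, ∏ j ∈ Finset.range n, ∏ i ∈ Finset.Ico (m j) (m (j + 1)), intChar (s j) (ε i ω) ∂P =
      ∏ j ∈ Finset.range n, (Real.cos (s j) : ℂ) ^ (m (j + 1) - m j) := by
  obtain ⟨c, hc⟩ := exists_blockwise m hm s n
  have h1 : ∀ ω, ∏ j ∈ Finset.range n, ∏ i ∈ Finset.Ico (m j) (m (j + 1)), intChar (s j) (ε i ω) =
      ∏ i ∈ Finset.Ico (m 0) (m n), intChar (c i) (ε i ω) := by
    intro ω
    rw [← prod_blocks m hm]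
    refine Finset.prod_congr rfl fun j hj => Finset.prod_congr rfl fun i hi => ?_
    rw [hc j (Finset.mem_range.1 hj) i hi]
  simp only [h1]
  rw [h.integral_prod_intChar_jump, ← prod_blocks m hm]
  refine Finset.prod_congr rfl fun j hj => ?_
  rw [Finset.prod_congr rfl (g := fun _ => (Real.cos (s j) : ℂ)), Finset.prod_const, Nat.card_Ico]
  intro i hi
  rw [hc j (Finset.mem_range.1 hj) i hi]

omit [IsProbabilityMeasure P] in
lemma IsModel.integral_poisson_increments (h : IsModel N ε ϑ P) (hϑ : 0 ≤ ϑ) {t : ℕ → ℝ≥0}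
    (ht : Monotone t) (s : ℕ → ℝ) (n : ℕ) :
    ∫ ω, ∏ j ∈ Finset.range n, (Real.cos (s j) : ℂ) ^ (N (t (j + 1)) ω - N (t j) ω) ∂P =
      ∏ j ∈ Finset.range n,
        Complex.exp (ϑ * ((t (j + 1) : ℝ) - t j : ℝ) * (Real.cos (s j) - 1)) := by
  have hi := (h.poisson.indep_increments.nat ht).precomp (g := ((↑) : Fin n → ℕ)) Fin.val_injective
  have hmeas : ∀ j, Measurable fun ω => (N (t (j + 1)) ω : ℤ) - (N (t j) ω : ℤ) := fun j =>
    (measurable_from_top.comp (h.poisson.measurable _)).sub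
      (measurable_from_top.comp (h.poisson.measurable _))
  have h1 := iIndepFun.integral_fun_prod_comp (ι := Fin n)
    (X := fun (j : Fin n) ω => (N (t (j + 1)) ω : ℤ) - (N (t j) ω : ℤ)) hi (f := fun j z => (Real.cos (s j) : ℂ) ^ z.toNat)
    (fun j => (hmeas j).aemeasurable) (fun j => Measurable.aestronglyMeasurable (by fun_prop))
  rw [Finset.prod_range, ← Fin.prod_congr' _ rfl]
  simp only [Fin.cast_refl, id]
  have h2 : ∀ j : ℕ, ∫ ω, (Real.cos (s j) : ℂ) ^ ((N (t (j + 1)) ω : ℤ) - (N (t j) ω : ℤ)).toNat ∂P =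
      Complex.exp (ϑ * ((t (j + 1) : ℝ) - t j : ℝ) * (Real.cos (s j) - 1)) := by
    intro j
    have hle : (t j : ℝ) ≤ t (j + 1) := by exact_mod_cast ht (Nat.le_succ j)
    have hlaw := h.poisson.increments (t j) (t (j + 1)) (ht (Nat.le_succ j))
    have h3 := hlaw.integral_comp (f := fun z : ℤ => (Real.cos (s j) : ℂ) ^ z.toNat)
      (Measurable.aestronglyMeasurable (by fun_prop))
    simp only [Function.comp_def] at h3
    rw [h3, integral_map .of_discrete .of_discrete, integral_poissonMeasure]
    set r : ℝ≥0 := (ϑ * ((t (j + 1) : ℝ) - t j)).toNNReal with hr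
    have hr' : (r : ℝ) = ϑ * ((t (j + 1) : ℝ) - t j) :=
      Real.coe_toNNReal _ (mul_nonneg hϑ (by linarith))
    have h4 : ∀ k : ℕ, (Real.exp (-r) * (r : ℝ) ^ k / (k.factorial : ℝ)) •
        (Real.cos (s j) : ℂ) ^ ((k : ℤ)).toNat =
        Complex.exp (-r) * ((r * Real.cos (s j) : ℂ) ^ k / (k.factorial : ℂ)) := by
      intro k
      rw [Int.toNat_natCast, Complex.real_smul, mul_pow]
      push_cast
      ring
    simp only [h4]
    rw [tsum_mul_left, (NormedSpace.expSeries_div_hasSum_exp _).tsum_eq, ← Complex.exp_eq_exp_ℂ,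
      ← Complex.exp_add]
    congr 1
    have : (r : ℂ) = ((ϑ * ((t (j + 1) : ℝ) - t j) : ℝ) : ℂ) := by rw [← hr']
    rw [this]
    push_cast
    ring
  simp only [h2] at h1
  rw [← h1]
  refine integral_congr_ae (ae_of_all _ fun ω => ?_)
  simp only
  rw [Finset.prod_range]
  refine Finset.prod_congr rfl fun j _ => ?_
  congr 1
  omega

/-- The joint characteristic function of the increments. Since signs and path are independent,
Fubini allows averaging the signs with the path frozen, which leaves cos(s_j) raised to the number
of jumps; the generating function of independent Poisson increments finishes the computation. -/
lemma IsModel.integral_prod_intChar_increments (h : IsModel N ε ϑ P) (hϑ : 0 ≤ ϑ) {t : ℕ → ℝ≥0}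
    (ht : Monotone t) (s : ℕ → ℝ) (n : ℕ) :
    ∫ ω, ∏ j ∈ Finset.range n, intChar (s j) (process N ε (t (j + 1)) ω - process N ε (t j) ω) ∂P =
      ∏ j ∈ Finset.range n,
        Complex.exp (ϑ * ((t (j + 1) : ℝ) - t j : ℝ) * (Real.cos (s j) - 1)) := by
  set E : Ω → ℕ → ℤ := fun ω i => ε i ω
  set M : Ω → ℕ → ℕ := fun ω j => N (t j) ω
  have hE : Measurable E := measurable_pi_lambda _ h.jump_measurable
  have hM : Measurable M := measurable_pi_lambda _ fun j => h.poisson.measurable (t j)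
  have hind : IndepFun E M P := by
    have hm : Measurable fun (f : ℝ≥0 → ℕ) (j : ℕ) => f (t j) := by fun_prop
    exact h.indep.comp measurable_id hm
  set F : (ℕ → ℤ) × (ℕ → ℕ) → ℂ := fun p => ∏ j ∈ Finset.range n,
    ∏ i ∈ Finset.Ico (p.2 j) (p.2 (j + 1)), intChar (s j) (p.1 i) with hF
  have hFm : Measurable F := by
    refine Finset.measurable_fun_prod _ fun j _ => ?_
    have h1 : Measurable fun q : (ℕ → ℤ) × (ℕ × ℕ) =>
        ∏ i ∈ Finset.Ico q.2.1 q.2.2, intChar (s j) (q.1 i) :=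
      measurable_from_prod_countable_left fun q => Finset.measurable_fun_prod (Finset.Ico q.1 q.2) fun i _ =>
        (Measurable.of_discrete (f := intChar (s j))).comp (measurable_pi_apply i)
    have h2 : Measurable fun p : (ℕ → ℤ) × (ℕ → ℕ) => (p.1, (p.2 j, p.2 (j + 1))) := by fun_prop
    have h3 := h1.comp h2
    simp only [Function.comp_def] at h3
    exact h3
  have hFb : ∀ p, ‖F p‖ ≤ 1 := by
    intro p
    simp only [hF, norm_prod, norm_intChar, Finset.prod_const_one, le_refl]
  have hmono : ∀ᵐ ω ∂P, Monotone (M ω) := by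
    filter_upwards [h.poisson.paths] with ω hω i j hij using hω.1 (ht hij)
  -- The block description is valid only for monotone counts. Monotonicity along a sequence is a
  -- countable intersection of coordinate conditions, hence measurable, and so passes to the law of
  -- the counts.
  have hmono' : ∀ᵐ m ∂(P.map M), Monotone m := by
    refine (ae_map_iff hM.aemeasurable ?_).2 hmono
    have : {m : ℕ → ℕ | Monotone m} = ⋂ j, {m | m j ≤ m (j + 1)} := by
      ext m
      simp only [Set.mem_ofPred_eq, Set.mem_iInter]
      exact ⟨fun hm j => hm (Nat.le_succ j), monotone_nat_of_le_succ⟩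
    rw [this]
    exact MeasurableSet.iInter fun j =>
      measurableSet_le (measurable_pi_apply j) (measurable_pi_apply (j + 1))
  have hleft : ∫ ω, ∏ j ∈ Finset.range n,
      intChar (s j) (process N ε (t (j + 1)) ω - process N ε (t j) ω) ∂P = ∫ ω, F (E ω, M ω) ∂P := by
    refine integral_congr_ae ?_
    filter_upwards [hmono] with ω hω
    simp only [hF]
    refine Finset.prod_congr rfl fun j _ => ?_
    rw [← intChar_sum]
    congr 1
    rw [process, process, Finset.sum_Ico_eq_sub _ (hω (Nat.le_succ j))]
  have : IsProbabilityMeasure (P.map E) := Measure.isProbabilityMeasure_map hE.aemeasurable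
  have : IsProbabilityMeasure (P.map M) := Measure.isProbabilityMeasure_map hM.aemeasurable
  rw [hleft, ← integral_map (μ := P) (φ := fun ω => (E ω, M ω)) (hE.prodMk hM).aemeasurable
    hFm.aestronglyMeasurable, hind.map_prod_eq_prod_map_map hE.aemeasurable hM.aemeasurable,
    integral_prod_symm F (Integrable.of_bound hFm.aestronglyMeasurable 1 (ae_of_all _ hFb))]
  have hinner : ∀ᵐ m ∂(P.map M), ∫ e, F (e, m) ∂(P.map E) =
      ∏ j ∈ Finset.range n, (Real.cos (s j) : ℂ) ^ (m (j + 1) - m j) := by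
    filter_upwards [hmono'] with m hm
    have hFm' : Measurable fun e => F (e, m) := hFm.comp (measurable_id.prodMk measurable_const)
    rw [integral_map hE.aemeasurable hFm'.aestronglyMeasurable]
    exact h.integral_blocks hm s n
  rw [integral_congr_ae hinner, integral_map hM.aemeasurable]
  · exact h.integral_poisson_increments hϑ ht s n
  · refine (Finset.measurable_fun_prod _ fun j _ => ?_).aestronglyMeasurable
    have h1 : Measurable fun q : ℕ × ℕ => (Real.cos (s j) : ℂ) ^ (q.2 - q.1) := .of_discrete
    have h2 : Measurable fun m : ℕ → ℕ => (m j, m (j + 1)) := by fun_prop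
    exact h1.comp h2

/-- Characteristic functions determine the image laws on ℝ, and the injective cast from ℤ brings the
identity back. -/
lemma hasLaw_skellam_of_intChar {D : Ω → ℤ} (hD : Measurable D) {x : ℝ} (hx : 0 ≤ x)
    (h : ∀ s : ℝ, ∫ ω, intChar s (D ω) ∂P = Complex.exp (x * (Real.cos s - 1))) :
    HasLaw D (skellamMeasure x) P := by
  refine ⟨hD.aemeasurable, ?_⟩
  have hc : Measurable (Int.cast : ℤ → ℝ) := .of_discrete
  have : IsProbabilityMeasure (P.map D) := Measure.isProbabilityMeasure_map hD.aemeasurable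
  have key : (P.map D).map (Int.cast : ℤ → ℝ) = (skellamMeasure x).map (Int.cast : ℤ → ℝ) := by
    have := Measure.isProbabilityMeasure_map (μ := P.map D) hc.aemeasurable
    have := Measure.isProbabilityMeasure_map (μ := skellamMeasure x) hc.aemeasurable
    refine Measure.ext_of_charFun (funext fun s => ?_)
    rw [charFun_apply_real, charFun_apply_real, integral_map hc.aemeasurable (by fun_prop),
      integral_map hc.aemeasurable (by fun_prop), integral_map hD.aemeasurable (by fun_prop)]
    have h1 := h s
    have h2 := charFun_skellamMeasure hx s
    simp only [intChar] at h1
    simp only [Complex.ofReal_intCast]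
    rw [h1, h2, Complex.ofReal_cos]
  ext A hA
  have hinj : Function.Injective (Int.cast : ℤ → ℝ) := Int.cast_injective
  have hA' : MeasurableSet ((Int.cast : ℤ → ℝ) '' A) :=
    (Set.to_countable A).image _ |>.measurableSet
  have h1 := congrArg (fun μ => μ ((Int.cast : ℤ → ℝ) '' A)) key
  simpa [Measure.map_apply hc hA', Set.preimage_image_eq _ hinj] using h1

/-- The increments of the process have Skellam laws. -/
theorem IsModel.hasLaw_increment (h : IsModel N ε ϑ P) (hϑ : 0 ≤ ϑ) {u v : ℝ≥0} (huv : u ≤ v) :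
    HasLaw (fun ω => process N ε v ω - process N ε u ω) (skellamMeasure (ϑ * ((v : ℝ) - u))) P := by
  have hX := measurable_process h.poisson.measurable h.jump_measurable
  refine hasLaw_skellam_of_intChar ((hX v).sub (hX u))
    (mul_nonneg hϑ (sub_nonneg.2 (by exact_mod_cast huv))) fun s => ?_
  -- A single increment is the first one along the monotone sequence u, v, v, ….
  have h1 := h.integral_prod_intChar_increments hϑ (t := fun j => if j = 0 then u else v)
    (monotone_nat_of_le_succ fun j => by rcases j with _ | j <;> simp [huv]) (fun _ => s) 1
  simp only [Finset.range_one, Finset.prod_singleton] at h1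
  simpa using h1

/-- The increments of the process along a monotone sequence of times are independent. -/
theorem IsModel.iIndepFun_increments (h : IsModel N ε ϑ P) (hϑ : 0 ≤ ϑ) {t : ℕ → ℝ≥0}
    (ht : Monotone t) :
    iIndepFun (fun j ω => process N ε (t (j + 1)) ω - process N ε (t j) ω) P := by
  have hX := measurable_process h.poisson.measurable h.jump_measurable
  set D : ℕ → Ω → ℤ := fun j ω => process N ε (t (j + 1)) ω - process N ε (t j) ω with hDdef
  have hD : ∀ j, Measurable (D j) := fun j => (hX _).sub (hX _)
  have hDr : ∀ j, Measurable fun ω => (D j ω : ℝ) := fun j =>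
    (Measurable.of_discrete (f := (Int.cast : ℤ → ℝ))).comp (hD j)
  have hlaw : ∀ (j : ℕ) (s : ℝ), ∫ ω, intChar s (D j ω) ∂P =
      Complex.exp (ϑ * ((t (j + 1) : ℝ) - t j : ℝ) * (Real.cos s - 1)) := by
    intro j s
    have hle : (t j : ℝ) ≤ t (j + 1) := by exact_mod_cast ht (Nat.le_succ j)
    have h1 := (h.hasLaw_increment hϑ (ht (Nat.le_succ j))).integral_comp (f := intChar s)
      (Measurable.aestronglyMeasurable .of_discrete)
    have h2 := charFun_skellamMeasure (mul_nonneg hϑ (sub_nonneg.2 hle)) s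
    simp only [Function.comp_def] at h1
    simp only [hDdef]
    rw [h1]
    simp only [intChar]
    rw [h2]
    push_cast
    ring_nf
  have hfin : ∀ n : ℕ, iIndepFun (fun (j : Fin n) ω => (D j ω : ℝ)) P := by
    intro n
    refine (iIndepFun_iff_charFun_pi (X := fun (j : Fin n) ω => (D j ω : ℝ))
      fun j => (hDr j).aemeasurable).2 fun s => ?_
    set s' : ℕ → ℝ := fun j => if hj : j < n then s ⟨j, hj⟩ else 0 with hs'
    have hs : ∀ j : Fin n, s' j = s j := fun j => by simp [hs']
    have h1 := h.integral_prod_intChar_increments hϑ ht s' n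
    rw [charFun_apply, integral_map (by fun_prop) (by fun_prop)]
    have e1 : ∀ j : Fin n, charFun (P.map fun ω => (D j ω : ℝ)) (s j) =
        Complex.exp (ϑ * ((t ((j : ℕ) + 1) : ℝ) - t j : ℝ) * (Real.cos (s' j) - 1)) := by
      intro j
      rw [← hlaw, charFun_apply_real, integral_map (hDr j).aemeasurable (by fun_prop), hs]
      simp [intChar]
    rw [Finset.prod_congr rfl fun j _ => e1 j, ← Finset.prod_range
      (fun j => Complex.exp (ϑ * ((t (j + 1) : ℝ) - t j : ℝ) * (Real.cos (s' j) - 1))), ← h1]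
    refine integral_congr_ae (ae_of_all _ fun ω => ?_)
    simp only [PiLp.inner_apply]
    rw [Finset.prod_range]
    simp only [intChar, hs]
    rw [← Complex.exp_sum]
    congr 1
    simp only [Real.inner_apply, hDdef]
    push_cast
    rw [Finset.sum_mul]
    exact Finset.sum_congr rfl fun j _ => by ring
  -- Independence was obtained for the real-valued casts; rounding is a measurable left inverse of
  -- the cast.
  have hround : ∀ n : ℕ, iIndepFun (fun (j : Fin n) => D j) P := by
    intro n
    have h1 := (hfin n).comp (fun _ => (round : ℝ → ℤ)) (fun _ => by
      have : (round : ℝ → ℤ) = fun x => ⌊x + 1 / 2⌋ := funext fun x => round_eq x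
      rw [this]
      exact Int.measurable_floor.comp (measurable_id.add_const _))
    simpa [Function.comp_def] using h1
  refine iIndepFun_iff_finset.2 fun s => ?_
  obtain ⟨n, hn⟩ := s.bddAbove
  exact (hround (n + 1)).precomp (g := fun x : s => (⟨x.1, Nat.lt_succ_of_le (hn x.2)⟩ : Fin (n + 1)))
    (fun a b hab => Subtype.ext (Fin.mk.inj hab))

omit [IsProbabilityMeasure P] in
lemma IsModel.process_zero (h : IsModel N ε ϑ P) : ∀ᵐ ω ∂P, process N ε 0 ω = 0 := by
  filter_upwards [h.poisson.zero] with ω hω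
  simp [process, hω]

lemma IsModel.hasLaw_process (h : IsModel N ε ϑ P) (hϑ : 0 ≤ ϑ) (v : ℝ≥0) :
    HasLaw (process N ε v) (skellamMeasure (ϑ * v)) P := by
  have h1 := h.hasLaw_increment hϑ (zero_le (a := v))
  simp only [NNReal.coe_zero, sub_zero] at h1
  refine h1.congr ?_
  filter_upwards [h.process_zero] with ω hω
  simp [hω]

end Increments

/-! ### The likelihood -/

section Likelihood

variable {Ω : Type*} [MeasurableSpace Ω] {P : ℝ → Measure Ω} [∀ ϑ, IsProbabilityMeasure (P ϑ)]
  {N : ℝ≥0 → Ω → ℕ} {ε : ℕ → Ω → ℤ}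

/-- The likelihood depends on ϑ and Δ only through ϑΔ. As this holds for all positive parameters,
the formula may be differentiated, each derivative in ϑ bringing a factor Δ. -/
lemma likelihood_eq (hmodel : ∀ ϑ : ℝ, 0 < ϑ → IsModel N ε ϑ (P ϑ)) {Δ : ℝ≥0} (hΔ : 0 < Δ)
    {ϑ : ℝ} (hϑ : 0 < ϑ) (k : ℤ) :
    likelihood P (process N ε) Δ ϑ k = skellam (ϑ * Δ) k := by
  have h1 := (hmodel ϑ hϑ).hasLaw_process hϑ.le Δ
  rw [likelihood, ← skellamMeasure_real_singleton (mul_pos hϑ (by exact_mod_cast hΔ))]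
  exact h1.measureReal_eq (p := fun z => z = k) (measurableSet_singleton k)

lemma score_eq (hmodel : ∀ ϑ : ℝ, 0 < ϑ → IsModel N ε ϑ (P ϑ)) {Δ : ℝ≥0} (hΔ : 0 < Δ)
    {ϑ : ℝ} (hϑ : 0 < ϑ) (k : ℤ) :
    score (likelihood P (process N ε) Δ) ϑ k = Δ * skellamScore (ϑ * Δ) k := by
  have hx : 0 < ϑ * (Δ : ℝ) := mul_pos hϑ (by exact_mod_cast hΔ)
  have h1 : (fun θ => Real.log (likelihood P (process N ε) Δ θ k)) =ᶠ[𝓝 ϑ]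
      fun θ => Real.log (skellam (θ * Δ) k) := by
    filter_upwards [lt_mem_nhds hϑ] with θ hθ
    rw [likelihood_eq hmodel hΔ hθ]
  have h2 : HasDerivAt (fun θ => Real.log (skellam (θ * Δ) k)) (skellamScore (ϑ * Δ) k * (1 * Δ)) ϑ :=
    HasDerivAt.comp (h₂ := fun y => Real.log (skellam y k)) (h := fun θ => θ * (Δ : ℝ)) ϑ
      (hasDerivAt_log_skellam hx k) ((hasDerivAt_id' ϑ).mul_const (Δ : ℝ))
  rw [score, h1.deriv_eq, h2.deriv]
  ring

lemma hasDerivAt_score (hmodel : ∀ ϑ : ℝ, 0 < ϑ → IsModel N ε ϑ (P ϑ)) {Δ : ℝ≥0} (hΔ : 0 < Δ)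
    {ϑ : ℝ} (hϑ : 0 < ϑ) (k : ℤ) :
    HasDerivAt (fun θ => score (likelihood P (process N ε) Δ) θ k)
      (Δ ^ 2 * skellamScoreDeriv (ϑ * Δ) k) ϑ := by
  have hx : 0 < ϑ * (Δ : ℝ) := mul_pos hϑ (by exact_mod_cast hΔ)
  have h2 : HasDerivAt (fun θ : ℝ => (Δ : ℝ) * skellamScore (θ * Δ) k)
      (Δ * (skellamScoreDeriv (ϑ * Δ) k * (1 * Δ))) ϑ :=
    (HasDerivAt.comp (h₂ := fun y => skellamScore y k) (h := fun θ => θ * (Δ : ℝ)) ϑ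
      (hasDerivAt_skellamScore hx k) ((hasDerivAt_id' ϑ).mul_const (Δ : ℝ))).const_mul _
  refine (h2.congr_of_eventuallyEq ?_).congr_deriv (by ring)
  filter_upwards [lt_mem_nhds hϑ] with θ hθ using score_eq hmodel hΔ hθ k

lemma scoreDeriv_eq (hmodel : ∀ ϑ : ℝ, 0 < ϑ → IsModel N ε ϑ (P ϑ)) {Δ : ℝ≥0} (hΔ : 0 < Δ)
    {ϑ : ℝ} (hϑ : 0 < ϑ) (k : ℤ) :
    scoreDeriv (likelihood P (process N ε) Δ) ϑ k = Δ ^ 2 * skellamScoreDeriv (ϑ * Δ) k :=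
  (hasDerivAt_score hmodel hΔ hϑ k).deriv

lemma fisherInformation_eq (hmodel : ∀ ϑ : ℝ, 0 < ϑ → IsModel N ε ϑ (P ϑ)) {Δ : ℝ≥0} (hΔ : 0 < Δ)
    {ϑ : ℝ} (hϑ : 0 < ϑ) (T : ℝ≥0) :
    fisherInformation P (process N ε) T Δ ϑ = numObs T Δ * Δ ^ 2 * skellamInfo (ϑ * Δ) := by
  have h1 := ((hmodel ϑ hϑ).hasLaw_process hϑ.le Δ).integral_comp
    (f := fun k => skellamScore (ϑ * Δ) k ^ 2) (Measurable.aestronglyMeasurable .of_discrete)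
  simp only [Function.comp_def] at h1
  simp only [fisherInformation, score_eq hmodel hΔ hϑ, mul_pow]
  rw [integral_const_mul, h1, skellamInfo]
  ring

lemma information_eq (hmodel : ∀ ϑ : ℝ, 0 < ϑ → IsModel N ε ϑ (P ϑ)) (Δ : ℝ≥0)
    {ϑ : ℝ} (hϑ : 0 < ϑ) (T : ℝ≥0) :
    information P (process N ε) T Δ ϑ = T * Δ * skellamInfo (ϑ * Δ) := by
  have h1 := ((hmodel ϑ hϑ).hasLaw_process hϑ.le Δ).integral_comp
    (f := fun k => skellamScore (ϑ * Δ) k ^ 2) (Measurable.aestronglyMeasurable .of_discrete)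
  simp only [Function.comp_def] at h1
  rw [information, skellamInfo, ← h1]
  congr 1
  refine integral_congr_ae (ae_of_all _ fun ω => ?_)
  simp only [skellamScore, besselRatio, ratio]
  rw [Nat.cast_natAbs, Int.cast_abs, div_eq_inv_mul |((process N ε Δ ω : ℤ) : ℝ)|]

end Likelihood

/-! ### A central limit theorem for triangular arrays with independent rows of equal laws -/

lemma norm_cexp_sub_taylor_le (y : ℝ) :
    ‖Complex.exp (y * Complex.I) - (1 + y * Complex.I - (y : ℂ) ^ 2 / 2)‖ ≤ 4 * |y| ^ 3 := by
  rcases le_or_gt |y| 1 with h | h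
  · have hn : ‖(y * Complex.I : ℂ)‖ = |y| := by simp
    have h1 := Complex.exp_bound (x := y * Complex.I) (by rw [hn]; exact h) (n := 3) (by norm_num)
    rw [hn] at h1
    simp only [Finset.sum_range_succ, Finset.sum_range_zero] at h1
    have e : (0 + (y * Complex.I : ℂ) ^ 0 / (Nat.factorial 0 : ℕ) +
        (y * Complex.I : ℂ) ^ 1 / (Nat.factorial 1 : ℕ) +
        (y * Complex.I : ℂ) ^ 2 / (Nat.factorial 2 : ℕ)) = 1 + y * Complex.I - (y : ℂ) ^ 2 / 2 := by
      rw [mul_pow (y : ℂ) Complex.I 2, Complex.I_sq]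
      simp [Nat.factorial]
      ring
    rw [e] at h1
    refine h1.trans ?_
    have : (0 : ℝ) ≤ |y| ^ 3 := by positivity
    norm_num [Nat.factorial]
    linarith
  · have h1 : ‖Complex.exp (y * Complex.I)‖ = 1 := Complex.norm_exp_ofReal_mul_I y
    have h2 : ‖(1 + y * Complex.I - (y : ℂ) ^ 2 / 2)‖ ≤ 1 + |y| + |y| ^ 2 / 2 := by
      refine (norm_sub_le _ _).trans (add_le_add ((norm_add_le _ _).trans ?_) ?_) <;> simp
    refine (norm_sub_le _ _).trans ?_
    rw [h1]
    have h3 : |y| ≤ |y| ^ 3 := le_self_pow₀ h.le (by norm_num)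
    have h4 : |y| ^ 2 ≤ |y| ^ 3 := pow_le_pow_right₀ h.le (by norm_num)
    linarith

lemma norm_pow_sub_pow_le_mul {z w : ℂ} (hz : ‖z‖ ≤ 1) (hw : ‖w‖ ≤ 1) (n : ℕ) :
    ‖z ^ n - w ^ n‖ ≤ n * ‖z - w‖ := by
  induction n with
  | zero => simp
  | succ n ih =>
    have e : z ^ (n + 1) - w ^ (n + 1) = (z ^ n - w ^ n) * z + w ^ n * (z - w) := by ring
    rw [e]
    refine (norm_add_le _ _).trans ?_
    rw [norm_mul, norm_mul, norm_pow]
    have h1 : ‖z ^ n - w ^ n‖ * ‖z‖ ≤ n * ‖z - w‖ :=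
      (mul_le_of_le_one_right (norm_nonneg _) hz).trans ih
    have h2 : ‖w‖ ^ n * ‖z - w‖ ≤ ‖z - w‖ :=
      mul_le_of_le_one_left (norm_nonneg _) (pow_le_one₀ (norm_nonneg _) hw)
    push_cast
    linarith

/-- A quantitative Lyapunov estimate: the n-th powers are compared through n‖z − w‖, where z is the
characteristic function of one summand and w = e^{−t²/(2n)}; both are close to 1 − t²/(2n). -/
lemma norm_charFun_pow_sub_le {μ : Measure ℤ} [IsProbabilityMeasure μ] {φ : ℤ → ℝ}
    (h1 : Integrable φ μ) (h2 : Integrable (fun k => φ k ^ 2) μ)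
    (h4 : Integrable (fun k => φ k ^ 4) μ) (h0 : ∫ k, φ k ∂μ = 0) {n : ℕ} (hn : 0 < n)
    (hv : n * ∫ k, φ k ^ 2 ∂μ = 1) (t : ℝ) (ht : t ^ 2 ≤ 2 * n) :
    ‖(∫ k, Complex.exp ((t * φ k : ℝ) * Complex.I) ∂μ) ^ n - Complex.exp (-(t ^ 2) / 2)‖ ≤
      4 * |t| ^ 3 * (Real.sqrt (n * ∫ k, φ k ^ 4 ∂μ) + 1 / n) + t ^ 4 / (4 * n) := by
  have hn' : (0 : ℝ) < n := by exact_mod_cast hn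
  set L : ℝ := n * ∫ k, φ k ^ 4 ∂μ with hL
  have hL0 : 0 ≤ L := mul_nonneg hn'.le (integral_nonneg fun k => by positivity)
  -- The third absolute moment is interpolated between the second and the fourth, giving δ/2 +
  -- L/(2δ) ≤ δ once δ ≥ √L. The summand 1/n keeps δ positive when L = 0.
  set δ : ℝ := Real.sqrt L + 1 / n with hδ
  have hδ0 : 0 < δ := by positivity
  have hcub : ∀ k, |φ k| ^ 3 ≤ δ / 2 * φ k ^ 2 + 1 / (2 * δ) * φ k ^ 4 := by
    intro k
    have e : δ / 2 * φ k ^ 2 + 1 / (2 * δ) * φ k ^ 4 - |φ k| ^ 3 =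
        (δ * |φ k| - |φ k| ^ 2) ^ 2 / (2 * δ) := by
      rw [show φ k ^ 4 = |φ k| ^ 4 by rw [← abs_pow]; exact (abs_of_nonneg (by positivity)).symm,
        ← sq_abs (φ k)]
      field_simp
      ring
    have : 0 ≤ (δ * |φ k| - |φ k| ^ 2) ^ 2 / (2 * δ) := by positivity
    linarith
  have h3b : Integrable (fun k => δ / 2 * φ k ^ 2 + 1 / (2 * δ) * φ k ^ 4) μ :=
    (h2.const_mul _).add (h4.const_mul _)
  have h3 : Integrable (fun k => |φ k| ^ 3) μ :=
    h3b.mono' (Measurable.aestronglyMeasurable .of_discrete) (ae_of_all _ fun k => by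
      rw [Real.norm_of_nonneg (by positivity)]; exact hcub k)
  have hI3 : n * ∫ k, |φ k| ^ 3 ∂μ ≤ δ := by
    have h5 : ∫ k, |φ k| ^ 3 ∂μ ≤ δ / 2 * ∫ k, φ k ^ 2 ∂μ + 1 / (2 * δ) * ∫ k, φ k ^ 4 ∂μ := by
      rw [← integral_const_mul, ← integral_const_mul,
        ← integral_add (h2.const_mul _) (h4.const_mul _)]
      exact integral_mono h3 h3b hcub
    have h6 : L / (2 * δ) ≤ δ / 2 := by
      rw [div_le_div_iff₀ (by positivity) two_pos]
      have h7 : L = Real.sqrt L ^ 2 := (Real.sq_sqrt hL0).symm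
      have h8 : Real.sqrt L ≤ δ := by rw [hδ]; linarith [show 0 < 1 / (n : ℝ) by positivity]
      have h9 := Real.sqrt_nonneg L
      nlinarith
    calc n * ∫ k, |φ k| ^ 3 ∂μ
        ≤ n * (δ / 2 * ∫ k, φ k ^ 2 ∂μ + 1 / (2 * δ) * ∫ k, φ k ^ 4 ∂μ) := by gcongr
      _ = δ / 2 * (n * ∫ k, φ k ^ 2 ∂μ) + L / (2 * δ) := by rw [hL]; ring
      _ ≤ δ := by rw [hv]; linarith
  set z : ℂ := ∫ k, Complex.exp ((t * φ k : ℝ) * Complex.I) ∂μ with hz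
  set w : ℂ := Complex.exp ((-(t ^ 2 / (2 * n)) : ℝ)) with hw
  have hz1 : ‖z‖ ≤ 1 := by
    refine (norm_integral_le_of_norm_le_const (ae_of_all _ fun k => ?_)).trans_eq
      (b := 1 * μ.real Set.univ) (by simp)
    exact (Complex.norm_exp_ofReal_mul_I _).le
  have hw1 : ‖w‖ ≤ 1 := by
    rw [hw, Complex.norm_exp_ofReal]
    exact Real.exp_le_one_iff.2 (by rw [neg_nonpos]; positivity)
  have hwn : w ^ n = Complex.exp (-(t ^ 2) / 2) := by
    rw [hw, ← Complex.exp_nat_mul]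
    congr 1
    have hn0 : (n : ℂ) ≠ 0 := by exact_mod_cast hn.ne'
    push_cast
    field_simp
  have hzt : ‖z - (1 - (t ^ 2 / (2 * n) : ℝ))‖ ≤ 4 * |t| ^ 3 * ∫ k, |φ k| ^ 3 ∂μ := by
    have hexp : Integrable (fun k => Complex.exp ((t * φ k : ℝ) * Complex.I)) μ :=
      Integrable.of_bound (Measurable.aestronglyMeasurable .of_discrete) 1
        (ae_of_all _ fun k => (Complex.norm_exp_ofReal_mul_I _).le)
    have hi1 : Integrable (fun k => ((t * φ k : ℝ) : ℂ) * Complex.I) μ :=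
      ((h1.const_mul t).ofReal).mul_const _
    have hi2 : Integrable (fun k => ((t * φ k : ℝ) : ℂ) ^ 2 / 2) μ := by
      have : Integrable (fun k => (((t ^ 2 / 2) * φ k ^ 2 : ℝ) : ℂ)) μ := (h2.const_mul _).ofReal
      refine this.congr (ae_of_all _ fun k => ?_)
      push_cast
      ring
    have hi12 : Integrable (fun k => 1 + ((t * φ k : ℝ) : ℂ) * Complex.I) μ :=
      (integrable_const _).add hi1
    have hi123 : Integrable (fun k => 1 + ((t * φ k : ℝ) : ℂ) * Complex.I -
        ((t * φ k : ℝ) : ℂ) ^ 2 / 2) μ := hi12.sub hi2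
    have e : (1 - (t ^ 2 / (2 * n) : ℝ) : ℂ) =
        ∫ k, (1 + ((t * φ k : ℝ) : ℂ) * Complex.I - ((t * φ k : ℝ) : ℂ) ^ 2 / 2) ∂μ := by
      rw [integral_sub hi12 hi2, integral_add (integrable_const _) hi1,
        integral_mul_const, integral_complex_ofReal, integral_const_mul, h0]
      have e2 : ∫ k, ((t * φ k : ℝ) : ℂ) ^ 2 / 2 ∂μ = ((t ^ 2 / 2 * ∫ k, φ k ^ 2 ∂μ : ℝ) : ℂ) := by
        rw [← integral_const_mul, ← integral_complex_ofReal]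
        refine integral_congr_ae (ae_of_all _ fun k => ?_)
        push_cast
        ring
      have e3 : ∫ k, φ k ^ 2 ∂μ = 1 / n := by rw [eq_div_iff hn'.ne']; linarith
      rw [e2, e3]
      simp
      field_simp
    rw [e, hz, ← integral_sub hexp hi123,
      ← integral_const_mul]
    refine norm_integral_le_of_norm_le (h3.const_mul _) (ae_of_all _ fun k => ?_)
    refine (norm_cexp_sub_taylor_le (t * φ k)).trans_eq ?_
    rw [abs_mul]
    ring
  have hwt : ‖((1 - (t ^ 2 / (2 * n) : ℝ)) : ℂ) - w‖ ≤ (t ^ 2 / (2 * n)) ^ 2 := by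
    have h5 := Real.abs_exp_sub_one_sub_id_le (x := -(t ^ 2 / (2 * n))) (by
      rw [abs_neg, abs_of_nonneg (by positivity), div_le_one (by positivity)]
      exact ht)
    have e : ((1 - (t ^ 2 / (2 * n) : ℝ)) : ℂ) - w =
        ((-(Real.exp (-(t ^ 2 / (2 * n))) - 1 - -(t ^ 2 / (2 * n))) : ℝ) : ℂ) := by
      rw [hw]
      push_cast
      ring
    rw [e, Complex.norm_real, Real.norm_eq_abs, abs_neg]
    refine h5.trans_eq (by ring)
  rw [← hwn]
  refine (norm_pow_sub_pow_le_mul hz1 hw1 n).trans ?_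
  have h5 : ‖z - w‖ ≤ 4 * |t| ^ 3 * ∫ k, |φ k| ^ 3 ∂μ + (t ^ 2 / (2 * n)) ^ 2 := by
    rw [show z - w = (z - (1 - (t ^ 2 / (2 * n) : ℝ))) + ((1 - (t ^ 2 / (2 * n) : ℝ)) - w) by ring]
    exact (norm_add_le _ _).trans (add_le_add hzt hwt)
  calc n * ‖z - w‖ ≤ n * (4 * |t| ^ 3 * ∫ k, |φ k| ^ 3 ∂μ + (t ^ 2 / (2 * n)) ^ 2) := by gcongr
    _ = 4 * |t| ^ 3 * (n * ∫ k, |φ k| ^ 3 ∂μ) + t ^ 4 / (4 * n) := by field_simp; ring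
    _ ≤ _ := by gcongr

section Rows

variable {Ω : Type*} [MeasurableSpace Ω] {P : Measure Ω}

lemma charFun_sum_row [IsProbabilityMeasure P] {D : ℕ → Ω → ℤ} {μ : Measure ℤ} (hind : iIndepFun D P)
    (hD : ∀ i, HasLaw (D i) μ P) (φ : ℤ → ℝ) (n : ℕ) (t : ℝ) :
    charFun (P.map fun ω => ∑ i ∈ Finset.range n, φ (D i ω)) t =
      (∫ k, Complex.exp ((t * φ k : ℝ) * Complex.I) ∂μ) ^ n := by
  have hφ : Measurable φ := .of_discrete
  have hm : ∀ i, AEMeasurable (fun ω => φ (D i ω)) P := fun i => hφ.comp_aemeasurable (hD i).aemeasurable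
  have hi : iIndepFun (fun i ω => φ (D i ω)) P := hind.comp (fun _ => φ) fun _ => hφ
  rw [iIndepFun.charFun_map_fun_finsetSum_eq_prod (s := Finset.range n)
    (X := fun i ω => φ (D i ω)) (fun i _ => hm i) (hi.restrict _), Finset.prod_apply]
  rw [Finset.prod_congr rfl (g := fun _ => ∫ k, Complex.exp ((t * φ k : ℝ) * Complex.I) ∂μ)]
  · simp
  · intro i _
    rw [charFun_apply_real, integral_map (hm i) (by fun_prop)]
    have h1 := (hD i).integral_comp (f := fun k => Complex.exp ((t * φ k : ℝ) * Complex.I))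
      (Measurable.aestronglyMeasurable .of_discrete)
    rw [← h1]
    simp

/-- A central limit theorem for triangular arrays under a fourth moment Lyapunov condition. -/
theorem tendstoInDistribution_sum_row [IsProbabilityMeasure P] {ι : Type*} {l : Filter ι} [l.IsCountablyGenerated]
    {D : ι → ℕ → Ω → ℤ} {μ : ι → Measure ℤ} [∀ T, IsProbabilityMeasure (μ T)]
    (hind : ∀ T, iIndepFun (D T) P) (hD : ∀ T i, HasLaw (D T i) (μ T) P)
    {φ : ι → ℤ → ℝ} {n : ι → ℕ}
    (h1 : ∀ᶠ T in l, Integrable (φ T) (μ T))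
    (h2 : ∀ᶠ T in l, Integrable (fun k => φ T k ^ 2) (μ T))
    (h4 : ∀ᶠ T in l, Integrable (fun k => φ T k ^ 4) (μ T))
    (h0 : ∀ᶠ T in l, ∫ k, φ T k ∂μ T = 0) (hv : ∀ᶠ T in l, n T * ∫ k, φ T k ^ 2 ∂μ T = 1)
    (hn : Tendsto (fun T => (n T : ℝ)) l atTop)
    (hL : Tendsto (fun T => n T * ∫ k, φ T k ^ 4 ∂μ T) l (𝓝 0)) :
    TendstoInDistribution (fun T ω => ∑ i ∈ Finset.range (n T), φ T (D T i ω)) l (id : ℝ → ℝ)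
      (fun _ => P) (gaussianReal 0 1) := by
  have hm : ∀ T, AEMeasurable (fun ω => ∑ i ∈ Finset.range (n T), φ T (D T i ω)) P := fun T =>
    Finset.aemeasurable_fun_sum _ fun i _ =>
      (Measurable.of_discrete (f := φ T)).comp_aemeasurable (hD T i).aemeasurable
  have hchar : ∀ t : ℝ, Tendsto (fun T => charFun (P.map fun ω => ∑ i ∈ Finset.range (n T),
      φ T (D T i ω)) t) l (𝓝 (Complex.exp (-(t ^ 2) / 2))) := by
    intro t
    have hb : Tendsto (fun T => 4 * |t| ^ 3 * (Real.sqrt (n T * ∫ k, φ T k ^ 4 ∂μ T) + 1 / n T) +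
        t ^ 4 / (4 * n T)) l (𝓝 (4 * |t| ^ 3 * (Real.sqrt 0 + 0) + 0)) := by
      refine ((((Real.continuous_sqrt.tendsto 0).comp hL).add
        (tendsto_const_nhds.div_atTop hn)).const_mul _).add
        (tendsto_const_nhds.div_atTop (hn.const_mul_atTop (by norm_num)))
    simp only [Real.sqrt_zero, add_zero, mul_zero] at hb
    refine tendsto_iff_norm_sub_tendsto_zero.2 (squeeze_zero' (Eventually.of_forall fun _ =>
      norm_nonneg _) ?_ hb)
    filter_upwards [h1, h2, h4, h0, hv, hn.eventually_ge_atTop (t ^ 2), hn.eventually_gt_atTop 0]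
      with T e1 e2 e4 e0 ev et en
    rw [charFun_sum_row (hind T) (hD T)]
    exact norm_charFun_pow_sub_le e1 e2 e4 e0 (by exact_mod_cast en) ev t (by linarith)
  -- Lévy's continuity theorem concerns sequences; countable generation of the filter reduces the
  -- claim to them.
  refine ⟨hm, aemeasurable_id, tendsto_of_seq_tendsto fun u hu => ?_⟩
  refine ProbabilityMeasure.tendsto_iff_tendsto_charFun.2 fun t => ?_
  have h5 := (hchar t).comp hu
  simp only [ProbabilityMeasure.coe_mk, Function.comp_def] at h5 ⊢
  rw [Measure.map_id, charFun_gaussianReal]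
  convert h5 using 2
  congr 1
  simp only [Complex.ofReal_zero, NNReal.coe_one, Complex.ofReal_one]
  ring_nf

/-! ### First and second moments of row sums -/

lemma HasLaw.integrable_comp_of_integrable {D : Ω → ℤ} {μ : Measure ℤ} (hD : HasLaw D μ P)
    {φ : ℤ → ℝ} (hφ : Integrable φ μ) : Integrable (fun ω => φ (D ω)) P := by
  rw [← hD.map_eq] at hφ
  exact (integrable_map_measure hφ.aestronglyMeasurable hD.aemeasurable).1 hφ

lemma integral_sum_row {D : ℕ → Ω → ℤ} {μ : Measure ℤ} (hD : ∀ i, HasLaw (D i) μ P) {φ : ℤ → ℝ}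
    (hφ : Integrable φ μ) (n : ℕ) :
    ∫ ω, ∑ i ∈ Finset.range n, φ (D i ω) ∂P = n * ∫ k, φ k ∂μ := by
  rw [integral_finsetSum _ fun i _ => HasLaw.integrable_comp_of_integrable (hD i) hφ]
  have h1 : ∀ i, ∫ ω, φ (D i ω) ∂P = ∫ k, φ k ∂μ := fun i =>
    (hD i).integral_comp hφ.aestronglyMeasurable
  simp [h1]

lemma markov_sum_row {D : ℕ → Ω → ℤ} {μ : Measure ℤ} (hD : ∀ i, HasLaw (D i) μ P) {φ : ℤ → ℝ}
    (hφ : Integrable φ μ) (h0 : ∀ k, 0 ≤ φ k) (n : ℕ) {c : ℝ} (hc : 0 < c) :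
    P.real {ω | c ≤ ∑ i ∈ Finset.range n, φ (D i ω)} ≤ n * (∫ k, φ k ∂μ) / c := by
  have h1 := mul_meas_ge_le_integral_of_nonneg (μ := P)
    (f := fun ω => ∑ i ∈ Finset.range n, φ (D i ω))
    (ae_of_all _ fun ω => Finset.sum_nonneg fun i _ => h0 _)
    (integrable_finsetSum _ fun i _ => HasLaw.integrable_comp_of_integrable (hD i) hφ) c
  rw [integral_sum_row hD hφ] at h1
  rw [le_div_iff₀ hc]
  linarith

lemma chebyshev_sum_row [IsProbabilityMeasure P] {D : ℕ → Ω → ℤ} {μ : Measure ℤ} [IsProbabilityMeasure μ]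
    (hind : iIndepFun D P) (hD : ∀ i, HasLaw (D i) μ P) {φ : ℤ → ℝ}
    (hφ : Integrable φ μ) (hφ2 : Integrable (fun k => φ k ^ 2) μ) (n : ℕ) {c : ℝ} (hc : 0 < c) :
    P.real {ω | c ≤ |∑ i ∈ Finset.range n, φ (D i ω) - n * ∫ k, φ k ∂μ|} ≤
      n * (∫ k, φ k ^ 2 ∂μ) / c ^ 2 := by
  have hm : ∀ i, AEStronglyMeasurable (fun ω => φ (D i ω)) P := fun i =>
    (HasLaw.integrable_comp_of_integrable (hD i) hφ).aestronglyMeasurable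
  have hmem : ∀ i, MemLp (fun ω => φ (D i ω)) 2 P := fun i =>
    (memLp_two_iff_integrable_sq (hm i)).2 (HasLaw.integrable_comp_of_integrable (hD i) hφ2)
  have hvar : Var[fun ω => ∑ i ∈ Finset.range n, φ (D i ω); P] ≤ n * ∫ k, φ k ^ 2 ∂μ := by
    have h1 := IndepFun.variance_sum (μ := P) (X := fun i ω => φ (D i ω)) (s := Finset.range n)
      (fun i _ => hmem i) (fun i _ j _ hij => (hind.comp (fun _ => φ)
        fun _ => Measurable.of_discrete).indepFun hij)
    rw [show (∑ i ∈ Finset.range n, fun ω => φ (D i ω)) =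
      fun ω => ∑ i ∈ Finset.range n, φ (D i ω) by ext ω; simp] at h1
    rw [h1]
    refine (Finset.sum_le_sum (g := fun _ => ∫ k, φ k ^ 2 ∂μ) fun i _ => ?_).trans_eq (by simp)
    refine (variance_le_expectation_sq (hm i)).trans_eq ?_
    exact (hD i).integral_comp hφ2.aestronglyMeasurable
  have h2 := meas_ge_le_variance_div_sq (μ := P)
    (memLp_finsetSum (Finset.range n) fun i _ => hmem i) hc
  rw [integral_sum_row hD hφ] at h2
  refine (ENNReal.toReal_mono ENNReal.ofReal_ne_top h2).trans ?_
  rw [ENNReal.toReal_ofReal (div_nonneg (variance_nonneg _ _) (by positivity))]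
  gcongr

end Rows

/-! ### One Newton step -/

/-- Deterministic core of the Newton argument: a is the information, S and G are the score sums at y
and x, L and B their derivatives there. Were G = S + L(x − y) and B = L = −a, the step would equal y
+ S/a exactly. The three terms of the numerator below measure B − L, the nonlinearity of the score
sum, and B + a. -/
lemma abs_newton_error_le {a x y G S B L δ K : ℝ} (ha : 0 < a) (hδ : δ ≤ 1 / 4)
    (hS : |S| ≤ K * Real.sqrt a) (hx : |Real.sqrt a * (x - y)| ≤ K) (hL : |L + a| ≤ δ * a)
    (hB : |B - L| ≤ δ * a) (hG : |G - S - L * (x - y)| ≤ δ * a * |x - y|) :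
    |Real.sqrt a * (x - G / B - y) - S / Real.sqrt a| ≤ 8 * K * δ := by
  set s := Real.sqrt a with hs
  have hs0 : 0 < s := Real.sqrt_pos.2 ha
  have hsa : s ^ 2 = a := Real.sq_sqrt ha.le
  have hδ0 : 0 ≤ δ := by
    by_contra! h
    linarith [abs_nonneg (L + a), mul_neg_of_neg_of_pos h ha]
  have hBa : |B + a| ≤ 2 * δ * a := by
    rw [show B + a = (B - L) + (L + a) by ring]
    exact (abs_add_le _ _).trans (by linarith)
  have hδa : δ * a ≤ a / 4 := by nlinarith
  have hB2 : a / 2 ≤ |B| := by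
    have := abs_le.1 hBa
    rw [abs_of_neg (by linarith)]
    linarith
  have hB0 : B ≠ 0 := abs_pos.1 (by linarith)
  rw [abs_mul, abs_of_pos hs0] at hx
  have e : s * (x - G / B - y) - S / s =
      (s ^ 2 * ((x - y) * (B - L)) - s ^ 2 * (G - S - L * (x - y)) - S * (B + s ^ 2)) / (s * B) := by
    field_simp
    ring
  rw [e, abs_div, abs_mul s, abs_of_pos hs0, div_le_iff₀ (mul_pos hs0 (by linarith)), hsa]
  have h1 : |a * ((x - y) * (B - L))| ≤ a * (|x - y| * (δ * a)) := by
    rw [abs_mul, abs_mul, abs_of_pos ha]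
    gcongr
  have h2 : |a * (G - S - L * (x - y))| ≤ a * (δ * a * |x - y|) := by
    rw [abs_mul, abs_of_pos ha]
    gcongr
  have h3 : |S * (B + a)| ≤ K * s * (2 * δ * a) := by
    rw [abs_mul]
    exact mul_le_mul hS hBa (abs_nonneg _) ((abs_nonneg _).trans hS)
  have h4 : a * |x - y| ≤ K * s := by
    calc a * |x - y| = s * (s * |x - y|) := by rw [← hsa]; ring
      _ ≤ s * K := by gcongr
      _ = K * s := mul_comm _ _
  have hK : 0 ≤ K := (mul_nonneg hs0.le (abs_nonneg _)).trans hx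
  calc _ ≤ |a * ((x - y) * (B - L))| + |a * (G - S - L * (x - y))| + |S * (B + a)| :=
        (abs_sub _ _).trans (add_le_add_left (abs_sub _ _) _)
    _ ≤ a * (|x - y| * (δ * a)) + a * (δ * a * |x - y|) + K * s * (2 * δ * a) := by gcongr
    _ = 2 * (δ * a) * (a * |x - y|) + K * s * (2 * δ * a) := by ring
    _ ≤ 2 * (δ * a) * (K * s) + K * s * (2 * δ * a) := by gcongr
    _ = 8 * K * δ * (s * (a / 2)) := by ring
    _ ≤ _ := by gcongr

/-- If the derivative of the score sum is controlled near `y`, its value at `x` is close to the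
linearisation at `y`. -/
lemma abs_sum_score_sub_linear_le {x y c : ℝ} (hx : 0 < x) (hy : 0 < y) (n : ℕ) (d : ℕ → ℤ)
    (h : ∀ z ∈ Set.uIcc y x, |∑ i ∈ Finset.range n, skellamScoreDeriv z (d i) -
      ∑ i ∈ Finset.range n, skellamScoreDeriv y (d i)| ≤ c) :
    |∑ i ∈ Finset.range n, skellamScore x (d i) - ∑ i ∈ Finset.range n, skellamScore y (d i) -
      (∑ i ∈ Finset.range n, skellamScoreDeriv y (d i)) * (x - y)| ≤ c * |x - y| := by
  set L := ∑ i ∈ Finset.range n, skellamScoreDeriv y (d i) with hL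
  have h1 := Convex.norm_image_sub_le_of_norm_hasDerivWithin_le
    (f := fun z => ∑ i ∈ Finset.range n, skellamScore z (d i) - L * z)
    (f' := fun z => ∑ i ∈ Finset.range n, skellamScoreDeriv z (d i) - L * 1)
    (s := Set.uIcc y x) (x := y) (y := x) (C := c) (fun z hz => ?_) (fun z hz => ?_)
    (convex_uIcc y x) Set.left_mem_uIcc Set.right_mem_uIcc
  · simp only [Real.norm_eq_abs] at h1
    refine le_of_eq_of_le ?_ h1
    congr 1
    ring
  · have hz0 : 0 < z := (lt_min hy hx).trans_le hz.1
    exact ((HasDerivAt.fun_sum fun i _ => hasDerivAt_skellamScore hz0 (d i)).sub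
      ((hasDerivAt_id z).const_mul L)).hasDerivWithinAt
  · rw [mul_one]
    exact h z hz

/-- A normalisation may be replaced by an equivalent one. -/
lemma AsympStandardNormal.congr_normalisation {Ω : Type*} [MeasurableSpace Ω] {P : Measure Ω}
    [IsProbabilityMeasure P] {a b : ℝ≥0 → ℝ} {Y : ℝ≥0 → Ω → ℝ} {ϑ : ℝ}
    (hY : ∀ T, AEMeasurable (Y T) P) (h : AsympStandardNormal P a Y ϑ)
    (ha : ∀ᶠ T in atTop, 0 < a T) (hab : Tendsto (fun T => b T / a T) atTop (𝓝 1)) :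
    AsympStandardNormal P b Y ϑ := by
  have hc : Tendsto (fun T => Real.sqrt (b T / a T)) atTop (𝓝 1) := by
    simpa [Function.comp_def] using (Real.continuous_sqrt.tendsto 1).comp hab
  have h1 : TendstoInMeasure P (fun (T : ℝ≥0) (_ : Ω) => Real.sqrt (b T / a T)) atTop
      (fun _ => 1) := by
    refine tendstoInMeasure_iff_norm.2 fun ε hε => ?_
    refine Tendsto.congr' ?_ tendsto_const_nhds
    filter_upwards [(tendsto_iff_norm_sub_tendsto_zero.1 hc).eventually_lt_const hε] with T hT
    rw [Real.norm_eq_abs] at hT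
    simp [hT.not_ge]
  have h2 := TendstoInDistribution.continuous_comp_prodMk_of_tendstoInMeasure_const
    (g := fun p : ℝ × ℝ => p.1 * p.2) (by fun_prop) h h1 (fun _ => aemeasurable_const)
  simp only [id, mul_one] at h2
  refine tendstoInDistribution_of_tendstoInMeasure_sub _ (id : ℝ → ℝ) h2 ?_
    (fun T => ((hY T).sub_const ϑ).const_mul _)
  refine tendstoInMeasure_iff_norm.2 fun ε hε => ?_
  refine Tendsto.congr' ?_ tendsto_const_nhds
  filter_upwards [ha] with T hT
  have e : ∀ ω, Real.sqrt (b T) * (Y T ω - ϑ) -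
      Real.sqrt (a T) * (Y T ω - ϑ) * Real.sqrt (b T / a T) = 0 := fun ω => by
    rw [Real.sqrt_div' _ hT.le]
    have := (Real.sqrt_pos.2 hT).ne'
    field_simp
    ring
  simp [e, hε.not_ge]

/-! ### The one-step estimator in a triangular array of Skellam variables -/

section Array

variable {Ω : Type*} [MeasurableSpace Ω] {P : Measure Ω} [IsProbabilityMeasure P]
  {ι : Type*} {l : Filter ι} [l.IsCountablyGenerated] {D : ι → ℕ → Ω → ℤ} {y : ι → ℝ} {n : ι → ℕ}

lemma tendstoInDistribution_sum_score (hind : ∀ T, iIndepFun (D T) P)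
    (hD : ∀ T i, HasLaw (D T i) (skellamMeasure (y T)) P) (hy : ∀ᶠ T in l, 0 < y T)
    (hn : Tendsto (fun T => (n T : ℝ)) l atTop)
    (h4 : Tendsto (fun T => (∫ k, skellamScore (y T) k ^ 4 ∂skellamMeasure (y T)) /
      (n T * skellamInfo (y T) ^ 2)) l (𝓝 0)) :
    TendstoInDistribution (fun T ω => (∑ i ∈ Finset.range (n T), skellamScore (y T) (D T i ω)) /
      Real.sqrt (n T * skellamInfo (y T))) l (id : ℝ → ℝ) (fun _ => P) (gaussianReal 0 1) := by
  have hpos : ∀ᶠ T in l, 0 < y T ∧ 0 < n T * skellamInfo (y T) := by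
    filter_upwards [hy, hn.eventually_gt_atTop 0] with T h1 h2
    exact ⟨h1, mul_pos h2 (skellamInfo_pos h1)⟩
  have h := tendstoInDistribution_sum_row (l := l) hind hD (n := n)
    (φ := fun T k => skellamScore (y T) k / Real.sqrt (n T * skellamInfo (y T)))
    (hy.mono fun T h => ((polyGrowth_skellamScore h).div_const _).integrable h)
    (hy.mono fun T h => (((polyGrowth_skellamScore h).div_const _).pow 2).integrable h)
    (hy.mono fun T h => (((polyGrowth_skellamScore h).div_const _).pow 4).integrable h)
    (hy.mono fun T h => by rw [integral_div, integral_skellamScore h, zero_div])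
    (hpos.mono fun T h => by
      simp only [div_pow]
      rw [integral_div, Real.sq_sqrt h.2.le]
      change n T * (skellamInfo (y T) / _) = 1
      rw [← mul_div_assoc, div_self h.2.ne']) hn (by
      refine h4.congr' ?_
      filter_upwards [hpos] with T h
      have e : Real.sqrt (n T * skellamInfo (y T)) ^ 4 = (n T * skellamInfo (y T)) ^ 2 := by
        rw [show 4 = 2 * 2 from rfl, pow_mul, Real.sq_sqrt h.2.le]
      simp only [div_pow, e]
      rw [integral_div]
      have := (pos_of_mul_pos_left h.2 (skellamInfo_pos h.1).le).ne'
      have := (skellamInfo_pos h.1).ne'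
      field_simp)
  simpa only [Finset.sum_div] using h

/-- One Newton step from an estimator `x` with the right rate of convergence yields an
asymptotically normal estimator whose asymptotic variance is the inverse Fisher information. -/
theorem tendstoInDistribution_newton (hind : ∀ T, iIndepFun (D T) P)
    (hD : ∀ T i, HasLaw (D T i) (skellamMeasure (y T)) P) (hy : ∀ᶠ T in l, 0 < y T)
    (hn : Tendsto (fun T => (n T : ℝ)) l atTop)
    (h4 : Tendsto (fun T => (∫ k, skellamScore (y T) k ^ 4 ∂skellamMeasure (y T)) /
      (n T * skellamInfo (y T) ^ 2)) l (𝓝 0))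
    (h2 : Tendsto (fun T => (∫ k, skellamScoreDeriv (y T) k ^ 2 ∂skellamMeasure (y T)) /
      (n T * skellamInfo (y T) ^ 2)) l (𝓝 0))
    {M R : ι → ℤ → ℝ} (hMg : ∀ T, PolyGrowth (M T)) (hRg : ∀ T, PolyGrowth (R T))
    (hM0 : ∀ᶠ T in l, ∀ k, 0 ≤ M T k) (hR0 : ∀ᶠ T in l, ∀ k, 0 ≤ R T k)
    {C : ℝ} (hM : ∀ᶠ T in l, ∫ k, M T k ∂skellamMeasure (y T) ≤ C * skellamInfo (y T))
    (hR : Tendsto (fun T => (∫ k, R T k ∂skellamMeasure (y T)) / skellamInfo (y T)) l (𝓝 0))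
    (hMR : ∀ᶠ T in l, ∀ z, |z - y T| ≤ y T / 2 → ∀ k,
      |skellamScoreDeriv z k - skellamScoreDeriv (y T) k| ≤ |z - y T| / y T * M T k + R T k)
    (hrel : Tendsto (fun T => n T * skellamInfo (y T) * y T ^ 2) l atTop)
    {x : ι → Ω → ℝ} (hx : ∀ η > 0, ∃ K > 0, ∀ᶠ T in l,
      P.real {ω | K ≤ |Real.sqrt (n T * skellamInfo (y T)) * (x T ω - y T)|} ≤ η)
    {Y : ι → Ω → ℝ} (hYm : ∀ T, AEMeasurable (Y T) P)
    (hY : ∀ᶠ T in l, ∀ ω, 0 < x T ω → Y T ω = x T ω -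
      (∑ i ∈ Finset.range (n T), skellamScore (x T ω) (D T i ω)) /
        ∑ i ∈ Finset.range (n T), skellamScoreDeriv (x T ω) (D T i ω)) :
    TendstoInDistribution (fun T ω => Real.sqrt (n T * skellamInfo (y T)) * (Y T ω - y T)) l
      (id : ℝ → ℝ) (fun _ => P) (gaussianReal 0 1) := by
  refine tendstoInDistribution_of_tendstoInMeasure_sub _ (id : ℝ → ℝ)
    (tendstoInDistribution_sum_score hind hD hy hn h4) ?_
    (fun T => ((hYm T).sub_const _).const_mul _)
  refine tendstoInMeasure_iff_measureReal_norm.2 fun c hc => ?_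
  rw [Metric.tendsto_nhds]
  intro η hη
  -- Five exceptional events, each of probability at most η/6, stay below η in total.
  obtain ⟨K₁, hK₁, hxK⟩ := hx (η / 6) (by positivity)
  -- The second entry makes the Chebyshev bound 1/K² for the normalised score sum at most η/6.
  set K : ℝ := max K₁ (Real.sqrt (6 / η)) with hK
  have hK0 : 0 < K := hK₁.trans_le (le_max_left _ _)
  have hK2 : 6 / η ≤ K ^ 2 := by
    rw [← Real.sqrt_le_left hK0.le]
    exact le_max_right _ _
  set δ : ℝ := min (1 / 4) (c / (16 * K)) with hδ
  have hδ0 : 0 < δ := lt_min (by norm_num) (by positivity)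
  have hδ4 : δ ≤ 1 / 4 := min_le_left _ _
  have hδc : 8 * K * δ < c := by
    have h1 : δ * (16 * K) ≤ c := (le_div_iff₀ (by positivity)).1 (min_le_right _ _)
    linarith
  set C₁ : ℝ := 6 * (|C| + 1) / η with hC₁
  have hC₁0 : 0 < C₁ := by positivity
  have ev1 := (tendsto_order.1 h2).2 (δ ^ 2 * (η / 6)) (by positivity)
  have ev2 := (tendsto_order.1 hR).2 (δ / 2 * (η / 6)) (by positivity)
  -- Off the first event this forces |x − y| (2 + 2C₁/δ) ≤ y. The summand 2 gives |x − y| ≤ y/2,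
  -- where the modulus bound is available; the other gives C₁|x − y|/y ≤ δ/2.
  have ev3 := hrel.eventually_ge_atTop ((K * (2 + 2 * C₁ / δ)) ^ 2)
  filter_upwards [hy, hn.eventually_gt_atTop 0, hM0, hR0, hM, hMR, hxK, hY, ev1, ev2, ev3] with T
    hyT hnT hM0 hR0 hMT hMRT hxT hYT ev1 ev2 ev3
  have hJ := skellamInfo_pos hyT
  set J := skellamInfo (y T) with hJdef
  set a : ℝ := n T * J with ha
  have ha0 : 0 < a := mul_pos hnT hJ
  have hs0 : 0 < Real.sqrt a := Real.sqrt_pos.2 ha0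
  -- the exceptional events
  set E₁ : Set Ω := {ω | K ≤ |Real.sqrt a * (x T ω - y T)|} with hE₁
  set E₂ : Set Ω := {ω | K * Real.sqrt a ≤
    |∑ i ∈ Finset.range (n T), skellamScore (y T) (D T i ω) - n T *
      ∫ k, skellamScore (y T) k ∂skellamMeasure (y T)|} with hE₂
  set E₃ : Set Ω := {ω | δ * a ≤
    |∑ i ∈ Finset.range (n T), skellamScoreDeriv (y T) (D T i ω) - n T *
      ∫ k, skellamScoreDeriv (y T) k ∂skellamMeasure (y T)|} with hE₃
  set E₄ : Set Ω := {ω | C₁ * a ≤ ∑ i ∈ Finset.range (n T), M T (D T i ω)} with hE₄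
  set E₅ : Set Ω := {ω | δ / 2 * a ≤ ∑ i ∈ Finset.range (n T), R T (D T i ω)} with hE₅
  have p₁ : P.real E₁ ≤ η / 6 := (measureReal_mono fun ω hω => (le_max_left K₁ _).trans hω).trans hxT
  have p₂ : P.real E₂ ≤ η / 6 := by
    have hg := polyGrowth_skellamScore hyT
    refine (chebyshev_sum_row (hind T) (hD T) (hg.integrable hyT) ((hg.pow 2).integrable hyT) _
      (mul_pos hK0 hs0)).trans ?_
    change n T * J / _ ≤ _
    rw [mul_pow, Real.sq_sqrt ha0.le, ← ha, div_le_iff₀ (by positivity)]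
    rw [div_le_iff₀ hη] at hK2
    nlinarith
  have p₃ : P.real E₃ ≤ η / 6 := by
    have hg := polyGrowth_skellamScoreDeriv hyT
    refine (chebyshev_sum_row (hind T) (hD T) (hg.integrable hyT) ((hg.pow 2).integrable hyT) _
      (mul_pos hδ0 ha0)).trans ?_
    rw [div_lt_iff₀ (by positivity)] at ev1
    rw [div_le_iff₀ (by positivity)]
    calc _ ≤ n T * (δ ^ 2 * (η / 6) * (n T * J ^ 2)) := by gcongr
      _ = _ := by rw [ha]; ring
  have p₄ : P.real E₄ ≤ η / 6 := by
    refine (markov_sum_row (hD T) ((hMg T).integrable hyT) hM0 _ (mul_pos hC₁0 ha0)).trans ?_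
    rw [div_le_iff₀ (by positivity)]
    calc n T * ∫ k, M T k ∂skellamMeasure (y T) ≤ n T * ((|C| + 1) * J) := by
          gcongr
          refine hMT.trans ?_
          gcongr
          linarith [le_abs_self C]
      _ = η / 6 * (C₁ * a) := by rw [hC₁, ha]; field_simp
  have p₅ : P.real E₅ ≤ η / 6 := by
    refine (markov_sum_row (hD T) ((hRg T).integrable hyT) hR0 _ (by positivity)).trans ?_
    rw [div_lt_iff₀ hJ] at ev2
    rw [div_le_iff₀ (by positivity)]
    calc _ ≤ n T * (δ / 2 * (η / 6) * J) := by gcongr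
      _ = _ := by rw [ha]; ring
  have hsub : {ω | c ≤ ‖Real.sqrt a * (Y T ω - y T) -
      (∑ i ∈ Finset.range (n T), skellamScore (y T) (D T i ω)) / Real.sqrt a - (0 : ℝ)‖} ⊆
      E₁ ∪ E₂ ∪ E₃ ∪ E₄ ∪ E₅ := by
    intro ω hω
    by_contra hE
    simp only [Set.mem_union, not_or, hE₁, hE₂, hE₃, hE₄, hE₅, Set.mem_ofPred_eq, not_le] at hE
    obtain ⟨⟨⟨⟨f₁, f₂⟩, f₃⟩, f₄⟩, f₅⟩ := hE
    rw [integral_skellamScore hyT, mul_zero, sub_zero] at f₂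
    rw [integral_skellamScoreDeriv hyT, mul_neg, sub_neg_eq_add] at f₃
    change |_ + a| < _ at f₃
    have hr : |x T ω - y T| * (2 + 2 * C₁ / δ) ≤ y T := by
      have h5 : K * (2 + 2 * C₁ / δ) ≤ Real.sqrt a * y T := by
        refine abs_le_of_sq_le_sq' ?_ (by positivity) |>.2
        rw [mul_pow (Real.sqrt a), Real.sq_sqrt ha0.le]
        exact ev3
      rw [abs_mul, abs_of_pos hs0] at f₁
      have h6 : Real.sqrt a * (|x T ω - y T| * (2 + 2 * C₁ / δ)) ≤ Real.sqrt a * y T := by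
        refine le_trans ?_ h5
        rw [← mul_assoc]
        gcongr
      exact le_of_mul_le_mul_left h6 hs0
    have hr2 : |x T ω - y T| ≤ y T / 2 := by
      have : 0 ≤ |x T ω - y T| * (2 * C₁ / δ) := by positivity
      linarith
    have hx0 : 0 < x T ω := by linarith [(abs_le.1 hr2).1]
    have hB : ∀ z, |z - y T| ≤ |x T ω - y T| →
        |∑ i ∈ Finset.range (n T), skellamScoreDeriv z (D T i ω) -
          ∑ i ∈ Finset.range (n T), skellamScoreDeriv (y T) (D T i ω)| ≤ δ * a := by
      intro z hz
      rw [← Finset.sum_sub_distrib]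
      refine (Finset.abs_sum_le_sum_abs _ _).trans ?_
      calc _ ≤ ∑ i ∈ Finset.range (n T), (|z - y T| / y T * M T (D T i ω) + R T (D T i ω)) :=
            Finset.sum_le_sum fun i _ => hMRT z (hz.trans hr2) _
        _ = |z - y T| / y T * ∑ i ∈ Finset.range (n T), M T (D T i ω) +
            ∑ i ∈ Finset.range (n T), R T (D T i ω) := by
            rw [Finset.sum_add_distrib, Finset.mul_sum]
        _ ≤ |x T ω - y T| / y T * (C₁ * a) + δ / 2 * a := by
            have h10 : 0 ≤ ∑ i ∈ Finset.range (n T), M T (D T i ω) :=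
              Finset.sum_nonneg fun i _ => hM0 _
            gcongr
        _ ≤ δ / 2 * a + δ / 2 * a := by
            have h7 : |x T ω - y T| / y T * C₁ ≤ δ / 2 := by
              rw [div_mul_eq_mul_div, div_le_iff₀ hyT]
              have h8 : |x T ω - y T| * (2 * C₁ / δ) ≤ y T := by
                have := abs_nonneg (x T ω - y T)
                linarith
              have h9 : |x T ω - y T| * C₁ = |x T ω - y T| * (2 * C₁ / δ) * (δ / 2) := by
                field_simp
              rw [h9, mul_comm (δ / 2)]
              gcongr
            rw [← mul_assoc]
            gcongr
        _ = δ * a := by ring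
    have hN := abs_newton_error_le (x := x T ω) (y := y T) ha0 hδ4 f₂.le f₁.le f₃.le
      (hB _ le_rfl)
      (abs_sum_score_sub_linear_le hx0 hyT (n T) (fun i => D T i ω) fun z hz =>
        hB z (Set.abs_sub_left_of_mem_uIcc hz))
    rw [Set.mem_ofPred_eq, sub_zero, Real.norm_eq_abs, hYT ω hx0] at hω
    linarith
  rw [Real.dist_eq, sub_zero, abs_of_nonneg measureReal_nonneg]
  calc _ ≤ P.real (E₁ ∪ E₂ ∪ E₃ ∪ E₄ ∪ E₅) := measureReal_mono hsub
    _ ≤ P.real E₁ + P.real E₂ + P.real E₃ + P.real E₄ + P.real E₅ := by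
        refine (measureReal_union_le _ _).trans (add_le_add_left ?_ _)
        refine (measureReal_union_le _ _).trans (add_le_add_left ?_ _)
        refine (measureReal_union_le _ _).trans (add_le_add_left ?_ _)
        exact measureReal_union_le _ _
    _ < η := by linarith

end Array

/-! ### The quadratic variation estimator and the one-step estimator -/

section Array

variable {Ω : Type*} [MeasurableSpace Ω] {P : Measure Ω} [IsProbabilityMeasure P]
  {ι : Type*} {l : Filter ι} {D : ι → ℕ → Ω → ℤ} {y : ι → ℝ} {n : ι → ℕ}

/-- The quadratic variation has the rate of convergence prescribed by the Fisher information. -/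
lemma tight_of_quadraticVariation (hind : ∀ T, iIndepFun (D T) P)
    (hD : ∀ T i, HasLaw (D T i) (skellamMeasure (y T)) P) (hy : ∀ᶠ T in l, 0 < y T)
    (hn : ∀ᶠ T in l, 1 ≤ n T) {C : ℝ}
    (hC : ∀ᶠ T in l, skellamInfo (y T) * (3 * y T ^ 2 + y T) ≤ C) {x : ι → Ω → ℝ}
    (hx : ∀ᶠ T in l, ∀ ω, |x T ω - y T| ≤
      (|∑ i ∈ Finset.range (n T), (D T i ω : ℝ) ^ 2 - n T * y T| + y T) / n T) :
    ∀ η > 0, ∃ K > 0, ∀ᶠ T in l,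
      P.real {ω | K ≤ |Real.sqrt (n T * skellamInfo (y T)) * (x T ω - y T)|} ≤ η := by
  intro η hη
  set B : ℝ := |C| + 1 with hB
  have hB0 : 0 < B := by positivity
  -- The first summand is the Chebyshev level for the centred sum of squares; the second absorbs the
  -- bias y/n caused by the unobserved end of [0, T].
  refine ⟨Real.sqrt (B / η) + Real.sqrt B, by positivity, ?_⟩
  filter_upwards [hy, hn, hC, hx] with T hyT hnT hCT hxT
  have hn0 : (0 : ℝ) < n T := by exact_mod_cast hnT
  have hJ := skellamInfo_pos hyT
  set J := skellamInfo (y T)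
  have hs : 0 < Real.sqrt (n T * J) := Real.sqrt_pos.2 (by positivity)
  have hCB : J * (3 * y T ^ 2 + y T) ≤ B := hCT.trans (by linarith [le_abs_self C])
  have hb : Real.sqrt (n T * J) * y T ≤ n T * Real.sqrt B := by
    refine abs_le_of_sq_le_sq' ?_ (by positivity) |>.2
    rw [mul_pow, mul_pow, Real.sq_sqrt (by positivity), Real.sq_sqrt hB0.le]
    have h1 : J * y T ^ 2 ≤ B := le_trans (by gcongr; nlinarith) hCB
    have h2 : (1 : ℝ) ≤ n T := by exact_mod_cast hnT
    calc n T * J * y T ^ 2 = n T * (J * y T ^ 2) := by ring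
      _ ≤ n T * (n T * B) := by
          exact mul_le_mul_of_nonneg_left (h1.trans (le_mul_of_one_le_left hB0.le h2)) hn0.le
      _ = _ := by ring
  set c : ℝ := n T * Real.sqrt (B / η) / Real.sqrt (n T * J) with hc
  have hc0 : 0 < c := by positivity
  have hcc : c ^ 2 = n T * B / (η * J) := by
    rw [hc, div_pow, mul_pow, Real.sq_sqrt (by positivity), Real.sq_sqrt (by positivity)]
    field_simp
  have hp := PolyGrowth.cast.pow 2
  have hcheb := chebyshev_sum_row (hind T) (hD T) (hp.integrable hyT)
    ((hp.pow 2).integrable hyT) (n T) hc0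
  have e4 : ∫ k : ℤ, ((k : ℝ) ^ 2) ^ 2 ∂skellamMeasure (y T) = 3 * y T ^ 2 + y T := by
    simp only [← pow_mul]
    exact integral_pow_four_skellam hyT
  rw [integral_sq_skellam hyT, e4] at hcheb
  refine (measureReal_mono fun ω hω => ?_).trans (hcheb.trans ?_)
  · simp only [Set.mem_ofPred_eq] at hω ⊢
    rw [abs_mul, abs_of_pos hs] at hω
    have h1 := hω.trans (mul_le_mul_of_nonneg_left (hxT ω) hs.le)
    rw [← mul_div_assoc, le_div_iff₀ hn0] at h1
    rw [hc, div_le_iff₀ hs]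
    nlinarith
  · rw [hcc, div_le_iff₀ (by positivity)]
    have : n T * (J * (3 * y T ^ 2 + y T)) ≤ n T * B := by gcongr
    calc _ = n T * (J * (3 * y T ^ 2 + y T)) / J := by field_simp
      _ ≤ n T * B / J := by gcongr
      _ = _ := by field_simp

end Array

/-- The estimator factors through finitely many integer observations, a discrete space, so no
regularity of the likelihood in the parameter is needed. -/
lemma measurable_oneStep {Ω : Type*} [MeasurableSpace Ω] {P : ℝ → Measure Ω} {X : ℝ≥0 → Ω → ℤ}
    (hX : ∀ t, Measurable (X t)) (T Δ : ℝ≥0) : Measurable (oneStep P X T Δ) := by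
  set n := numObs T Δ with hn
  let G : Ω → Fin (n + 1) → ℤ := fun ω i => X ((i : ℕ) * Δ) ω
  have hG : Measurable G := measurable_pi_lambda _ fun i => hX _
  let F : (Fin (n + 1) → ℤ) → ℝ := fun v =>
    osEstimator (likelihood P X Δ) T Δ fun i => if h : i < n + 1 then v ⟨i, h⟩ else 0
  have hF : Measurable F := .of_discrete
  have e : oneStep P X T Δ = F ∘ G := by
    ext ω
    have h1 : ∀ i ∈ Finset.range (numObs T Δ),
        (if h : i + 1 < n + 1 then G ω ⟨i + 1, h⟩ else 0) -
          (if h : i < n + 1 then G ω ⟨i, h⟩ else 0) =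
        X ((i + 1 : ℕ) * Δ) ω - X ((i : ℕ) * Δ) ω := by
      intro i hi
      have hi' : i < n := Finset.mem_range.1 hi
      rw [dif_pos (by omega), dif_pos (by omega)]
    have h2 : qvEstimator T Δ (fun i => if h : i < n + 1 then G ω ⟨i, h⟩ else 0) =
        qvEstimator T Δ fun i => X (i * Δ) ω := by
      unfold qvEstimator
      congr 1
      exact Finset.sum_congr rfl fun i hi => by rw [h1 i hi]
    simp only [oneStep, osEstimator, Function.comp, F, h2]
    refine congrArg₂ _ rfl (congrArg₂ _ (Finset.sum_congr rfl fun i hi => ?_)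
      (Finset.sum_congr rfl fun i hi => ?_)) <;> rw [h1 i hi]
  rw [e]
  exact hF.comp hG

lemma tendsto_numObs_div {Δ : ℝ≥0 → ℝ≥0}
    (hu : Tendsto (fun T : ℝ≥0 => (T : ℝ) / (Δ T : ℝ)) atTop atTop) :
    Tendsto (fun T => (numObs T (Δ T) : ℝ) / ((T : ℝ) / (Δ T : ℝ))) atTop (𝓝 1) := by
  refine (tendsto_nat_floor_div_atTop.comp hu).congr fun T => ?_
  rw [Function.comp, numObs, ← NNReal.coe_div]
  congr 2

section Model

variable {Ω : Type*} [MeasurableSpace Ω] {P : ℝ → Measure Ω} [∀ ϑ, IsProbabilityMeasure (P ϑ)]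
  {N : ℝ≥0 → Ω → ℕ} {ε : ℕ → Ω → ℤ} {Δ : ℝ≥0 → ℝ≥0} {ϑ : ℝ}

/-- Scale equivariance of Newton's step: the factors Δ and Δ² of the two derivatives combine with
the outer factor and cancel. The starting value must be positive for the Skellam formula to apply.
-/
lemma oneStep_eq (hmodel : ∀ ϑ : ℝ, 0 < ϑ → IsModel N ε ϑ (P ϑ)) {T Δ : ℝ≥0} (hΔ : 0 < Δ) {ω : Ω}
    (hq : 0 < qvEstimator T Δ fun i => process N ε (i * Δ) ω) :
    Δ * oneStep P (process N ε) T Δ ω =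
      Δ * qvEstimator T Δ (fun i => process N ε (i * Δ) ω) -
      (∑ i ∈ Finset.range (numObs T Δ),
        skellamScore (Δ * qvEstimator T Δ fun i => process N ε (i * Δ) ω)
          (process N ε ((i + 1 : ℕ) * Δ) ω - process N ε (i * Δ) ω)) /
      ∑ i ∈ Finset.range (numObs T Δ),
        skellamScoreDeriv (Δ * qvEstimator T Δ fun i => process N ε (i * Δ) ω)
          (process N ε ((i + 1 : ℕ) * Δ) ω - process N ε (i * Δ) ω) := by
  have hΔ' : (Δ : ℝ) ≠ 0 := by exact_mod_cast hΔ.ne'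
  simp only [oneStep, osEstimator, score_eq hmodel hΔ hq, scoreDeriv_eq hmodel hΔ hq,
    ← Finset.mul_sum]
  rw [mul_comm _ (Δ : ℝ), mul_sub, sq, mul_assoc, mul_div_mul_left _ _ hΔ', ← mul_div_assoc,
    mul_div_mul_left _ _ hΔ']

/-- The estimator divides by T rather than nΔ. Since nΔ ≤ T < (n + 1)Δ, both Δ/T and the relative
defect (T − nΔ)/T are at most 1/n. -/
lemma abs_qvEstimator_sub_le {T Δ : ℝ≥0} (hΔ : 0 < Δ) (hT : 0 < T) (hn : 1 ≤ numObs T Δ)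
    (hϑ : 0 < ϑ) (x : ℕ → ℤ) :
    |Δ * qvEstimator T Δ x - ϑ * Δ| ≤
      (|∑ i ∈ Finset.range (numObs T Δ), ((x (i + 1) - x i : ℤ) : ℝ) ^ 2 -
        numObs T Δ * (ϑ * Δ)| + ϑ * Δ) / numObs T Δ := by
  have hT' : (0 : ℝ) < T := by exact_mod_cast hT
  have hΔ' : (0 : ℝ) < Δ := by exact_mod_cast hΔ
  set n : ℝ := (numObs T Δ : ℝ) with hndef
  have hn0 : 0 < n := by rw [hndef]; exact_mod_cast hn
  have h1 : n * Δ ≤ T := by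
    have h := Nat.floor_le (a := T / Δ) (zero_le)
    rw [le_div_iff₀ hΔ] at h
    exact_mod_cast h
  have h2 : (T : ℝ) < (n + 1) * Δ := by
    have h := Nat.lt_floor_add_one (T / Δ)
    rw [div_lt_iff₀ hΔ, ← NNReal.coe_lt_coe] at h
    push_cast at h
    exact h
  set S := ∑ i ∈ Finset.range (numObs T Δ), ((x (i + 1) - x i : ℤ) : ℝ) ^ 2
  have e : Δ * qvEstimator T Δ x - ϑ * Δ =
      Δ / T * (S - n * (ϑ * Δ)) - ϑ * Δ * ((T - n * Δ) / T) := by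
    rw [qvEstimator]
    field_simp
    ring
  have h3 : (Δ : ℝ) / T ≤ 1 / n := by
    rw [div_le_div_iff₀ hT' hn0]
    linarith
  have h4 : |((T : ℝ) - n * Δ) / T| ≤ 1 / n := by
    rw [abs_of_nonneg (div_nonneg (by linarith) hT'.le)]
    refine le_trans ?_ h3
    gcongr
    linarith
  rw [e]
  refine (abs_sub _ _).trans ?_
  rw [abs_mul, abs_mul, abs_of_pos (by positivity : (0 : ℝ) < Δ / T),
    abs_of_pos (by positivity : 0 < ϑ * Δ)]
  calc _ ≤ 1 / n * |S - n * (ϑ * Δ)| + ϑ * Δ * (1 / n) := by gcongr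
    _ = _ := by field_simp

/-- Asymptotic normality of the one-step estimator, under conditions on the moments and the
modulus of continuity of the score of one increment. -/
theorem asympStandardNormal_oneStep (hmodel : ∀ ϑ : ℝ, 0 < ϑ → IsModel N ε ϑ (P ϑ))
    (hΔ : ∀ T : ℝ≥0, 0 < T → 0 < Δ T ∧ Δ T ≤ T) (hϑ : 0 < ϑ) {y : ℝ≥0 → ℝ}
    (hy : ∀ T, y T = ϑ * Δ T) {n : ℝ≥0 → ℕ} (hndef : ∀ T, n T = numObs T (Δ T))
    (hn : Tendsto (fun T => (n T : ℝ)) atTop atTop)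
    (h4 : Tendsto (fun T => (∫ k, skellamScore (y T) k ^ 4 ∂skellamMeasure (y T)) /
      (n T * skellamInfo (y T) ^ 2)) atTop (𝓝 0))
    (h2 : Tendsto (fun T => (∫ k, skellamScoreDeriv (y T) k ^ 2 ∂skellamMeasure (y T)) /
      (n T * skellamInfo (y T) ^ 2)) atTop (𝓝 0))
    {B : ℝ} (hB : ∀ᶠ T in atTop, skellamInfo (y T) * (3 * y T ^ 2 + y T) ≤ B)
    {M R : ℝ≥0 → ℤ → ℝ} (hMg : ∀ T, PolyGrowth (M T)) (hRg : ∀ T, PolyGrowth (R T))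
    (hM0 : ∀ᶠ T in atTop, ∀ k, 0 ≤ M T k) (hR0 : ∀ᶠ T in atTop, ∀ k, 0 ≤ R T k)
    {C : ℝ} (hM : ∀ᶠ T in atTop, ∫ k, M T k ∂skellamMeasure (y T) ≤ C * skellamInfo (y T))
    (hR : Tendsto (fun T => (∫ k, R T k ∂skellamMeasure (y T)) / skellamInfo (y T)) atTop (𝓝 0))
    (hMR : ∀ᶠ T in atTop, ∀ z, |z - y T| ≤ y T / 2 → ∀ k,
      |skellamScoreDeriv z k - skellamScoreDeriv (y T) k| ≤ |z - y T| / y T * M T k + R T k)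
    (hrel : Tendsto (fun T => n T * skellamInfo (y T) * y T ^ 2) atTop atTop) :
    AsympStandardNormal (P ϑ) (fun T => n T * (Δ T : ℝ) ^ 2 * skellamInfo (y T))
      (fun T => oneStep P (process N ε) T (Δ T)) ϑ := by
  have hX := measurable_process (hmodel ϑ hϑ).poisson.measurable (hmodel ϑ hϑ).jump_measurable
  set D : ℝ≥0 → ℕ → Ω → ℤ := fun T i ω =>
    process N ε ((i + 1 : ℕ) * Δ T) ω - process N ε (i * Δ T) ω with hDdef
  have hmono : ∀ T, Monotone fun i : ℕ => (i : ℝ≥0) * Δ T := fun T i j hij => by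
    have : (i : ℝ≥0) ≤ j := by exact_mod_cast hij
    dsimp only
    gcongr
  have hind : ∀ T, iIndepFun (D T) (P ϑ) := fun T => by
    have h := (hmodel ϑ hϑ).iIndepFun_increments hϑ.le (hmono T)
    exact h
  have hD : ∀ T i, HasLaw (D T i) (skellamMeasure (y T)) (P ϑ) := fun T i => by
    have h := (hmodel ϑ hϑ).hasLaw_increment hϑ.le (hmono T (Nat.le_succ i))
    have e : ϑ * (((((i + 1 : ℕ) : ℝ≥0) * Δ T : ℝ≥0) : ℝ) - (((i : ℝ≥0) * Δ T : ℝ≥0) : ℝ)) = y T := by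
      rw [hy]
      push_cast
      ring
    rw [e] at h
    exact h
  have hy0 : ∀ᶠ T in atTop, 0 < y T := by
    filter_upwards [eventually_gt_atTop 0] with T hT
    rw [hy]
    exact mul_pos hϑ (by exact_mod_cast (hΔ T hT).1)
  have hn1 : ∀ᶠ T in atTop, 1 ≤ n T := by
    filter_upwards [hn.eventually_ge_atTop 1] with T hT
    exact_mod_cast hT
  set x : ℝ≥0 → Ω → ℝ := fun T ω => Δ T * qvEstimator T (Δ T) fun i => process N ε (i * Δ T) ω
    with hxdef
  have hxq : ∀ᶠ T in atTop, ∀ ω, |x T ω - y T| ≤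
      (|∑ i ∈ Finset.range (n T), (D T i ω : ℝ) ^ 2 - n T * y T| + y T) / n T := by
    filter_upwards [eventually_gt_atTop 0, hn1] with T hT h1
    intro ω
    rw [hy, hndef]
    rw [hndef] at h1
    exact abs_qvEstimator_sub_le (hΔ T hT).1 hT h1 hϑ fun i => process N ε (i * Δ T) ω
  have hYx : ∀ᶠ T in atTop, ∀ ω, 0 < x T ω → Δ T * oneStep P (process N ε) T (Δ T) ω = x T ω -
      (∑ i ∈ Finset.range (n T), skellamScore (x T ω) (D T i ω)) /
        ∑ i ∈ Finset.range (n T), skellamScoreDeriv (x T ω) (D T i ω) := by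
    filter_upwards [eventually_gt_atTop 0] with T hT
    intro ω hω
    rw [hndef]
    exact oneStep_eq hmodel (hΔ T hT).1 (pos_of_mul_pos_right hω (by positivity))
  have hx := tight_of_quadraticVariation hind hD hy0 hn1 hB hxq
  have h := tendstoInDistribution_newton hind hD hy0 hn h4 h2 hMg hRg hM0 hR0 hM hR hMR hrel hx
    (fun T => ((measurable_oneStep hX T (Δ T)).const_mul _).aemeasurable) hYx
  unfold AsympStandardNormal
  convert h using 3 with T ω
  change Real.sqrt (n T * (Δ T : ℝ) ^ 2 * skellamInfo (y T)) * _ = _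
  rw [hy, mul_right_comm, Real.sqrt_mul' _ (by positivity), Real.sqrt_sq (by positivity)]
  ring

end Model

/-! ### The three regimes -/

lemma tendsto_coe_atTop : Tendsto (fun T : ℝ≥0 => (T : ℝ)) atTop atTop :=
  NNReal.tendsto_coe_atTop.2 tendsto_id

lemma skellamInfo_mul_self_le {y B : ℝ} (hy : 0 < y) (hB : y ≤ B) : y * skellamInfo y ≤ 1 + 3 * B := by
  have h := (abs_le.1 (abs_skellamInfo_sub_le hy)).2
  have h1 : y * skellamInfo y ≤ y * (1 / y + 3) := by
    gcongr
    linarith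
  have h2 : y * (1 / y + 3) = 1 + 3 * y := by field_simp
  linarith

section Model

variable {Ω : Type*} [MeasurableSpace Ω] {P : ℝ → Measure Ω} [∀ ϑ, IsProbabilityMeasure (P ϑ)]
  {N : ℝ≥0 → Ω → ℕ} {ε : ℕ → Ω → ℤ} {Δ : ℝ≥0 → ℝ≥0} {ϑ : ℝ}

/-- If the sampling interval stays bounded, the one-step estimator is asymptotically normal. -/
lemma asympStandardNormal_oneStep_of_bounded (hmodel : ∀ ϑ : ℝ, 0 < ϑ → IsModel N ε ϑ (P ϑ))
    (hΔ : ∀ T : ℝ≥0, 0 < T → 0 < Δ T ∧ Δ T ≤ T) (hϑ : 0 < ϑ)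
    (hu : Tendsto (fun T : ℝ≥0 => (T : ℝ) / (Δ T : ℝ)) atTop atTop) {B c : ℝ}
    (hB : ∀ᶠ T in atTop, ϑ * Δ T ≤ B) (hc : 0 < c)
    (hcJ : ∀ᶠ T in atTop, c ≤ ϑ * Δ T * skellamInfo (ϑ * Δ T)) :
    AsympStandardNormal (P ϑ)
      (fun T => numObs T (Δ T) * (Δ T : ℝ) ^ 2 * skellamInfo (ϑ * Δ T))
      (fun T => oneStep P (process N ε) T (Δ T)) ϑ := by
  set y : ℝ≥0 → ℝ := fun T => ϑ * Δ T with hydef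
  set n : ℝ≥0 → ℕ := fun T => numObs T (Δ T) with hndef
  have hr := tendsto_numObs_div hu
  have hn : Tendsto (fun T => (n T : ℝ)) atTop atTop := by
    refine (hr.pos_mul_atTop one_pos hu).congr' ?_
    filter_upwards [hu.eventually_gt_atTop 0] with T hT
    exact div_mul_cancel₀ _ hT.ne'
  have hy0 : ∀ᶠ T in atTop, 0 < y T := by
    filter_upwards [eventually_gt_atTop 0] with T hT
    exact mul_pos hϑ (by exact_mod_cast (hΔ T hT).1)
  have hny : Tendsto (fun T => n T * y T) atTop atTop := by
    refine ((hr.pos_mul_atTop one_pos tendsto_coe_atTop).const_mul_atTop hϑ).congr' ?_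
    filter_upwards [eventually_gt_atTop 0] with T hT
    have h1 : (Δ T : ℝ) ≠ 0 := by exact_mod_cast (hΔ T hT).1.ne'
    have h2 : (T : ℝ) ≠ 0 := by exact_mod_cast hT.ne'
    simp only [hydef, hndef]
    field_simp
  -- From yJ ≥ c one gets F/(nJ²) ≤ A/(c² n y). The relevant size is n y, which grows like ϑT
  -- however small Δ is.
  have hsmall : ∀ (F : ℝ≥0 → ℝ) (A : ℝ), (∀ T, 0 ≤ F T) → (∀ᶠ T in atTop, F T * y T ^ 3 ≤ A) →
      Tendsto (fun T => F T / (n T * skellamInfo (y T) ^ 2)) atTop (𝓝 0) := by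
    intro F A hF0 hF
    have h1 : Tendsto (fun T => A / c ^ 2 / (n T * y T)) atTop (𝓝 0) :=
      tendsto_const_nhds.div_atTop hny
    refine squeeze_zero' (Eventually.of_forall fun T => div_nonneg (hF0 T) (by positivity)) ?_ h1
    filter_upwards [hF, hcJ, hy0, hn.eventually_gt_atTop 0] with T h2 h3 h4 h5
    have hJ := skellamInfo_pos h4
    rw [div_div, div_le_div_iff₀ (by positivity) (by positivity)]
    have h6 : c ^ 2 ≤ (y T * skellamInfo (y T)) ^ 2 := by gcongr
    calc F T * (c ^ 2 * (n T * y T)) ≤ F T * ((y T * skellamInfo (y T)) ^ 2 * (n T * y T)) := by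
          have := hF0 T
          gcongr
      _ = F T * y T ^ 3 * (n T * skellamInfo (y T) ^ 2) := by ring
      _ ≤ _ := by gcongr
  refine asympStandardNormal_oneStep hmodel hΔ hϑ (y := y) (fun _ => rfl) (n := n) (fun _ => rfl) hn
    (hsmall _ (8 * (3 * B + 1 + B ^ 3)) (fun T => integral_nonneg fun k => by positivity) ?_)
    (hsmall _ (2 * (1 + B ^ 3)) (fun T => integral_nonneg fun k => by positivity) ?_)
    (B := (1 + 3 * B) * (3 * B + 1)) ?_
    (M := fun T k => 2 * y T + 4 * k.natAbs + 4 + 6 * k.natAbs / y T ^ 2) (R := fun _ _ => 0)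
    (fun T => ?_) (fun _ => .const 0) ?_ (Eventually.of_forall fun _ _ => le_rfl)
    (C := (6 * B ^ 2 + 4 * B + 6) / c) ?_ (by simp) ?_ ?_
  · filter_upwards [hy0, hB] with T h1 h2
    calc _ ≤ 8 * ((3 * y T ^ 2 + y T) / y T ^ 4 + 1) * y T ^ 3 := by
          gcongr
          exact integral_score_pow_four_le h1
      _ = 8 * (3 * y T + 1 + y T ^ 3) := by field_simp
      _ ≤ _ := by gcongr
  · filter_upwards [hy0, hB] with T h1 h2
    calc _ ≤ 2 * (1 / y T ^ 3 + 1) * y T ^ 3 := by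
          gcongr
          exact integral_scoreDeriv_sq_le h1
      _ = 2 * (1 + y T ^ 3) := by field_simp
      _ ≤ _ := by gcongr
  · filter_upwards [hy0, hB] with T h1 h2
    have h3 := skellamInfo_mul_self_le h1 h2
    have hJ := skellamInfo_pos h1
    calc _ = y T * skellamInfo (y T) * (3 * y T + 1) := by ring
      _ ≤ _ := by
        have : 0 < 1 + 3 * B := by linarith
        gcongr
  · exact ((((PolyGrowth.const _).add (PolyGrowth.natAbs.const_mul 4)).add (.const 4)).add
      ((PolyGrowth.natAbs.const_mul 6).div_const _))
  · filter_upwards [hy0] with T h1 k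
    positivity
  · filter_upwards [hy0, hB, hcJ] with T h1 h2 h3
    have hJ := skellamInfo_pos h1
    have hi := PolyGrowth.natAbs.integrable h1
    have e : ∀ k : ℤ, 2 * y T + 4 * (k.natAbs : ℝ) + 4 + 6 * k.natAbs / y T ^ 2 =
        (2 * y T + 4) + (4 + 6 / y T ^ 2) * k.natAbs := fun k => by ring
    simp only [e]
    rw [integral_add (integrable_const _) (hi.const_mul _), integral_const_mul]
    simp only [integral_const, probReal_univ, smul_eq_mul, one_mul]
    have h4 := integral_natAbs_le h1
    calc _ ≤ 2 * y T + 4 + (4 + 6 / y T ^ 2) * y T := by gcongr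
      _ = (6 * y T ^ 2 + 4 * y T + 6) / y T := by field_simp; ring
      _ ≤ (6 * B ^ 2 + 4 * B + 6) / y T := by gcongr
      _ = (6 * B ^ 2 + 4 * B + 6) / c * (c / y T) := by field_simp
      _ ≤ _ := by
        have hB0 : 0 < B := h1.trans_le h2
        gcongr
        rw [div_le_iff₀ h1]
        linarith [mul_comm (y T) (skellamInfo (y T))]
  · filter_upwards [hy0] with T h1 z hz k
    rw [add_zero]
    exact abs_scoreDeriv_sub_le h1 (by linarith [(abs_le.1 hz).1]) k
  · refine tendsto_atTop_mono' _ ?_ (hny.const_mul_atTop hc)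
    filter_upwards [hy0, hcJ] with T h1 h2
    calc c * (n T * y T) ≤ y T * skellamInfo (y T) * (n T * y T) := by gcongr
      _ = _ := by ring

/-- If the sampling interval tends to infinity, the one-step estimator is asymptotically normal. -/
lemma asympStandardNormal_oneStep_of_macroscopic (hmodel : ∀ ϑ : ℝ, 0 < ϑ → IsModel N ε ϑ (P ϑ))
    (hΔ : ∀ T : ℝ≥0, 0 < T → 0 < Δ T ∧ Δ T ≤ T) (hϑ : 0 < ϑ)
    (hu : Tendsto (fun T : ℝ≥0 => (T : ℝ) / (Δ T : ℝ)) atTop atTop)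
    (hy : Tendsto (fun T => ϑ * (Δ T : ℝ)) atTop atTop) :
    AsympStandardNormal (P ϑ)
      (fun T => numObs T (Δ T) * (Δ T : ℝ) ^ 2 * skellamInfo (ϑ * Δ T))
      (fun T => oneStep P (process N ε) T (Δ T)) ϑ := by
  set y : ℝ≥0 → ℝ := fun T => ϑ * Δ T with hydef
  set n : ℝ≥0 → ℕ := fun T => numObs T (Δ T) with hndef
  have hn : Tendsto (fun T => (n T : ℝ)) atTop atTop := by
    refine ((tendsto_numObs_div hu).pos_mul_atTop one_pos hu).congr' ?_
    filter_upwards [hu.eventually_gt_atTop 0] with T hT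
    exact div_mul_cancel₀ _ hT.ne'
  have hy32 : ∀ᶠ T in atTop, 32 ≤ y T := hy.eventually_ge_atTop 32
  have hJ1 := tendsto_mul_skellamInfo_atTop.comp hy
  -- Since y²J → 1/2, eventually it lies between 1/4 and 1; this exchanges J and y⁻² below.
  have hJl : ∀ᶠ T in atTop, 1 ≤ 4 * (y T ^ 2 * skellamInfo (y T)) := by
    filter_upwards [hJ1.eventually_const_lt (show (1 / 2 : ℝ) < 1 by norm_num)] with T hT
    simp only [Function.comp] at hT
    linarith
  have hJu : ∀ᶠ T in atTop, y T ^ 2 * skellamInfo (y T) ≤ 1 := by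
    filter_upwards [hJ1.eventually_lt_const (show (1 : ℝ) < 2 by norm_num)] with T hT
    simp only [Function.comp] at hT
    linarith
  have hsmall : ∀ (F : ℝ≥0 → ℝ) (A : ℝ), (∀ T, 0 ≤ F T) → (∀ᶠ T in atTop, F T ≤ A / y T ^ 4) →
      Tendsto (fun T => F T / (n T * skellamInfo (y T) ^ 2)) atTop (𝓝 0) := by
    intro F A hF0 hF
    have h1 : Tendsto (fun T => 16 * A / n T) atTop (𝓝 0) := tendsto_const_nhds.div_atTop hn
    refine squeeze_zero' (Eventually.of_forall fun T => div_nonneg (hF0 T) (by positivity)) ?_ h1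
    filter_upwards [hF, hJl, hy32, hn.eventually_gt_atTop 0] with T h2 h3 h4 h5
    have hy0 : 0 < y T := by linarith
    have hJ := skellamInfo_pos hy0
    rw [le_div_iff₀ (by positivity)] at h2
    rw [div_le_div_iff₀ (by positivity) h5]
    have h6 : 1 ≤ (4 * (y T ^ 2 * skellamInfo (y T))) ^ 2 := one_le_pow₀ h3
    calc F T * n T ≤ F T * n T * (4 * (y T ^ 2 * skellamInfo (y T))) ^ 2 :=
          le_mul_of_one_le_right (mul_nonneg (hF0 T) h5.le) h6
      _ = 16 * (F T * y T ^ 4) * (n T * skellamInfo (y T) ^ 2) := by ring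
      _ ≤ _ := by gcongr
  obtain ⟨C₄, hC₄, h4⟩ := exists_integral_score_pow_four_le
  obtain ⟨C₂, hC₂, h2⟩ := exists_integral_scoreDeriv_sq_le
  obtain ⟨C, hC, hd⟩ := exists_abs_scoreDeriv_sub_le_envelope
  have henv : ∀ T, 32 ≤ y T → ∀ k, 0 ≤ scoreEnvelope (y T) k := fun T h k =>
    zero_le_one.trans (one_le_scoreEnvelope (by linarith) k)
  refine asympStandardNormal_oneStep hmodel hΔ hϑ (y := y) (fun _ => rfl) (n := n) (fun _ => rfl) hn
    (hsmall _ C₄ (fun T => integral_nonneg fun k => by positivity)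
      (hy32.mono fun T h => h4 _ (by linarith)))
    (hsmall _ C₂ (fun T => integral_nonneg fun k => by positivity)
      (hy32.mono fun T h => h2 _ (by linarith)))
    (B := 4) ?_
    (M := fun T k => 38 / y T ^ 2 * scoreEnvelope (y T) k)
    (R := fun T k => C / y T ^ 3 * scoreEnvelope (y T) k ^ 2)
    (fun T => (polyGrowth_scoreEnvelope _).const_mul _)
    (fun T => ((polyGrowth_scoreEnvelope _).pow 2).const_mul _) ?_ ?_
    (C := 4 * (3040 * 38)) ?_ ?_ ?_ ?_
  · filter_upwards [hy32, hJu] with T h1 h2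
    have hJ := skellamInfo_pos (show 0 < y T by linarith)
    calc _ ≤ skellamInfo (y T) * (4 * y T ^ 2) := by
          gcongr
          nlinarith
      _ ≤ 4 := by linarith
  · filter_upwards [hy32] with T h1 k
    have := henv T h1 k
    positivity
  · filter_upwards [hy32] with T h1 k
    have : 0 < y T := by linarith
    positivity
  · filter_upwards [hy32, hJl] with T h1 h2
    have h0 : 0 < y T := by linarith
    refine (le_abs_self _).trans ((integral_le_of_abs_le_envelope (c := 38 / y T ^ 2)
      (by linarith) (by positivity) fun k => ?_).trans ?_)
    · have := henv T h1 k
      rw [abs_of_nonneg (by positivity)]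
      gcongr
      exact le_self_pow₀ (one_le_scoreEnvelope h0 k) (by norm_num)
    · rw [← mul_div_assoc, div_le_iff₀ (by positivity)]
      linarith
  -- The remainder has mean O(y⁻³), and dividing by J ≥ 1/(4y²) leaves O(1/y). This is where y → ∞
  -- is essential.
  · have h1 : Tendsto (fun T => 4 * (3040 * C) / y T) atTop (𝓝 0) :=
      tendsto_const_nhds.div_atTop hy
    refine squeeze_zero' ?_ ?_ h1
    · filter_upwards [hy32] with T h1
      have h0 : 0 < y T := by linarith
      exact div_nonneg (integral_nonneg fun k => by positivity) (skellamInfo_pos h0).le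
    · filter_upwards [hy32, hJl] with T h1 h2
      have h0 : 0 < y T := by linarith
      have hJ := skellamInfo_pos h0
      have h3 : ∫ k, C / y T ^ 3 * scoreEnvelope (y T) k ^ 2 ∂skellamMeasure (y T) ≤
          3040 * (C / y T ^ 3) := by
        refine (le_abs_self _).trans (integral_le_of_abs_le_envelope (by linarith)
          (by positivity) fun k => ?_)
        rw [abs_of_nonneg (by positivity)]
        gcongr
        · exact one_le_scoreEnvelope h0 k
        · norm_num
      rw [div_le_div_iff₀ hJ h0]
      calc _ ≤ 3040 * (C / y T ^ 3) * y T := by gcongr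
        _ = 3040 * C / y T ^ 2 * 1 := by field_simp
        _ ≤ 3040 * C / y T ^ 2 * (4 * (y T ^ 2 * skellamInfo (y T))) := by gcongr
        _ = _ := by field_simp
  · filter_upwards [hy32] with T h1 z hz k
    have := abs_le.1 hz
    exact hd z (y T) h1 (by linarith) (by linarith) k
  · refine tendsto_atTop_mono' _ ?_ (hn.const_mul_atTop (show (0 : ℝ) < 1 / 4 by norm_num))
    filter_upwards [hJl] with T h1
    calc 1 / 4 * (n T : ℝ) ≤ (y T ^ 2 * skellamInfo (y T)) * n T := by
          gcongr
          linarith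
      _ = _ := by ring

/-- The information, the Fisher information, and any asymptotically equivalent normalisation may be
used interchangeably. -/
lemma asympStandardNormal_normalisations (hmodel : ∀ ϑ : ℝ, 0 < ϑ → IsModel N ε ϑ (P ϑ))
    (hΔ : ∀ T : ℝ≥0, 0 < T → 0 < Δ T ∧ Δ T ≤ T) (hϑ : 0 < ϑ)
    (hu : Tendsto (fun T : ℝ≥0 => (T : ℝ) / (Δ T : ℝ)) atTop atTop)
    (h : AsympStandardNormal (P ϑ)
      (fun T => numObs T (Δ T) * (Δ T : ℝ) ^ 2 * skellamInfo (ϑ * Δ T))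
      (fun T => oneStep P (process N ε) T (Δ T)) ϑ) {b : ℝ≥0 → ℝ}
    (hb : Tendsto (fun T => b T / (T * Δ T * skellamInfo (ϑ * Δ T))) atTop (𝓝 1)) :
    AsympStandardNormal (P ϑ) (fun T => information P (process N ε) T (Δ T) ϑ)
      (fun T => oneStep P (process N ε) T (Δ T)) ϑ ∧
    AsympStandardNormal (P ϑ) (fun T => fisherInformation P (process N ε) T (Δ T) ϑ)
      (fun T => oneStep P (process N ε) T (Δ T)) ϑ ∧
    AsympStandardNormal (P ϑ) b (fun T => oneStep P (process N ε) T (Δ T)) ϑ := by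
  have hX := measurable_process (hmodel ϑ hϑ).poisson.measurable (hmodel ϑ hϑ).jump_measurable
  have hm : ∀ T, AEMeasurable (oneStep P (process N ε) T (Δ T)) (P ϑ) := fun T =>
    (measurable_oneStep hX T (Δ T)).aemeasurable
  have hr := tendsto_numObs_div hu
  have hpos : ∀ᶠ T : ℝ≥0 in atTop, (0 : ℝ) < T ∧ (0 : ℝ) < Δ T ∧ 0 < skellamInfo (ϑ * Δ T) := by
    filter_upwards [eventually_gt_atTop 0] with T hT
    have h1 : (0 : ℝ) < Δ T := by exact_mod_cast (hΔ T hT).1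
    exact ⟨by exact_mod_cast hT, h1, skellamInfo_pos (mul_pos hϑ h1)⟩
  have hn : ∀ᶠ T in atTop, (0 : ℝ) < numObs T (Δ T) := by
    filter_upwards [hr.eventually_const_lt zero_lt_one, hpos] with T h1 h2
    by_contra hn
    have : (numObs T (Δ T) : ℝ) = 0 := le_antisymm (not_lt.1 hn) (by positivity)
    simp [this] at h1
  have ha : ∀ᶠ T in atTop, 0 < numObs T (Δ T) * (Δ T : ℝ) ^ 2 * skellamInfo (ϑ * Δ T) := by
    filter_upwards [hpos, hn] with T h1 h2
    obtain ⟨h3, h4, h5⟩ := h1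
    positivity
  have hi : AsympStandardNormal (P ϑ) (fun T => T * Δ T * skellamInfo (ϑ * Δ T))
      (fun T => oneStep P (process N ε) T (Δ T)) ϑ := by
    -- The quotient of the two normalisations is (T/Δ)/⌊T/Δ⌋.
    refine h.congr_normalisation hm ha ?_
    have h1 := hr.inv₀ one_ne_zero
    rw [inv_one] at h1
    refine h1.congr' ?_
    filter_upwards [hpos, hn] with T h2 h3
    obtain ⟨h4, h5, h6⟩ := h2
    generalize skellamInfo (ϑ * Δ T) = J at h6
    field_simp
  refine ⟨?_, ?_, hi.congr_normalisation hm (hpos.mono fun T h1 =>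
    mul_pos (mul_pos h1.1 h1.2.1) h1.2.2) hb⟩
  · simp only [information_eq hmodel _ hϑ]
    exact hi
  · refine h.congr_normalisation hm ha (tendsto_const_nhds.congr' ?_)
    filter_upwards [ha, eventually_gt_atTop 0] with T h1 h2
    rw [fisherInformation_eq hmodel (hΔ T h2).1 hϑ, div_self h1.ne']

end Model

end TimeScales

end

/-! ### The theorem in its three regimes. -/

theorem theorem6 {Ω : Type*} [MeasurableSpace Ω]
    (P : ℝ → Measure Ω) [∀ ϑ, IsProbabilityMeasure (P ϑ)]
    (N : ℝ≥0 → Ω → ℕ) (ε : ℕ → Ω → ℤ)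
    (hmodel : ∀ ϑ : ℝ, 0 < ϑ → TimeScales.IsModel N ε ϑ (P ϑ))
    (Δ : ℝ≥0 → ℝ≥0) (hΔ : ∀ T : ℝ≥0, 0 < T → 0 < Δ T ∧ Δ T ≤ T)
    (ϑ : ℝ) (hϑ : 0 < ϑ) :
    let X := TimeScales.process N ε
    let Y : ℝ≥0 → Ω → ℝ := fun T => TimeScales.oneStep P X T (Δ T)
    -- microscopic regime
    (TimeScales.IsMicroscopic Δ →
      TimeScales.AsympStandardNormal (P ϑ) (fun T => TimeScales.information P X T (Δ T) ϑ) Y ϑ ∧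
      TimeScales.AsympStandardNormal (P ϑ)
        (fun T => TimeScales.fisherInformation P X T (Δ T) ϑ) Y ϑ ∧
      TimeScales.AsympStandardNormal (P ϑ) (fun T => (T : ℝ) / ϑ) Y ϑ) ∧
    -- intermediate regime
    (∀ Δinf : ℝ≥0, TimeScales.IsIntermediate Δ Δinf →
      TimeScales.AsympStandardNormal (P ϑ) (fun T => TimeScales.information P X T (Δ T) ϑ) Y ϑ ∧
      TimeScales.AsympStandardNormal (P ϑ)
        (fun T => TimeScales.fisherInformation P X T (Δ T) ϑ) Y ϑ ∧
      TimeScales.AsympStandardNormal (P ϑ) (fun T => TimeScales.information P X T Δinf ϑ) Y ϑ) ∧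
    -- macroscopic regime
    (TimeScales.IsMacroscopic Δ →
      TimeScales.AsympStandardNormal (P ϑ) (fun T => TimeScales.information P X T (Δ T) ϑ) Y ϑ ∧
      TimeScales.AsympStandardNormal (P ϑ)
        (fun T => TimeScales.fisherInformation P X T (Δ T) ϑ) Y ϑ ∧
      TimeScales.AsympStandardNormal (P ϑ)
        (fun T => (T : ℝ) / (Δ T : ℝ) / (2 * ϑ ^ 2)) Y ϑ) := by
  intro X Y
  have hpos : ∀ᶠ T : ℝ≥0 in atTop, (0 : ℝ) < T ∧ (0 : ℝ) < Δ T ∧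
      0 < TimeScales.skellamInfo (ϑ * Δ T) := by
    filter_upwards [eventually_gt_atTop 0] with T hT
    have h1 : (0 : ℝ) < Δ T := by exact_mod_cast (hΔ T hT).1
    exact ⟨by exact_mod_cast hT, h1, TimeScales.skellamInfo_pos (mul_pos hϑ h1)⟩
  have hubdd : ∀ B : ℝ, 0 < B → (∀ᶠ T : ℝ≥0 in atTop, (Δ T : ℝ) ≤ B) →
      Tendsto (fun T : ℝ≥0 => (T : ℝ) / (Δ T : ℝ)) atTop atTop := by
    intro B hB hΔB
    refine tendsto_atTop_mono' _ ?_ (TimeScales.tendsto_coe_atTop.atTop_div_const hB)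
    filter_upwards [hΔB, hpos] with T h1 h2
    obtain ⟨h3, h4, -⟩ := h2
    gcongr
  refine ⟨fun hmic => ?_, fun Δinf hint => ?_, fun hmac => ?_⟩
  · have h0 : Tendsto (fun T => (Δ T : ℝ)) atTop (𝓝 0) := by
      rw [← NNReal.coe_zero]
      exact NNReal.tendsto_coe.2 hmic
    have hΔ1 := (h0.eventually_lt_const one_pos).mono fun T h => h.le
    have hu := hubdd 1 one_pos hΔ1
    have hy0 : Tendsto (fun T => ϑ * (Δ T : ℝ)) atTop (𝓝[>] 0) := by
      refine tendsto_nhdsWithin_iff.2 ⟨by simpa using h0.const_mul ϑ, ?_⟩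
      filter_upwards [hpos] with T hT
      exact mul_pos hϑ hT.2.1
    have hJ := TimeScales.tendsto_mul_skellamInfo_zero.comp hy0
    -- With y = ϑΔ, the limit yJ(y) → 1 supplies the lower bound 1/2, and (T/ϑ)/(TΔJ) = 1/(yJ).
    refine TimeScales.asympStandardNormal_normalisations hmodel hΔ hϑ hu
      (TimeScales.asympStandardNormal_oneStep_of_bounded hmodel hΔ hϑ hu (B := ϑ) (c := 1 / 2)
        ?_ (by norm_num) ?_) ?_
    · filter_upwards [hΔ1] with T hT
      exact mul_le_of_le_one_right hϑ.le hT
    · exact (hJ.eventually_const_lt (show (1 / 2 : ℝ) < 1 by norm_num)).mono fun T h => h.le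
    · have h1 := hJ.inv₀ one_ne_zero
      rw [inv_one] at h1
      refine h1.congr' ?_
      filter_upwards [hpos] with T hT
      obtain ⟨h3, h4, h5⟩ := hT
      simp only [Function.comp]
      field_simp
  · have h0 : Tendsto (fun T => (Δ T : ℝ)) atTop (𝓝 (Δinf : ℝ)) := NNReal.tendsto_coe.2 hint.2
    have hinf : (0 : ℝ) < Δinf := by exact_mod_cast hint.1
    have hΔ1 := (h0.eventually_lt_const (lt_add_one (Δinf : ℝ))).mono fun T h => h.le
    have hu := hubdd (Δinf + 1) (by positivity) hΔ1
    have hy0 := h0.const_mul ϑ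
    have hyinf : 0 < ϑ * (Δinf : ℝ) := mul_pos hϑ hinf
    have hJinf := TimeScales.skellamInfo_pos hyinf
    have hJ := (TimeScales.continuousAt_skellamInfo hyinf).tendsto.comp hy0
    -- Continuity of J supplies both the lower bound, half the limit of yJ(y), and the equivalence
    -- of the normalisations at Δ_T and at its limit.
    refine TimeScales.asympStandardNormal_normalisations hmodel hΔ hϑ hu
      (TimeScales.asympStandardNormal_oneStep_of_bounded hmodel hΔ hϑ hu (B := ϑ * (Δinf + 1))
        (c := ϑ * Δinf * TimeScales.skellamInfo (ϑ * Δinf) / 2) ?_ (by positivity) ?_) ?_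
    · filter_upwards [hΔ1] with T hT
      gcongr
    · exact ((hy0.mul hJ).eventually_const_lt (half_lt_self (mul_pos hyinf hJinf))).mono
        fun T h => h.le
    · simp only [X, TimeScales.information_eq hmodel _ hϑ]
      have h1 := (tendsto_const_nhds (x := (Δinf : ℝ) * TimeScales.skellamInfo (ϑ * Δinf))).div
        (h0.mul hJ) (mul_pos hinf hJinf).ne'
      rw [div_self (mul_pos hinf hJinf).ne'] at h1
      refine h1.congr' ?_
      filter_upwards [hpos] with T hT
      obtain ⟨h3, h4, h5⟩ := hT
      simp only [Function.comp, Pi.div_apply]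
      generalize TimeScales.skellamInfo (ϑ * Δ T) = J at h5
      field_simp
  · have h0 : Tendsto (fun T => (Δ T : ℝ)) atTop atTop := NNReal.tendsto_coe_atTop.2 hmac.1
    have hu : Tendsto (fun T : ℝ≥0 => (T : ℝ) / (Δ T : ℝ)) atTop atTop := by
      exact_mod_cast NNReal.tendsto_coe_atTop.2 hmac.2
    have hy := h0.const_mul_atTop hϑ
    have hJ := TimeScales.tendsto_mul_skellamInfo_atTop.comp hy
    refine TimeScales.asympStandardNormal_normalisations hmodel hΔ hϑ hu
      (TimeScales.asympStandardNormal_oneStep_of_macroscopic hmodel hΔ hϑ hu hy) ?_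
    -- Here the quotient of normalisations is 1/(2y²J(y)).
    have h1 := hJ.inv₀ one_ne_zero
    rw [inv_one] at h1
    refine h1.congr' ?_
    filter_upwards [hpos] with T hT
    obtain ⟨h3, h4, h5⟩ := hT
    simp only [Function.comp]
    field_simp
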